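/- All graphs are finite, simple and undirected. A path or cycle is chordless if it has no edge between two of its non-consecutive vertices; a hole is a chordless cycle of length at least $4$. - A long prism is a graph made of three vertex-disjoint chordless paths $a_i\dots b_i$ ($i=1,2,3$) of length at least $1$, at least one of length at least $2$, such that $\{a_1,a_2,a_3\}$ and $\{b_1,b_2,b_3\}$ are triangles and there are no other edges between the paths. - A pyramid is a graph made of three chordless paths $a\dots b_i$ ($i=1,2,3$) of length at least $1$, two of which have length at least $2$, vertex-disjoint except at $a$, such that $\{b_1,b_2,b_3\}$ is a triangle and there are no edges between the paths other than those of the triangle and the three edges incident to $a$. - A theta is a graph made of three internally vertex-disjoint chordless paths from $a$ to $b$ of length at least $2$, with no edges between the paths other than the three edges incident to $a$ and the three edges incident to $b$. - A wheel $(H,x)$ is a graph formed by a hole $H$ and a vertex $x\notin H$ with at least three neighbors in $H$. A sector of $(H,x)$ is a path of $H$ of length at least $1$ whose endpoints are neighbors of $x$ and whose internal vertices are not. A wheel is broken if at least two of its sectors have length at least $2$. There is an algorithm which, given a graph $G$ with $n$ vertices and $m$ edges that contains no long prism, no pyramid and no theta as an induced subgraph, decides in time $O(n^{13}(n+m))$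 whether $G$ contains a broken wheel as an induced subgraph. Here the machine is a word RAM with unit-cost operations on words of $O(\log n)$ bits, and $G$ is given by adjacency lists, in arbitrary order. -/

import Mathlib

/-! ### Three-path-configurations and broken wheels, as induced subgraphs -/

namespace SimpleGraph

variable {V : Type*}

/-- `G` contains a long prism as an induced subgraph: three pairwise vertex-disjoint chordless
paths `P 0`, `P 1`, `P 2` of lengths at least `1`, at least one of them of length at least `2`,
whose first vertices form a triangle, whose last vertices form a triangle, and with no other
edges between two of the paths. A chordless path of length `l` in `G` is an induced embedding of
the path graph on `l + 1` vertices. -/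
def HasLongPrism (G : SimpleGraph V) : Prop :=
  ∃ (l : Fin 3 → ℕ) (P : ∀ i, pathGraph (l i + 1) ↪g G),
    (∀ i, 1 ≤ l i) ∧ (∃ i, 2 ≤ l i) ∧
    ∀ i j, i ≠ j → ∀ s t,
      P i s ≠ P j t ∧
      (G.Adj (P i s) (P j t) ↔
        (s = 0 ∧ t = 0) ∨ (s = Fin.last (l i) ∧ t = Fin.last (l j)))

/-- `G` contains a pyramid as an induced subgraph: three chordless paths of lengths at least `1`,
two of which have length at least `2`, with a common first vertex (the apex), vertex-disjoint
otherwise, whose last vertices form a triangle, and with no other edges between two of the paths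
except for those incident to the apex (which belong to the paths). -/
def HasPyramid (G : SimpleGraph V) : Prop :=
  ∃ (l : Fin 3 → ℕ) (P : ∀ i, pathGraph (l i + 1) ↪g G),
    (∀ i, 1 ≤ l i) ∧ (∃ i j, i ≠ j ∧ 2 ≤ l i ∧ 2 ≤ l j) ∧
    ∀ i j, i ≠ j → ∀ s t,
      (P i s = P j t ↔ s = 0 ∧ t = 0) ∧
      (s ≠ 0 → t ≠ 0 →
        (G.Adj (P i s) (P j t) ↔ s = Fin.last (l i) ∧ t = Fin.last (l j)))

/-- `G` contains a theta as an induced subgraph: three chordless paths of lengths at least `2`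
with the same first vertex and the same last vertex (the apices), internally vertex-disjoint,
with no edges between the interiors of two of the paths. -/
def HasTheta (G : SimpleGraph V) : Prop :=
  ∃ (l : Fin 3 → ℕ) (P : ∀ i, pathGraph (l i + 1) ↪g G),
    (∀ i, 2 ≤ l i) ∧
    ∀ i j, i ≠ j → ∀ s t,
      (P i s = P j t ↔ (s = 0 ∧ t = 0) ∨ (s = Fin.last (l i) ∧ t = Fin.last (l j))) ∧
      (s ≠ 0 → s ≠ Fin.last (l i) → t ≠ 0 → t ≠ Fin.last (l j) → ¬ G.Adj (P i s) (P j t))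

/-- `h` lists in cyclic order the vertices of a hole of `G`, that is, of a chordless cycle of
length `k ≥ 4`. -/
structure IsHole (G : SimpleGraph V) {k : ℕ} (h : ZMod k → V) : Prop where
  four_le : 4 ≤ k
  injective : Function.Injective h
  adj_iff : ∀ i j, G.Adj (h i) (h j) ↔ j = i + 1 ∨ i = j + 1

/-- `(h, x)` is a wheel of `G` with rim `h` and center `x`: the vertex `x` is outside of the hole
`h` and has at least three neighbors in it. -/
structure IsWheel (G : SimpleGraph V) {k : ℕ} (h : ZMod k → V) (x : V) : Prop where
  isHole : G.IsHole h
  notMem : ∀ i, h i ≠ x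
  three_le : 3 ≤ {i | G.Adj x (h i)}.ncard

/-- The subpath `h i, h (i + 1), …, h (i + l)` of the rim, of length `l`, is a sector of `(h, x)`:
its endpoints are neighbors of `x` and its internal vertices are not. -/
structure IsSector (G : SimpleGraph V) {k : ℕ} (h : ZMod k → V) (x : V) (i : ZMod k) (l : ℕ) :
    Prop where
  one_le : 1 ≤ l
  lt : l < k
  adj_first : G.Adj x (h i)
  adj_last : G.Adj x (h (i + l))
  not_adj : ∀ j : ℕ, 0 < j → j < l → ¬ G.Adj x (h (i + j))

/-- `(h, x)` is a broken wheel of `G`: a wheel with at least two sectors of length at least `2`.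
Sectors are told apart by their first vertices in the cyclic order. -/
def IsBrokenWheel (G : SimpleGraph V) {k : ℕ} (h : ZMod k → V) (x : V) : Prop :=
  G.IsWheel h x ∧
    ∃ i i' l l', i ≠ i' ∧ 2 ≤ l ∧ 2 ≤ l' ∧ G.IsSector h x i l ∧ G.IsSector h x i' l'

/-- `G` contains a broken wheel as an induced subgraph. -/
def HasBrokenWheel (G : SimpleGraph V) : Prop :=
  ∃ (k : ℕ) (h : ZMod k → V) (x : V), G.IsBrokenWheel h x

end SimpleGraph

/-! ### Word RAM programs with unit-cost operations -/

namespace WordRAM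

/-- The memory of the machine: registers `var 0, var 1, …`, and random-access arrays
`arr 0, arr 1, …` of words. A given program mentions only finitely many of them. -/
structure State where
  var : ℕ → ℕ
  arr : ℕ → ℕ → ℕ

/-- Expressions: constants, registers, array cells (with a computed index), addition,
subtraction, multiplication, and the comparisons `<` and `=`. -/
inductive Expr where
  | const (c : ℕ)
  | var (x : ℕ)
  | read (a : ℕ) (i : Expr)
  | add (e f : Expr)
  | sub (e f : Expr)
  | mul (e f : Expr)
  | lt (e f : Expr)
  | eq (e f : Expr)

/-- The value of an expression on a machine with words of `w` bits: results are reduced modulo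
`2 ^ w`, subtraction is truncated at `0`, and comparisons return `1` or `0`. -/
def Expr.eval (w : ℕ) (s : State) : Expr → ℕ
  | const c => c % 2 ^ w
  | var x => s.var x
  | read a i => s.arr a (i.eval w s)
  | add e f => (e.eval w s + f.eval w s) % 2 ^ w
  | sub e f => e.eval w s - f.eval w s
  | mul e f => (e.eval w s * f.eval w s) % 2 ^ w
  | lt e f => if e.eval w s < f.eval w s then 1 else 0
  | eq e f => if e.eval w s = f.eval w s then 1 else 0

/-- The number of elementary operations in the evaluation of an expression. -/
def Expr.cost : Expr → ℕ
  | const _ => 1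
  | var _ => 1
  | read _ i => i.cost + 1
  | add e f => e.cost + f.cost + 1
  | sub e f => e.cost + f.cost + 1
  | mul e f => e.cost + f.cost + 1
  | lt e f => e.cost + f.cost + 1
  | eq e f => e.cost + f.cost + 1

/-- Programs: assignments to a register, assignments to an array cell, sequential composition,
conditionals, and while-loops. -/
inductive Program where
  | skip
  | assign (x : ℕ) (e : Expr)
  | write (a : ℕ) (i e : Expr)
  | seq (p q : Program)
  | ite (e : Expr) (p q : Program)
  | loop (e : Expr) (p : Program)

/-- `Exec w p s t s'`: on a machine with words of `w` bits, the program `p` started in the state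
`s` halts after exactly `t` elementary steps in the state `s'`. -/
inductive Exec (w : ℕ) : Program → State → ℕ → State → Prop where
  | skip (s : State) : Exec w .skip s 1 s
  | assign (x : ℕ) (e : Expr) (s : State) :
      Exec w (.assign x e) s (e.cost + 1)
        { s with var := Function.update s.var x (e.eval w s) }
  | write (a : ℕ) (i e : Expr) (s : State) :
      Exec w (.write a i e) s (i.cost + e.cost + 1)
        { s with
          arr := Function.update s.arr a
            (Function.update (s.arr a) (i.eval w s) (e.eval w s)) }
  | seq {p q : Program} {s s₁ s₂ : State} {t₁ t₂ : ℕ} :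
      Exec w p s t₁ s₁ → Exec w q s₁ t₂ s₂ → Exec w (.seq p q) s (t₁ + t₂) s₂
  | ite_true {e : Expr} {p q : Program} {s s' : State} {t : ℕ} :
      e.eval w s ≠ 0 → Exec w p s t s' → Exec w (.ite e p q) s (e.cost + 1 + t) s'
  | ite_false {e : Expr} {p q : Program} {s s' : State} {t : ℕ} :
      e.eval w s = 0 → Exec w q s t s' → Exec w (.ite e p q) s (e.cost + 1 + t) s'
  | loop_false {e : Expr} {p : Program} {s : State} :
      e.eval w s = 0 → Exec w (.loop e p) s (e.cost + 1) s
  | loop_true {e : Expr} {p : Program} {s s₁ s₂ : State} {t₁ t₂ : ℕ} :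
      e.eval w s ≠ 0 → Exec w p s t₁ s₁ → Exec w (.loop e p) s₁ t₂ s₂ →
        Exec w (.loop e p) s (e.cost + 1 + t₁ + t₂) s₂

/-- `L` is a system of adjacency lists of `G`: the list `L u` enumerates the neighbors of `u`,
each exactly once, in an arbitrary order. -/
def IsAdjLists {n : ℕ} (G : SimpleGraph (Fin n)) (L : Fin n → List (Fin n)) : Prop :=
  ∀ u, (L u).Nodup ∧ ∀ v, v ∈ L u ↔ G.Adj u v

/-- The initial state of the machine on the adjacency lists `L` of a graph with vertices
`0, …, n - 1`: register `0` holds `n`; array `1` holds the lists `L 0, L 1, …, L (n - 1)` one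
after another; cell `i ≤ n` of array `0` holds the total length of the lists `L u` with `u < i`,
so that `L u` occupies the cells of array `1` from `arr 0 u` (included) to `arr 0 (u + 1)`
(excluded). The rest of the memory is `0`. -/
def input {n : ℕ} (L : Fin n → List (Fin n)) : State where
  var x := if x = 0 then n else 0
  arr a i :=
    if a = 0 then
      if i ≤ n then ∑ u : Fin n with u.val < i, (L u).length else 0
    else if a = 1 then (((List.ofFn L).flatten).map Fin.val).getD i 0
    else 0

end WordRAM

/-!
A broken wheel with center `x` is described by a *frame* (`SimpleGraph.Frame`): four neighbors
`a`, `b`, `c`, `d` of `x` on the rim and four connected sets of vertices, which play the roles of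
the interiors of two long sectors, from `a` to `b` and from `c` to `d`, and of the two parts of
the rim that link them, from `b` to `c` and from `d` to `a`. Each set is attached to the others
only where the rim requires it. Frames and broken wheels are equivalent
(`SimpleGraph.Frame.hasBrokenWheel`, `SimpleGraph.HasBrokenWheel.exists_frame`), as shortest paths
through the four sets form a hole. In the same way thetas, pyramids and long prisms are found from
connected sets with prescribed attachments (`SimpleGraph.hasTheta_of_sets`,
`SimpleGraph.hasPyramid_of_sets`, `SimpleGraph.hasLongPrism_of_sets`).

Let `G` contain no theta, no pyramid and no long prism. If three pairwise nonadjacent neighbors of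
`x` are attached to the same component of the non-neighbors of `x`, then `G` contains a broken
wheel (`SimpleGraph.hasBrokenWheel_of_triple`). If there is no such triple, but a broken wheel,
choose a frame whose two sector sets are as large as possible. Then the first sector set is a
component of an explicit set of vertices, which depends on `x`, `a`, `b`, `c`, `d` only, the second
one is a component of such a set once the first is removed with its neighbors, and the components
of `b` and of `a` in what remains link the sectors (`SimpleGraph.Frame.mem_of_touches`,
`SimpleGraph.Frame.sep_of_maximal`): a vertex or path that contradicts this gives a theta, a
pyramid, a long prism or a larger frame. So a greedy computation recovers a frame from `x`, `a`,
`b`, `c`, `d` and one vertex in each of the two sectors. This makes the existence of a broken wheel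
equivalent to the existence of seven vertices that pass one of two tests, each of which computes a
bounded number of components (`SimpleGraph.hasBrokenWheel_iff_cert`).

The algorithm runs through all choices of seven vertices. It is written in a language whose only
loops run over the vertices, so that its running time is `O((n + 1) ^ k)` with `k` the nesting
depth of its loops (`WordRAM.Cmd.exec_eval`). A component is computed by `n` rounds of
propagation along the entries of the adjacency matrix, with three nested loops. The depth is
`7 + 3 = 10`, and `n ^ 10` is within the bound as `n + m ≥ n`.
-/

/-! ### Connected vertex sets and induced paths -/

namespace SimpleGraph

variable {V : Type*} {G : SimpleGraph V}

/-- The vertices `p 0, …, p l` form, in this order, an induced path of `G`. The values of `p`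
beyond `l` are irrelevant. -/
def IndPath (G : SimpleGraph V) (p : ℕ → V) (l : ℕ) : Prop :=
  ∀ i ≤ l, ∀ j ≤ l, (p i = p j → i = j) ∧ (G.Adj (p i) (p j) ↔ i + 1 = j ∨ j + 1 = i)

/-- Any two vertices of `X` are joined by a walk inside `X`. The empty set qualifies. -/
def Conn (G : SimpleGraph V) (X : Set V) : Prop :=
  ∀ u ∈ X, ∀ v ∈ X, Relation.ReflTransGen (fun p q => G.Adj p q ∧ p ∈ X ∧ q ∈ X) u v

/-- The vertex sets `X` and `Y` are disjoint and there is no edge between them. -/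
def Sep (G : SimpleGraph V) (X Y : Set V) : Prop :=
  ∀ u ∈ X, ∀ v ∈ Y, u ≠ v ∧ ¬ G.Adj u v

/-- The vertices `p k` with `i ≤ k < j`. -/
def seg (p : ℕ → V) (i j : ℕ) : Set V := {v | ∃ k, i ≤ k ∧ k < j ∧ v = p k}

/-- The vertex `u` has a neighbor in `X`. -/
def Touches (G : SimpleGraph V) (u : V) (X : Set V) : Prop := ∃ w ∈ X, G.Adj u w

theorem Sep.symm {X Y : Set V} (h : G.Sep X Y) : G.Sep Y X :=
  fun u hu v hv => ⟨(h v hv u hu).1.symm, fun e => (h v hv u hu).2 e.symm⟩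

theorem conn_singleton (v : V) : G.Conn {v} := by
  intro u hu w hw
  rw [Set.mem_singleton_iff] at hu hw
  subst hu; subst hw
  exact .refl

theorem Conn.mono_walk {X Y : Set V} (hXY : X ⊆ Y) {u v : V}
    (h : Relation.ReflTransGen (fun p q => G.Adj p q ∧ p ∈ X ∧ q ∈ X) u v) :
    Relation.ReflTransGen (fun p q => G.Adj p q ∧ p ∈ Y ∧ q ∈ Y) u v :=
  Relation.ReflTransGen.mono (fun _ _ h => ⟨h.1, hXY h.2.1, hXY h.2.2⟩) _ _ h

theorem walk_symm {X : Set V} {u v : V}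
    (h : Relation.ReflTransGen (fun p q => G.Adj p q ∧ p ∈ X ∧ q ∈ X) u v) :
    Relation.ReflTransGen (fun p q => G.Adj p q ∧ p ∈ X ∧ q ∈ X) v u :=
  have : Std.Symm (fun p q => G.Adj p q ∧ p ∈ X ∧ q ∈ X) :=
    ⟨fun _ _ h => ⟨h.1.symm, h.2.2, h.2.1⟩⟩
  Std.Symm.symm _ _ h

theorem conn_of_center {X : Set V} (c : V)
    (h : ∀ u ∈ X, Relation.ReflTransGen (fun p q => G.Adj p q ∧ p ∈ X ∧ q ∈ X) c u) :
    G.Conn X :=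
  fun u hu v hv => (walk_symm (h u hu)).trans (h v hv)

theorem Conn.union {X Y : Set V} (hX : G.Conn X) (hY : G.Conn Y)
    (h : ∃ u ∈ X, ∃ v ∈ Y, u = v ∨ G.Adj u v) : G.Conn (X ∪ Y) := by
  obtain ⟨u, hu, v, hv, huv⟩ := h
  refine conn_of_center u fun w hw => ?_
  rcases hw with hw | hw
  · exact Conn.mono_walk Set.subset_union_left (hX u hu w hw)
  · have h2 := Conn.mono_walk (Set.subset_union_right (s := X)) (hY v hv w hw)
    rcases huv with rfl | huv
    · exact h2
    · exact .head ⟨huv, .inl hu, .inr hv⟩ h2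

theorem Conn.insert_of_touches {X : Set V} (hX : G.Conn X) {u : V} (h : G.Touches u X) :
    G.Conn (insert u X) := by
  obtain ⟨w, hw, hu⟩ := h
  rw [Set.insert_eq]
  exact (conn_singleton u).union hX ⟨u, rfl, w, hw, .inr hu⟩

theorem mem_seg {p : ℕ → V} {i j k : ℕ} (h : i ≤ k) (h' : k < j) : p k ∈ seg p i j :=
  ⟨k, h, h', rfl⟩

theorem conn_seg {p : ℕ → V} {i j : ℕ} (h : ∀ k, i ≤ k → k + 1 < j → G.Adj (p k) (p (k + 1))) :
    G.Conn (seg p i j) := by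
  by_cases hij : i < j
  · refine conn_of_center (p i) ?_
    rintro _ ⟨k, hk, hkj, rfl⟩
    induction k, hk using Nat.le_induction with
    | base => exact .refl
    | succ k hk ih =>
      exact (ih (by omega)).tail
        ⟨h k hk hkj, mem_seg hk (by omega), mem_seg (by omega) hkj⟩
  · rintro _ ⟨k, hk, hkj, rfl⟩
    omega

namespace IndPath

variable {p : ℕ → V} {l : ℕ}

theorem eq_iff (h : G.IndPath p l) {i j : ℕ} (hi : i ≤ l) (hj : j ≤ l) : p i = p j ↔ i = j :=
  ⟨(h i hi j hj).1, fun e => e ▸ rfl⟩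

theorem adj_iff (h : G.IndPath p l) {i j : ℕ} (hi : i ≤ l) (hj : j ≤ l) :
    G.Adj (p i) (p j) ↔ i + 1 = j ∨ j + 1 = i :=
  (h i hi j hj).2

theorem adj_succ (h : G.IndPath p l) {i : ℕ} (hi : i + 1 ≤ l) : G.Adj (p i) (p (i + 1)) :=
  (h.adj_iff (by omega) hi).2 (.inl rfl)

theorem conn_seg (h : G.IndPath p l) {i j : ℕ} (hj : j ≤ l + 1) : G.Conn (seg p i j) :=
  SimpleGraph.conn_seg fun _ _ hk' => h.adj_succ (by omega)

/-- The induced path as an embedding of a path graph. -/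
def toEmbedding (h : G.IndPath p l) : pathGraph (l + 1) ↪g G where
  toFun i := p i
  inj' i j hij := Fin.ext ((h i (by omega) j (by omega)).1 hij)
  map_rel_iff' {i j} := by
    rw [pathGraph_adj]
    exact (h i (by omega) j (by omega)).2

theorem reverse (h : G.IndPath p l) : G.IndPath (fun i => p (l - i)) l := by
  intro i hi j hj
  have := h (l - i) (by omega) (l - j) (by omega)
  refine ⟨fun e => ?_, this.2.trans ?_⟩
  · have := this.1 e
    omega
  · omega

theorem take (h : G.IndPath p l) {k : ℕ} (hk : k ≤ l) : G.IndPath p k :=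
  fun i hi j hj => h i (hi.trans hk) j (hj.trans hk)

end IndPath

theorem exists_walk_fun {X : Set V} {u v : V} (hu : u ∈ X)
    (h : Relation.ReflTransGen (fun p q => G.Adj p q ∧ p ∈ X ∧ q ∈ X) u v) :
    ∃ (l : ℕ) (p : ℕ → V), p 0 = u ∧ p l = v ∧ (∀ i ≤ l, p i ∈ X) ∧
      ∀ i < l, G.Adj (p i) (p (i + 1)) := by
  induction h with
  | refl => exact ⟨0, fun _ => u, rfl, rfl, fun _ _ => hu, by omega⟩
  | @tail b c _ hbc ih =>
    obtain ⟨l, p, h0, hl, hX, ha⟩ := ih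
    refine ⟨l + 1, fun i => if i ≤ l then p i else c, by simp [h0], by simp, ?_, ?_⟩
    · intro i _
      by_cases h : i ≤ l
      · simpa [h] using hX i h
      · simpa [h] using hbc.2.2
    · intro i hi
      by_cases h : i < l
      · simpa [h, Nat.succ_le_iff, h.le] using ha i h
      · obtain rfl : i = l := by omega
        simpa [hl] using hbc.1

/-- A shortest walk inside `X` is an induced path. -/
theorem Conn.exists_indPath {X : Set V} (hX : G.Conn X) {u v : V} (hu : u ∈ X) (hv : v ∈ X) :
    ∃ (l : ℕ) (p : ℕ → V), G.IndPath p l ∧ p 0 = u ∧ p l = v ∧ ∀ i ≤ l, p i ∈ X := by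
  classical
  have hex := exists_walk_fun hu (hX u hu v hv)
  have hmin := fun m hm => Nat.find_min hex (m := m) hm
  obtain ⟨p, h0, hl, hpX, ha⟩ := Nat.find_spec hex
  set l := Nat.find hex
  -- a repetition or a chord would give a shorter walk
  have short : ∀ i j, i < j → j ≤ l → p i ≠ p j ∧ (G.Adj (p i) (p j) → i + 1 = j) := by
    intro i j hij hj
    constructor
    · intro e
      refine hmin (l - (j - i)) (by omega)
        ⟨fun k => if k ≤ i then p k else p (k + (j - i)), by simp [h0], ?_, ?_, ?_⟩
      · by_cases h : l - (j - i) ≤ i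
        · obtain rfl : j = l := by omega
          have : l - (l - i) = i := by omega
          simpa [this, e] using hl
        · dsimp only
          rw [if_neg h, ← hl]
          congr 1
          omega
      · intro k hk
        dsimp only
        split_ifs
        · exact hpX k (by omega)
        · exact hpX _ (by omega)
      · intro k hk
        dsimp only
        by_cases h : k < i
        · rw [if_pos h.le, if_pos (by omega)]
          exact ha k (by omega)
        · rw [if_neg (by omega : ¬ k + 1 ≤ i)]
          by_cases h' : k = i
          · subst h'
            rw [if_pos le_rfl, e]
            have := ha j (by omega)
            rwa [show k + 1 + (j - k) = j + 1 by omega]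
          · rw [if_neg (by omega)]
            have := ha (k + (j - i)) (by omega)
            rwa [show k + 1 + (j - i) = k + (j - i) + 1 by omega]
    · intro e
      by_contra hne
      refine hmin (l - (j - i - 1)) (by omega)
        ⟨fun k => if k ≤ i then p k else p (k + (j - i - 1)), by simp [h0], ?_, ?_, ?_⟩
      · dsimp only
        rw [if_neg (by omega), ← hl]
        congr 1
        omega
      · intro k hk
        dsimp only
        split_ifs
        · exact hpX k (by omega)
        · exact hpX _ (by omega)
      · intro k hk
        dsimp only
        by_cases h : k < i
        · rw [if_pos h.le, if_pos (by omega)]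
          exact ha k (by omega)
        · rw [if_neg (by omega : ¬ k + 1 ≤ i)]
          by_cases h' : k = i
          · subst h'
            rw [if_pos le_rfl]
            rwa [show k + 1 + (j - k - 1) = j by omega]
          · rw [if_neg (by omega)]
            have := ha (k + (j - i - 1)) (by omega)
            rwa [show k + 1 + (j - i - 1) = k + (j - i - 1) + 1 by omega]
  refine ⟨l, p, ?_, h0, hl, hpX⟩
  intro i hi j hj
  rcases lt_trichotomy i j with h | rfl | h
  · refine ⟨fun e => absurd e (short i j h hj).1, fun e => .inl ((short i j h hj).2 e), ?_⟩
    rintro (rfl | rfl)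
    · exact ha i (by omega)
    · omega
  · simp
  · refine ⟨fun e => absurd e.symm (short j i h hi).1,
      fun e => .inr ((short j i h hi).2 e.symm), ?_⟩
    rintro (rfl | rfl)
    · omega
    · exact (ha j (by omega)).symm

/-- An induced path with prescribed ends and interior in a connected set touched by both ends. -/
theorem Conn.exists_indPath_through {X : Set V} (hX : G.Conn X) {u v : V} (huv : u ≠ v)
    (hadj : ¬ G.Adj u v) (tu : G.Touches u X) (tv : G.Touches v X) :
    ∃ (l : ℕ) (p : ℕ → V), 2 ≤ l ∧ G.IndPath p l ∧ p 0 = u ∧ p l = v ∧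
      ∀ i, 0 < i → i < l → p i ∈ X := by
  have hc : G.Conn (insert u (insert v X)) := by
    refine (hX.insert_of_touches tv).insert_of_touches ?_
    obtain ⟨w, hw, h⟩ := tu
    exact ⟨w, .inr hw, h⟩
  obtain ⟨l, p, hp, h0, hl, hpX⟩ := hc.exists_indPath (u := u) (v := v) (.inl rfl) (.inr (.inl rfl))
  have hl0 : l ≠ 0 := fun e => huv (by rw [← h0, ← hl, e])
  have hl1 : l ≠ 1 := fun e => hadj (by rw [← h0, ← hl, e]; exact hp.adj_succ (by omega))
  refine ⟨l, p, by omega, hp, h0, hl, fun i hi hil => ?_⟩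
  rcases hpX i hil.le with h | h | h
  · rw [← h0] at h
    have := (hp i hil.le 0 (by omega)).1 h
    omega
  · rw [← hl] at h
    have := (hp i hil.le l le_rfl).1 h
    omega
  · exact h

/-- A path that leads inside the connected set `D` from `t` to the first vertex adjacent to `W`;
it is listed from the `W`-side. -/
theorem Conn.exists_attaching_path {D W : Set V} (hD : G.Conn D) {t : V} (ht : t ∈ D)
    (htW : t ∉ W) (h : ∃ w ∈ D, w ∈ W ∨ G.Touches w W) :
    ∃ (k : ℕ) (q : ℕ → V), G.IndPath q k ∧ q k = t ∧ (∀ i ≤ k, q i ∈ D ∧ q i ∉ W) ∧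
      ∀ i ≤ k, (G.Touches (q i) W ↔ i = 0) := by
  classical
  obtain ⟨w, hw, hwW⟩ := h
  obtain ⟨l, p, hp, h0, hl, hpD⟩ := hD.exists_indPath ht hw
  have hex : ∃ i, i ≤ l ∧ (p i ∈ W ∨ G.Touches (p i) W) := ⟨l, le_rfl, by rwa [hl]⟩
  obtain ⟨hml, hm⟩ := Nat.find_spec hex
  have hmin := fun i hi => Nat.find_min hex (m := i) hi
  set m := Nat.find hex
  have hnot : ∀ i < m, p i ∉ W ∧ ¬ G.Touches (p i) W := by
    intro i hi
    have := hmin i hi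
    simp only [not_and, not_or] at this
    exact this (by omega)
  have hmW : p m ∉ W := by
    intro hmW
    by_cases h : m = 0
    · rw [h, h0] at hmW
      exact htW hmW
    · have := hp.adj_succ (i := m - 1) (by omega)
      rw [show m - 1 + 1 = m by omega] at this
      exact (hnot (m - 1) (by omega)).2 ⟨_, hmW, this⟩
  refine ⟨m, fun i => p (m - i), (hp.take hml).reverse, by simpa using h0, ?_, ?_⟩
  · intro i hi
    refine ⟨hpD _ (by omega), ?_⟩
    by_cases h : i = 0
    · simpa [h] using hmW
    · exact (hnot _ (by omega)).1
  · intro i hi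
    by_cases h : i = 0
    · simpa [h] using hm.resolve_left hmW
    · simpa [h] using (hnot (m - i) (by omega)).2

/-- The first and the last neighbor of `t` on a path. -/
theorem exists_first_last {p : ℕ → V} {l : ℕ} {t : V} (h : ∃ i ≤ l, G.Adj t (p i)) :
    ∃ i j, i ≤ j ∧ j ≤ l ∧ G.Adj t (p i) ∧ G.Adj t (p j) ∧
      ∀ k ≤ l, G.Adj t (p k) → i ≤ k ∧ k ≤ j := by
  classical
  obtain ⟨k, hk, hkt⟩ := h
  have hex : ∃ i, i ≤ l ∧ G.Adj t (p i) := ⟨k, hk, hkt⟩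
  have h1 := Nat.find_spec hex
  have h2 := Nat.findGreatest_spec (P := fun i => G.Adj t (p i)) hk hkt
  refine ⟨Nat.find hex, Nat.findGreatest (fun i => G.Adj t (p i)) l, ?_, Nat.findGreatest_le l,
    h1.2, h2, fun m hm hmt => ⟨Nat.find_min' hex ⟨hm, hmt⟩, Nat.le_findGreatest hm hmt⟩⟩
  exact (Nat.find_min' hex ⟨hk, hkt⟩).trans (Nat.le_findGreatest hk hkt)

end SimpleGraph

/-! ### Three-path-configurations from connected sets -/

namespace SimpleGraph

variable {V : Type*} {G : SimpleGraph V}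

/-- The vertex sets `X` and `Y` are disjoint and `pq` is the only possible edge between them. -/
def SepExcept (G : SimpleGraph V) (X Y : Set V) (p q : V) : Prop :=
  ∀ u ∈ X, ∀ v ∈ Y, u ≠ v ∧ (G.Adj u v → u = p ∧ v = q)

theorem SepExcept.symm {X Y : Set V} {p q : V} (h : G.SepExcept X Y p q) :
    G.SepExcept Y X q p :=
  fun u hu v hv => ⟨(h v hv u hu).1.symm, fun e => ((h v hv u hu).2 e.symm).symm⟩

/-- The interiors of the three paths of a theta may be given as connected sets. -/
theorem hasTheta_of_sets {u v : V} (huv : u ≠ v) (hadj : ¬ G.Adj u v) {X Y Z : Set V}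
    (hX : G.Conn X) (hY : G.Conn Y) (hZ : G.Conn Z)
    (uX : G.Touches u X) (uY : G.Touches u Y) (uZ : G.Touches u Z)
    (vX : G.Touches v X) (vY : G.Touches v Y) (vZ : G.Touches v Z)
    (XY : G.Sep X Y) (XZ : G.Sep X Z) (YZ : G.Sep Y Z) : G.HasTheta := by
  let W : Fin 3 → Set V := ![X, Y, Z]
  have hsep : ∀ i j, i ≠ j → G.Sep (W i) (W j) := by
    intro i j hij
    fin_cases i <;> fin_cases j <;>
      first
        | exact absurd rfl hij
        | exact XY
        | exact XZ
        | exact YZ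
        | exact XY.symm
        | exact XZ.symm
        | exact YZ.symm
  have hex : ∀ i, ∃ (l : ℕ) (p : ℕ → V), 2 ≤ l ∧ G.IndPath p l ∧ p 0 = u ∧ p l = v ∧
      ∀ s, 0 < s → s < l → p s ∈ W i := by
    intro i
    fin_cases i
    · exact hX.exists_indPath_through huv hadj uX vX
    · exact hY.exists_indPath_through huv hadj uY vY
    · exact hZ.exists_indPath_through huv hadj uZ vZ
  choose l p hl hp h0 hlast hW using hex
  refine ⟨l, fun i => (hp i).toEmbedding, hl, fun i j hij s t => ?_⟩
  have hs := s.2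
  have ht := t.2
  have hli := hl i
  have hlj := hl j
  change (p i s = p j t ↔ _) ∧ (_ → _ → _ → _ → ¬ G.Adj (p i s) (p j t))
  simp only [ne_eq, Fin.ext_iff, Fin.val_zero, Fin.val_last]
  generalize (s : ℕ) = s at *
  generalize (t : ℕ) = t at *
  have hin : ∀ i s, s ≤ l i → s = 0 ∨ s = l i ∨ p i s ∈ W i := fun i s h => by
    by_cases h1 : s = 0
    · exact .inl h1
    · by_cases h2 : s = l i
      · exact .inr (.inl h2)
      · exact .inr (.inr (hW i s (by omega) (by omega)))
  refine ⟨⟨fun e => ?_, ?_⟩, fun h1 h2 h3 h4 => ?_⟩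
  · rcases hin i s (by omega) with h | h | h
    · have : p j t = p j 0 := by rw [← e, h, h0, h0]
      exact .inl ⟨h, ((hp j) t (by omega) 0 (by omega)).1 this⟩
    · have : p j t = p j (l j) := by rw [← e, h, hlast, hlast]
      exact .inr ⟨h, ((hp j) t (by omega) (l j) (by omega)).1 this⟩
    · rcases hin j t (by omega) with h' | h' | h'
      · have : p i s = p i 0 := by rw [e, h', h0, h0]
        exact .inl ⟨((hp i) s (by omega) 0 (by omega)).1 this, h'⟩
      · have : p i s = p i (l i) := by rw [e, h', hlast, hlast]
        exact .inr ⟨((hp i) s (by omega) (l i) (by omega)).1 this, h'⟩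
      · exact absurd e (hsep i j hij _ h _ h').1
  · rintro (⟨rfl, rfl⟩ | ⟨rfl, rfl⟩)
    · rw [h0, h0]
    · rw [hlast, hlast]
  · exact (hsep i j hij _ (hW i s (by omega) (by omega)) _ (hW j t (by omega) (by omega))).2

/-- The three paths of a pyramid without their apex `u` may be given as connected sets that
contain the vertices of the triangle. -/
theorem hasPyramid_of_sets {u x y z : V} {X Y Z : Set V}
    (hX : G.Conn X) (hY : G.Conn Y) (hZ : G.Conn Z) (xX : x ∈ X) (yY : y ∈ Y) (zZ : z ∈ Z)
    (ux : u ≠ x) (uy : u ≠ y) (uz : u ≠ z)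
    (uX : G.Touches u X) (uY : G.Touches u Y) (uZ : G.Touches u Z)
    (hux : ¬ G.Adj u x) (huy : ¬ G.Adj u y)
    (xy : G.Adj x y) (xz : G.Adj x z) (yz : G.Adj y z)
    (XY : G.SepExcept X Y x y) (XZ : G.SepExcept X Z x z) (YZ : G.SepExcept Y Z y z) :
    G.HasPyramid := by
  let W : Fin 3 → Set V := ![X, Y, Z]
  let b : Fin 3 → V := ![x, y, z]
  have hsep : ∀ i j, i ≠ j → G.SepExcept (W i) (W j) (b i) (b j) := by
    intro i j hij
    fin_cases i <;> fin_cases j <;>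
      first
        | exact absurd rfl hij
        | exact XY
        | exact XZ
        | exact YZ
        | exact XY.symm
        | exact XZ.symm
        | exact YZ.symm
  have hb : ∀ i j, i ≠ j → G.Adj (b i) (b j) := by
    intro i j hij
    fin_cases i <;> fin_cases j <;>
      first
        | exact absurd rfl hij
        | exact xy
        | exact xz
        | exact yz
        | exact xy.symm
        | exact xz.symm
        | exact yz.symm
  have hub : ∀ i, u ≠ b i := by
    intro i
    fin_cases i
    exacts [ux, uy, uz]
  have hex : ∀ i, ∃ (l : ℕ) (p : ℕ → V), G.IndPath p l ∧ p 0 = u ∧ p l = b i ∧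
      ∀ s ≤ l, p s ∈ insert u (W i) := by
    intro i
    fin_cases i
    · exact (hX.insert_of_touches uX).exists_indPath (.inl rfl) (.inr xX)
    · exact (hY.insert_of_touches uY).exists_indPath (.inl rfl) (.inr yY)
    · exact (hZ.insert_of_touches uZ).exists_indPath (.inl rfl) (.inr zZ)
  choose l p hp h0 hlast hW' using hex
  have hl : ∀ i, 1 ≤ l i := by
    intro i
    by_contra h
    apply hub i
    rw [← h0 i, ← hlast i]
    congr 1
    omega
  have hl2 : ∀ i, ¬ G.Adj u (b i) → 2 ≤ l i := by
    intro i hi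
    have h1 := hl i
    by_contra h
    apply hi
    have := (hp i).adj_succ (i := 0) (by omega)
    rwa [h0, show 0 + 1 = l i by omega, hlast] at this
  have hW : ∀ i s, s ≤ l i → s ≠ 0 → p i s ∈ W i := by
    intro i s hs hs0
    refine (hW' i s hs).resolve_left fun e => hs0 ?_
    rw [← h0 i] at e
    exact ((hp i) s hs 0 (by omega)).1 e
  refine ⟨l, fun i => (hp i).toEmbedding, hl,
    ⟨0, 1, by decide, hl2 0 hux, hl2 1 huy⟩, fun i j hij s t => ?_⟩
  have hs := s.2
  have ht := t.2
  change (p i s = p j t ↔ _) ∧ (_ → _ → (G.Adj (p i s) (p j t) ↔ _))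
  simp only [ne_eq, Fin.ext_iff, Fin.val_zero, Fin.val_last]
  generalize (s : ℕ) = s at *
  generalize (t : ℕ) = t at *
  refine ⟨⟨fun e => ?_, ?_⟩, fun h1 h2 => ⟨fun e => ?_, ?_⟩⟩
  · by_cases hs0 : s = 0
    · have : p j t = p j 0 := by rw [← e, hs0, h0, h0]
      exact ⟨hs0, ((hp j) t (by omega) 0 (by omega)).1 this⟩
    · by_cases ht0 : t = 0
      · have : p i s = p i 0 := by rw [e, ht0, h0, h0]
        exact ⟨((hp i) s (by omega) 0 (by omega)).1 this, ht0⟩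
      · exact absurd e
          (hsep i j hij _ (hW i s (by omega) hs0) _ (hW j t (by omega) ht0)).1
  · rintro ⟨rfl, rfl⟩
    rw [h0, h0]
  · have := (hsep i j hij _ (hW i s (by omega) h1) _ (hW j t (by omega) h2)).2 e
    rw [← hlast, ← hlast] at this
    exact ⟨((hp i) s (by omega) _ le_rfl).1 this.1, ((hp j) t (by omega) _ le_rfl).1 this.2⟩
  · rintro ⟨rfl, rfl⟩
    rw [hlast, hlast]
    exact hb i j hij

/-- The three paths of a long prism may be given as connected sets. -/
theorem hasLongPrism_of_sets {a b c x y z : V} {X Y Z : Set V}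
    (hX : G.Conn X) (hY : G.Conn Y) (hZ : G.Conn Z)
    (aX : a ∈ X) (bY : b ∈ Y) (cZ : c ∈ Z) (xX : x ∈ X) (yY : y ∈ Y) (zZ : z ∈ Z)
    (ax : a ≠ x) (hby : b ≠ y) (cz : c ≠ z) (hcz : ¬ G.Adj c z)
    (ab : G.Adj a b) (ac : G.Adj a c) (bc : G.Adj b c)
    (xy : G.Adj x y) (xz : G.Adj x z) (yz : G.Adj y z)
    (XY : ∀ p ∈ X, ∀ q ∈ Y, p ≠ q ∧ (G.Adj p q → (p = a ∧ q = b) ∨ (p = x ∧ q = y)))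
    (XZ : ∀ p ∈ X, ∀ q ∈ Z, p ≠ q ∧ (G.Adj p q → (p = a ∧ q = c) ∨ (p = x ∧ q = z)))
    (YZ : ∀ p ∈ Y, ∀ q ∈ Z, p ≠ q ∧ (G.Adj p q → (p = b ∧ q = c) ∨ (p = y ∧ q = z))) :
    G.HasLongPrism := by
  let W : Fin 3 → Set V := ![X, Y, Z]
  let A : Fin 3 → V := ![a, b, c]
  let B : Fin 3 → V := ![x, y, z]
  have hsep : ∀ i j, i ≠ j → ∀ p ∈ W i, ∀ q ∈ W j,
      p ≠ q ∧ (G.Adj p q → (p = A i ∧ q = A j) ∨ (p = B i ∧ q = B j)) := by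
    have flip : ∀ {p q : V} {P Q R S : Prop}, (p ≠ q ∧ (G.Adj p q → (P ∧ Q) ∨ (R ∧ S))) →
        (q ≠ p ∧ (G.Adj q p → (Q ∧ P) ∨ (S ∧ R))) := by
      intro p q P Q R S h
      exact ⟨h.1.symm, fun e => (h.2 e.symm).imp And.symm And.symm⟩
    intro i j hij
    fin_cases i <;> fin_cases j <;>
      first
        | exact absurd rfl hij
        | exact XY
        | exact XZ
        | exact YZ
        | exact fun p hp q hq => flip (XY q hq p hp)
        | exact fun p hp q hq => flip (XZ q hq p hp)
        | exact fun p hp q hq => flip (YZ q hq p hp)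
  have hA : ∀ i j, i ≠ j → G.Adj (A i) (A j) := by
    intro i j hij
    fin_cases i <;> fin_cases j <;>
      first
        | exact absurd rfl hij
        | exact ab
        | exact ac
        | exact bc
        | exact ab.symm
        | exact ac.symm
        | exact bc.symm
  have hB : ∀ i j, i ≠ j → G.Adj (B i) (B j) := by
    intro i j hij
    fin_cases i <;> fin_cases j <;>
      first
        | exact absurd rfl hij
        | exact xy
        | exact xz
        | exact yz
        | exact xy.symm
        | exact xz.symm
        | exact yz.symm
  have hAB : ∀ i, A i ≠ B i := by
    intro i
    fin_cases i
    exacts [ax, hby, cz]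
  have hex : ∀ i, ∃ (l : ℕ) (p : ℕ → V), G.IndPath p l ∧ p 0 = A i ∧ p l = B i ∧
      ∀ s ≤ l, p s ∈ W i := by
    intro i
    fin_cases i
    · exact hX.exists_indPath aX xX
    · exact hY.exists_indPath bY yY
    · exact hZ.exists_indPath cZ zZ
  choose l p hp h0 hlast hW using hex
  have hl : ∀ i, 1 ≤ l i := by
    intro i
    by_contra h
    apply hAB i
    rw [← h0 i, ← hlast i]
    congr 1
    omega
  have hl2 : 2 ≤ l 2 := by
    have h1 := hl 2
    by_contra h
    apply hcz
    have := (hp 2).adj_succ (i := 0) (by omega)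
    rw [show 0 + 1 = l 2 by omega, h0, hlast] at this
    exact this
  refine ⟨l, fun i => (hp i).toEmbedding, hl, ⟨2, hl2⟩, fun i j hij s t => ?_⟩
  have hs := s.2
  have ht := t.2
  change (p i s ≠ p j t) ∧ (G.Adj (p i s) (p j t) ↔ _)
  simp only [Fin.ext_iff, Fin.val_zero, Fin.val_last]
  generalize (s : ℕ) = s at *
  generalize (t : ℕ) = t at *
  have := hsep i j hij _ (hW i s (by omega)) _ (hW j t (by omega))
  refine ⟨this.1, fun e => ?_, ?_⟩
  · rcases this.2 e with ⟨h1, h2⟩ | ⟨h1, h2⟩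
    · rw [← h0] at h1 h2
      exact .inl ⟨((hp i) s (by omega) _ (by omega)).1 h1,
        ((hp j) t (by omega) _ (by omega)).1 h2⟩
    · rw [← hlast] at h1 h2
      exact .inr ⟨((hp i) s (by omega) _ (by omega)).1 h1,
        ((hp j) t (by omega) _ (by omega)).1 h2⟩
  · rintro (⟨rfl, rfl⟩ | ⟨rfl, rfl⟩)
    · rw [h0, h0]
      exact hA i j hij
    · rw [hlast, hlast]
      exact hB i j hij

end SimpleGraph

/-! ### Broken wheels as frames of connected sets -/

namespace SimpleGraph

variable {V : Type*} {G : SimpleGraph V}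

/-- The vertex sets `S` and `R` are disjoint, and `b` is the only vertex of `R` that may have
neighbors in `S`. -/
def SepTo (G : SimpleGraph V) (S R : Set V) (b : V) : Prop :=
  ∀ u ∈ S, ∀ v ∈ R, u ≠ v ∧ (G.Adj u v → v = b)

/-- A broken wheel with center `x` in which the four parts of the rim are only recorded as
connected sets: `S` and `S'` stand for the interiors of two long sectors `a … b` and `c … d`,
whereas `R` stands for the part `b … c` of the rim between them and `R'` for the part `d … a`.
The vertices `b` and `c` may coincide, and so may `a` and `d`, but not both. -/
structure Frame (G : SimpleGraph V) (x a b c d : V) (S S' R R' : Set V) : Prop where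
  xa : G.Adj x a
  xb : G.Adj x b
  xc : G.Adj x c
  xd : G.Adj x d
  farS : ∀ v ∈ S, v ≠ x ∧ ¬ G.Adj x v
  farS' : ∀ v ∈ S', v ≠ x ∧ ¬ G.Adj x v
  xR : x ∉ R
  xR' : x ∉ R'
  bR : b ∈ R
  cR : c ∈ R
  aR' : a ∈ R'
  dR' : d ∈ R'
  connS : G.Conn S
  connS' : G.Conn S'
  connR : G.Conn R
  connR' : G.Conn R'
  sepS : G.Sep S S'
  sepR : G.Sep R R'
  SR : G.SepTo S R b
  SR' : G.SepTo S R' a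
  S'R : G.SepTo S' R c
  S'R' : G.SepTo S' R' d
  aS : G.Touches a S
  bS : G.Touches b S
  cS' : G.Touches c S'
  dS' : G.Touches d S'
  nondeg : ¬ (a = d ∧ b = c)

namespace Frame

variable {x a b c d : V} {S S' R R' : Set V}

/-- The reflection of the rim that preserves both long sectors. -/
theorem reflect (F : G.Frame x a b c d S S' R R') : G.Frame x b a d c S S' R' R where
  xa := F.xb
  xb := F.xa
  xc := F.xd
  xd := F.xc
  farS := F.farS
  farS' := F.farS'
  xR := F.xR'
  xR' := F.xR
  bR := F.aR'
  cR := F.dR'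
  aR' := F.bR
  dR' := F.cR
  connS := F.connS
  connS' := F.connS'
  connR := F.connR'
  connR' := F.connR
  sepS := F.sepS
  sepR := F.sepR.symm
  SR := F.SR'
  SR' := F.SR
  S'R := F.S'R'
  S'R' := F.S'R
  aS := F.bS
  bS := F.aS
  cS' := F.dS'
  dS' := F.cS'
  nondeg h := F.nondeg ⟨h.2, h.1⟩

/-- The reflection of the rim that exchanges the long sectors. -/
theorem swap (F : G.Frame x a b c d S S' R R') : G.Frame x d c b a S' S R R' where
  xa := F.xd
  xb := F.xc
  xc := F.xb
  xd := F.xa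
  farS := F.farS'
  farS' := F.farS
  xR := F.xR
  xR' := F.xR'
  bR := F.cR
  cR := F.bR
  aR' := F.dR'
  dR' := F.aR'
  connS := F.connS'
  connS' := F.connS
  connR := F.connR
  connR' := F.connR'
  sepS := F.sepS.symm
  sepR := F.sepR
  SR := F.S'R
  SR' := F.S'R'
  S'R := F.SR
  S'R' := F.SR'
  aS := F.dS'
  bS := F.cS'
  cS' := F.bS
  dS' := F.aS
  nondeg h := F.nondeg ⟨h.1.symm, h.2.symm⟩

theorem ne_ab (F : G.Frame x a b c d S S' R R') : a ≠ b := ((F.sepR b F.bR a F.aR').1).symm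

theorem not_ab (F : G.Frame x a b c d S S' R R') : ¬ G.Adj a b :=
  fun e => (F.sepR b F.bR a F.aR').2 e.symm

theorem ne_ac (F : G.Frame x a b c d S S' R R') : a ≠ c := ((F.sepR c F.cR a F.aR').1).symm

theorem not_ac (F : G.Frame x a b c d S S' R R') : ¬ G.Adj a c :=
  fun e => (F.sepR c F.cR a F.aR').2 e.symm

theorem ne_bd (F : G.Frame x a b c d S S' R R') : b ≠ d := (F.sepR b F.bR d F.dR').1

theorem not_bd (F : G.Frame x a b c d S S' R R') : ¬ G.Adj b d := (F.sepR b F.bR d F.dR').2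

theorem ne_cd (F : G.Frame x a b c d S S' R R') : c ≠ d := (F.sepR c F.cR d F.dR').1

theorem not_cd (F : G.Frame x a b c d S S' R R') : ¬ G.Adj c d := (F.sepR c F.cR d F.dR').2

theorem aS_notMem (F : G.Frame x a b c d S S' R R') : a ∉ S := fun h => (F.farS a h).2 F.xa

end Frame

/-- A hole from an enumeration of its vertices by `0, …, k - 1`. -/
theorem isHole_of_fun {k : ℕ} (hk : 4 ≤ k) {f : ℕ → V}
    (h : ∀ i j, i < j → j < k →
      f i ≠ f j ∧ (G.Adj (f i) (f j) ↔ i + 1 = j ∨ (i = 0 ∧ j + 1 = k))) :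
    G.IsHole (fun z : ZMod k => f z.val) := by
  have : NeZero k := ⟨by omega⟩
  have : Fact (1 < k) := ⟨by omega⟩
  have hval : ∀ z : ZMod k, (z + 1).val = if z.val + 1 = k then 0 else z.val + 1 := by
    intro z
    rw [ZMod.val_add, ZMod.val_one]
    have := z.val_lt
    split_ifs with e
    · rw [e, Nat.mod_self]
    · exact Nat.mod_eq_of_lt (by omega)
  refine ⟨hk, fun i j e => ?_, fun i j => ?_⟩
  · by_contra hne
    have hv : i.val ≠ j.val := fun e => hne (ZMod.val_injective k e)
    rcases lt_or_gt_of_ne hv with hlt | hlt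
    · exact (h _ _ hlt j.val_lt).1 e
    · exact (h _ _ hlt i.val_lt).1 e.symm
  · have e1 : j = i + 1 ↔ j.val = (i + 1).val := (ZMod.val_injective k).eq_iff.symm
    have e2 : i = j + 1 ↔ i.val = (j + 1).val := (ZMod.val_injective k).eq_iff.symm
    rw [e1, e2, hval, hval]
    have hi := i.val_lt
    have hj := j.val_lt
    generalize i.val = i at *
    generalize j.val = j at *
    rcases lt_trichotomy i j with hlt | rfl | hlt
    · rw [(h i j hlt hj).2]
      split_ifs <;> omega
    · simp only [SimpleGraph.irrefl, false_iff]
      split_ifs <;> omega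
    · rw [G.adj_comm, (h j i hlt hi).2]
      split_ifs <;> omega

theorem Frame.hasBrokenWheel {x a b c d : V} {S S' R R' : Set V}
    (F : G.Frame x a b c d S S' R R') : G.HasBrokenWheel := by
  obtain ⟨l₁, p, hl₁, hp, p0, pl, pS⟩ :=
    F.connS.exists_indPath_through F.ne_ab F.not_ab F.aS F.bS
  obtain ⟨l₃, q, hl₃, hq, q0, ql, qS⟩ :=
    F.connS'.exists_indPath_through F.ne_cd F.not_cd F.cS' F.dS'
  obtain ⟨l₂, r, hr, r0, rl, rR⟩ := F.connR.exists_indPath F.bR F.cR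
  obtain ⟨l₄, r', hr', r'0, r'l, r'R⟩ := F.connR'.exists_indPath F.dR' F.aR'
  -- the rim is `r`, the interior of `q`, then `r'`, then the interior of `p`
  have hRS' : ∀ i j, i ≤ l₂ → 0 < j → j < l₃ →
      r i ≠ q j ∧ (G.Adj (r i) (q j) ↔ i = l₂ ∧ j = 1) := by
    intro i j hi hj hj'
    have h := F.S'R _ (qS j hj hj') _ (rR i hi)
    refine ⟨h.1.symm, fun e => ?_, ?_⟩
    · have e1 := h.2 e.symm
      obtain rfl : i = l₂ := (hr.eq_iff hi le_rfl).1 (e1.trans rl.symm)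
      rw [rl, ← q0, hq.adj_iff (by omega) (by omega)] at e
      omega
    · rintro ⟨rfl, rfl⟩
      rw [rl, ← q0]
      exact hq.adj_succ (by omega)
  have hRS : ∀ i j, i ≤ l₂ → 0 < j → j < l₁ →
      r i ≠ p j ∧ (G.Adj (r i) (p j) ↔ i = 0 ∧ j + 1 = l₁) := by
    intro i j hi hj hj'
    have h := F.SR _ (pS j hj hj') _ (rR i hi)
    refine ⟨h.1.symm, fun e => ?_, ?_⟩
    · have e1 := h.2 e.symm
      obtain rfl : i = 0 := (hr.eq_iff hi (by omega)).1 (e1.trans r0.symm)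
      rw [r0, ← pl, hp.adj_iff (by omega) (by omega)] at e
      omega
    · rintro ⟨rfl, rfl⟩
      rw [r0, ← pl]
      exact (hp.adj_succ le_rfl).symm
  have hR'S' : ∀ i j, i ≤ l₄ → 0 < j → j < l₃ →
      q j ≠ r' i ∧ (G.Adj (q j) (r' i) ↔ i = 0 ∧ j + 1 = l₃) := by
    intro i j hi hj hj'
    have h := F.S'R' _ (qS j hj hj') _ (r'R i hi)
    refine ⟨h.1, fun e => ?_, ?_⟩
    · have e1 := h.2 e
      obtain rfl : i = 0 := (hr'.eq_iff hi (by omega)).1 (e1.trans r'0.symm)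
      rw [r'0, ← ql, hq.adj_iff (by omega) (by omega)] at e
      omega
    · rintro ⟨rfl, rfl⟩
      rw [r'0, ← ql]
      exact hq.adj_succ le_rfl
  have hR'S : ∀ i j, i ≤ l₄ → 0 < j → j < l₁ →
      r' i ≠ p j ∧ (G.Adj (r' i) (p j) ↔ i = l₄ ∧ j = 1) := by
    intro i j hi hj hj'
    have h := F.SR' _ (pS j hj hj') _ (r'R i hi)
    refine ⟨h.1.symm, fun e => ?_, ?_⟩
    · have e1 := h.2 e.symm
      obtain rfl : i = l₄ := (hr'.eq_iff hi le_rfl).1 (e1.trans r'l.symm)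
      rw [r'l, ← p0, hp.adj_iff (by omega) (by omega)] at e
      omega
    · rintro ⟨rfl, rfl⟩
      rw [r'l, ← p0]
      exact hp.adj_succ (by omega)
  let f : ℕ → V := fun i =>
    if i ≤ l₂ then r i else if i < l₂ + l₃ then q (i - l₂)
    else if i ≤ l₂ + l₃ + l₄ then r' (i - l₂ - l₃) else p (i - l₂ - l₃ - l₄)
  have f1 : ∀ i, i ≤ l₂ → f i = r i := fun i h => if_pos h
  have f2 : ∀ i, l₂ < i → i < l₂ + l₃ → f i = q (i - l₂) := fun i h h' => by
    simp only [f]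
    rw [if_neg (by omega), if_pos h']
  have f3 : ∀ i, l₂ + l₃ ≤ i → i ≤ l₂ + l₃ + l₄ → f i = r' (i - l₂ - l₃) := fun i h h' => by
    simp only [f]
    rw [if_neg (by omega), if_neg (by omega), if_pos h']
  have f4 : ∀ i, l₂ + l₃ + l₄ < i → f i = p (i - l₂ - l₃ - l₄) := fun i h => by
    simp only [f]
    rw [if_neg (by omega), if_neg (by omega), if_neg (by omega)]
  set k := l₂ + l₃ + l₄ + l₁ with hk
  have hf : ∀ i j, i < j → j < k →
      f i ≠ f j ∧ (G.Adj (f i) (f j) ↔ i + 1 = j ∨ (i = 0 ∧ j + 1 = k)) := by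
    intro i j hij hj
    rcases le_or_gt i l₂ with h1 | h1
    · rw [f1 i h1]
      rcases le_or_gt j l₂ with h2 | h2
      · rw [f1 j h2]
        have := hr i h1 j h2
        exact ⟨fun e => by have := this.1 e; omega, this.2.trans (by omega)⟩
      rcases lt_or_ge j (l₂ + l₃) with h3 | h3
      · rw [f2 j h2 h3]
        have := hRS' i (j - l₂) h1 (by omega) (by omega)
        exact ⟨this.1, this.2.trans (by omega)⟩
      rcases le_or_gt j (l₂ + l₃ + l₄) with h4 | h4
      · rw [f3 j h3 h4]
        have := F.sepR _ (rR i h1) _ (r'R (j - l₂ - l₃) (by omega))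
        exact ⟨this.1, iff_of_false this.2 (by omega)⟩
      · rw [f4 j h4]
        have := hRS i (j - l₂ - l₃ - l₄) h1 (by omega) (by omega)
        exact ⟨this.1, this.2.trans (by omega)⟩
    rcases lt_or_ge i (l₂ + l₃) with h1' | h1'
    · rw [f2 i h1 h1']
      rcases lt_or_ge j (l₂ + l₃) with h3 | h3
      · rw [f2 j (by omega) h3]
        have := hq (i - l₂) (by omega) (j - l₂) (by omega)
        exact ⟨fun e => by have := this.1 e; omega, this.2.trans (by omega)⟩
      rcases le_or_gt j (l₂ + l₃ + l₄) with h4 | h4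
      · rw [f3 j h3 h4]
        have := hR'S' (j - l₂ - l₃) (i - l₂) (by omega) (by omega) (by omega)
        exact ⟨this.1, this.2.trans (by omega)⟩
      · rw [f4 j h4]
        have := F.sepS.symm _ (qS (i - l₂) (by omega) (by omega)) _
          (pS (j - l₂ - l₃ - l₄) (by omega) (by omega))
        exact ⟨this.1, iff_of_false this.2 (by omega)⟩
    rcases le_or_gt i (l₂ + l₃ + l₄) with h1'' | h1''
    · rw [f3 i h1' h1'']
      rcases le_or_gt j (l₂ + l₃ + l₄) with h4 | h4
      · rw [f3 j (by omega) h4]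
        have := hr' (i - l₂ - l₃) (by omega) (j - l₂ - l₃) (by omega)
        exact ⟨fun e => by have := this.1 e; omega, this.2.trans (by omega)⟩
      · rw [f4 j h4]
        have := hR'S (i - l₂ - l₃) (j - l₂ - l₃ - l₄) (by omega) (by omega) (by omega)
        exact ⟨this.1, this.2.trans (by omega)⟩
    · rw [f4 i h1'', f4 j (by omega)]
      have := hp (i - l₂ - l₃ - l₄) (by omega) (j - l₂ - l₃ - l₄) (by omega)
      exact ⟨fun e => by have := this.1 e; omega, this.2.trans (by omega)⟩
  have hole := isHole_of_fun (by omega) hf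
  have : NeZero k := ⟨by omega⟩
  have hval : ∀ i j : ℕ, i + j < k → ((i : ZMod k) + (j : ZMod k)).val = i + j := by
    intro i j h
    rw [← Nat.cast_add, ZMod.val_natCast, Nat.mod_eq_of_lt h]
  have hval0 : ∀ i : ℕ, i < k → (i : ZMod k).val = i := fun i h => by
    rw [ZMod.val_natCast, Nat.mod_eq_of_lt h]
  have vb : f 0 = b := by rw [f1 0 (by omega), r0]
  have vc : f l₂ = c := by rw [f1 l₂ le_rfl, rl]
  have vd : f (l₂ + l₃) = d := by
    rw [f3 _ le_rfl (by omega), show l₂ + l₃ - l₂ - l₃ = 0 by omega, r'0]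
  have va : f (l₂ + l₃ + l₄) = a := by
    rw [f3 _ (by omega) le_rfl, show l₂ + l₃ + l₄ - l₂ - l₃ = l₄ by omega, r'l]
  have fmem : ∀ i < k, f i ∈ R ∪ S' ∪ R' ∪ S := by
    intro i hi
    rcases le_or_gt i l₂ with h1 | h1
    · rw [f1 i h1]
      exact .inl (.inl (.inl (rR i h1)))
    rcases lt_or_ge i (l₂ + l₃) with h2 | h2
    · rw [f2 i h1 h2]
      exact .inl (.inl (.inr (qS _ (by omega) (by omega))))
    rcases le_or_gt i (l₂ + l₃ + l₄) with h3 | h3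
    · rw [f3 i h2 h3]
      exact .inl (.inr (r'R _ (by omega)))
    · rw [f4 i h3]
      exact .inr (pS _ (by omega) (by omega))
  refine ⟨k, fun z => f z.val, x, ⟨hole, fun z e => ?_, ?_⟩,
    ((l₂ + l₃ + l₄ : ℕ) : ZMod k), (l₂ : ZMod k), l₁, l₃, ?_, hl₁, hl₃, ?_, ?_⟩
  · have := fmem z.val z.val_lt
    rw [e] at this
    rcases this with ((h | h) | h) | h
    · exact F.xR h
    · exact (F.farS' x h).1 rfl
    · exact F.xR' h
    · exact (F.farS x h).1 rfl
  · have hinj : ∀ i j : ℕ, i < k → j < k → i ≠ j → (i : ZMod k) ≠ (j : ZMod k) := by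
      intro i j hi hj hij e
      apply hij
      rw [← hval0 i hi, ← hval0 j hj, e]
    have hadj : ∀ i : ℕ, i < k → G.Adj x (f i) →
        (i : ZMod k) ∈ {z : ZMod k | G.Adj x (f z.val)} := by
      intro i hi h
      change G.Adj x (f (i : ZMod k).val)
      rwa [hval0 i hi]
    have h0 := hadj 0 (by omega) (vb ▸ F.xb)
    have h1 := hadj l₂ (by omega) (vc ▸ F.xc)
    have h2 := hadj (l₂ + l₃) (by omega) (vd ▸ F.xd)
    have h3 := hadj (l₂ + l₃ + l₄) (by omega) (va ▸ F.xa)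
    refine (Set.two_lt_ncard_iff (Set.toFinite _)).2 ?_
    by_cases e2 : l₂ = 0
    · have e4 : l₄ ≠ 0 := by
        intro e4
        subst e2
        subst e4
        exact F.nondeg ⟨r'l.symm.trans r'0, r0.symm.trans rl⟩
      exact ⟨_, _, _, h0, h2, h3, hinj _ _ (by omega) (by omega) (by omega),
        hinj _ _ (by omega) (by omega) (by omega), hinj _ _ (by omega) (by omega) (by omega)⟩
    · exact ⟨_, _, _, h0, h1, h2, hinj _ _ (by omega) (by omega) (by omega),
        hinj _ _ (by omega) (by omega) (by omega), hinj _ _ (by omega) (by omega) (by omega)⟩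
  · intro e
    have := congrArg ZMod.val e
    rw [hval0 _ (by omega), hval0 _ (by omega)] at this
    omega
  · refine ⟨by omega, by omega, ?_, ?_, fun j hj hj' => ?_⟩
    · rw [hval0 _ (by omega), va]
      exact F.xa
    · rw [← Nat.cast_add, ZMod.val_natCast, ← hk, Nat.mod_self, vb]
      exact F.xb
    · rw [hval _ _ (by omega), f4 _ (by omega),
        show l₂ + l₃ + l₄ + j - l₂ - l₃ - l₄ = j by omega]
      exact (F.farS _ (pS j hj hj')).2
  · refine ⟨by omega, by omega, ?_, ?_, fun j hj hj' => ?_⟩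
    · rw [hval0 _ (by omega), vc]
      exact F.xc
    · rw [hval _ _ (by omega), vd]
      exact F.xd
    · rw [hval _ _ (by omega), f2 _ (by omega) (by omega), show l₂ + j - l₂ = j by omega]
      exact (F.farS' _ (qS j hj hj')).2

theorem HasBrokenWheel.exists_frame (hG : G.HasBrokenWheel) :
    ∃ x a b c d S S' R R', G.Frame x a b c d S S' R R' := by
  obtain ⟨k, h, x, ⟨hole, hx, three⟩, i, i', l, l', hne, hl, hl', s, s'⟩ := hG
  have hk := hole.four_le
  have : NeZero k := ⟨by omega⟩
  let f : ℕ → V := fun j => h (i + (j : ZMod k))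
  have cast_iff : ∀ u v : ℕ, u ≤ v → ((u : ZMod k) = (v : ZMod k) ↔ k ∣ v - u) := by
    intro u v huv
    rw [ZMod.natCast_eq_natCast_iff, Nat.modEq_iff_dvd' huv]
  have dvd_iff : ∀ u, 0 < u → u ≤ k → (k ∣ u ↔ u = k) := by
    intro u hu huk
    exact ⟨fun e => le_antisymm huk (Nat.le_of_dvd hu e), fun e => e ▸ dvd_rfl⟩
  have hf : ∀ u v, 0 < u → u < v → v ≤ k →
      f u ≠ f v ∧ (G.Adj (f u) (f v) ↔ u + 1 = v ∨ (u = 1 ∧ v = k)) := by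
    intro u v hu huv hv
    constructor
    · intro e
      have := add_left_cancel (hole.injective e)
      rw [cast_iff u v huv.le, dvd_iff _ (by omega) (by omega)] at this
      omega
    · have e1 : i + (v : ZMod k) = i + u + 1 ↔ ((u + 1 : ℕ) : ZMod k) = (v : ZMod k) := by
        rw [add_assoc, add_right_inj, Nat.cast_add, Nat.cast_one, eq_comm]
      have e2 : i + (u : ZMod k) = i + v + 1 ↔ (u : ZMod k) = ((v + 1 : ℕ) : ZMod k) := by
        rw [add_assoc, add_right_inj, Nat.cast_add, Nat.cast_one]
      rw [hole.adj_iff, e1, e2, cast_iff _ _ (by omega : u + 1 ≤ v),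
        cast_iff _ _ (by omega : u ≤ v + 1), dvd_iff (v + 1 - u) (by omega) (by omega)]
      have : k ∣ v - (u + 1) ↔ u + 1 = v := by
        constructor
        · intro e
          have := Nat.eq_zero_of_dvd_of_lt e (by omega)
          omega
        · rintro rfl
          simp
      rw [this]
      omega
  obtain ⟨m, hm, rfl⟩ : ∃ m < k, i' = i + (m : ZMod k) := by
    refine ⟨(i' - i).val, ZMod.val_lt _, ?_⟩
    rw [ZMod.natCast_zmod_val]
    ring
  have hm0 : 0 < m := by
    rcases Nat.eq_zero_or_pos m with rfl | h
    · simp at hne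
    · exact h
  have fk : f k = h i := by simp [f]
  have hlm : l ≤ m := by
    by_contra hlt
    exact s.not_adj m hm0 (by omega) s'.adj_first
  have hml : m + l' ≤ k := by
    by_contra hlt
    have := s'.not_adj (k - m) (by omega) (by omega)
    rw [add_assoc, ← Nat.cast_add, show m + (k - m) = k by omega] at this
    exact this (by simpa using s.adj_first)
  have hxf : ∀ j, f j ≠ x := fun j => hx _
  have adj_m : ∀ j : ℕ, h (i + m + j) = f (m + j) := by
    intro j
    simp only [f, Nat.cast_add, add_assoc]
  have xd : G.Adj x (f (m + l')) := by
    rw [← adj_m]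
    exact s'.adj_last
  refine ⟨x, f k, f l, f m, f (m + l'), seg f 1 l, seg f (m + 1) (m + l'), seg f l (m + 1),
    seg f (m + l') (k + 1), ?_⟩
  have hconn : ∀ u v, 0 < u → v ≤ k + 1 → G.Conn (seg f u v) := fun u v hu hv =>
    conn_seg fun j hj hj' => (hf j (j + 1) (by omega) (by omega) (by omega)).2.2 (.inl rfl)
  constructor
  · rw [fk]
    exact s.adj_first
  · exact s.adj_last
  · exact s'.adj_first
  · exact xd
  · rintro _ ⟨j, hj, hj', rfl⟩
    exact ⟨hxf j, s.not_adj j (by omega) hj'⟩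
  · rintro _ ⟨j, hj, hj', rfl⟩
    refine ⟨hxf j, ?_⟩
    have := s'.not_adj (j - m) (by omega) (by omega)
    rwa [adj_m, show m + (j - m) = j by omega] at this
  · rintro ⟨j, hj, hj', e⟩
    exact hxf j e.symm
  · rintro ⟨j, hj, hj', e⟩
    exact hxf j e.symm
  · exact mem_seg le_rfl (by omega)
  · exact mem_seg hlm (by omega)
  · exact mem_seg hml (by omega)
  · exact mem_seg le_rfl (by omega)
  · exact hconn _ _ (by omega) (by omega)
  · exact hconn _ _ (by omega) (by omega)
  · exact hconn _ _ (by omega) (by omega)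
  · exact hconn _ _ (by omega) (by omega)
  · rintro _ ⟨u, hu, hu', rfl⟩ _ ⟨v, hv, hv', rfl⟩
    have := hf u v (by omega) (by omega) (by omega)
    exact ⟨this.1, fun e => by have := this.2.1 e; omega⟩
  · rintro _ ⟨u, hu, hu', rfl⟩ _ ⟨v, hv, hv', rfl⟩
    have := hf u v (by omega) (by omega) (by omega)
    exact ⟨this.1, fun e => by have := this.2.1 e; omega⟩
  · rintro _ ⟨u, hu, hu', rfl⟩ _ ⟨v, hv, hv', rfl⟩
    have := hf u v (by omega) (by omega) (by omega)
    exact ⟨this.1, fun e => congrArg f (by have := this.2.1 e; omega)⟩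
  · rintro _ ⟨u, hu, hu', rfl⟩ _ ⟨v, hv, hv', rfl⟩
    have := hf u v (by omega) (by omega) (by omega)
    exact ⟨this.1, fun e => congrArg f (by have := this.2.1 e; omega)⟩
  · rintro _ ⟨u, hu, hu', rfl⟩ _ ⟨v, hv, hv', rfl⟩
    have := hf v u (by omega) (by omega) (by omega)
    exact ⟨this.1.symm, fun e => congrArg f (by have := this.2.1 e.symm; omega)⟩
  · rintro _ ⟨u, hu, hu', rfl⟩ _ ⟨v, hv, hv', rfl⟩
    have := hf u v (by omega) (by omega) (by omega)
    exact ⟨this.1, fun e => congrArg f (by have := this.2.1 e; omega)⟩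
  · exact ⟨f 1, mem_seg le_rfl (by omega),
      ((hf 1 k (by omega) (by omega) le_rfl).2.2 (.inr ⟨rfl, rfl⟩)).symm⟩
  · exact ⟨f (l - 1), mem_seg (by omega) (by omega),
      ((hf (l - 1) l (by omega) (by omega) (by omega)).2.2 (.inl (by omega))).symm⟩
  · exact ⟨f (m + 1), mem_seg le_rfl (by omega),
      (hf m (m + 1) (by omega) (by omega) (by omega)).2.2 (.inl rfl)⟩
  · exact ⟨f (m + l' - 1), mem_seg (by omega) (by omega),
      ((hf (m + l' - 1) (m + l') (by omega) (by omega) (by omega)).2.2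
        (.inl (by omega))).symm⟩
  · rintro ⟨e1, e2⟩
    have h1 : m + l' = k := by
      by_contra hne
      exact (hf (m + l') k (by omega) (by omega) le_rfl).1 e1.symm
    have h2 : l = m := by
      by_contra hne
      exact (hf l m (by omega) (by omega) (by omega)).1 e2
    -- otherwise the center has only two neighbors in the rim
    obtain ⟨z₁, z₂, z₃, h₁, h₂, h₃, n₁, n₂, n₃⟩ :=
      (Set.two_lt_ncard_iff (Set.toFinite _)).1 three
    have key : ∀ z, G.Adj x (h z) → z = i ∨ z = i + (l : ZMod k) := by
      intro z hz
      obtain ⟨j, hj, rfl⟩ : ∃ j < k, z = i + (j : ZMod k) := by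
        refine ⟨(z - i).val, ZMod.val_lt _, ?_⟩
        rw [ZMod.natCast_zmod_val]
        ring
      rcases Nat.eq_zero_or_pos j with rfl | hj0
      · simp
      rcases lt_trichotomy j l with hjl | rfl | hjl
      · exact absurd hz (s.not_adj j hj0 hjl)
      · exact .inr rfl
      · have := s'.not_adj (j - m) (by omega) (by omega)
        rw [adj_m, show m + (j - m) = j by omega] at this
        exact absurd hz this
    rcases key _ h₁ with e₁ | e₁ <;> rcases key _ h₂ with e₂ | e₂ <;>
      rcases key _ h₃ with e₃ | e₃ <;> simp_all

end SimpleGraph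

/-! ### Three independent neighbors of a vertex attached to one component -/

namespace SimpleGraph

variable {V : Type*} {G : SimpleGraph V}

namespace IndPath

variable {p : ℕ → V} {l : ℕ}

theorem sep_seg (h : G.IndPath p l) {i j i' j' : ℕ} (hj : j < i') (hj' : j' ≤ l + 1) :
    G.Sep (seg p i j) (seg p i' j') := by
  rintro _ ⟨u, hu, hu', rfl⟩ _ ⟨v, hv, hv', rfl⟩
  refine ⟨fun e => ?_, fun e => ?_⟩
  · have := (h.eq_iff (by omega) (by omega)).1 e
    omega
  · have := (h.adj_iff (by omega) (by omega)).1 e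
    omega

theorem sepExcept_seg (h : G.IndPath p l) {i j j' : ℕ} (hj' : j' ≤ l + 1) :
    G.SepExcept (seg p i (j + 1)) (seg p (j + 1) j') (p j) (p (j + 1)) := by
  rintro _ ⟨u, hu, hu', rfl⟩ _ ⟨v, hv, hv', rfl⟩
  refine ⟨fun e => ?_, fun e => ?_⟩
  · have := (h.eq_iff (by omega) (by omega)).1 e
    omega
  · have := (h.adj_iff (by omega) (by omega)).1 e
    exact ⟨congrArg p (by omega), congrArg p (by omega)⟩

theorem touches_seg_left (h : G.IndPath p l) {i k : ℕ} (hi : i < k) (hk : k ≤ l) :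
    G.Touches (p k) (seg p i k) :=
  ⟨p (k - 1), mem_seg (by omega) (by omega), (h.adj_iff hk (by omega)).2 (by omega)⟩

theorem touches_seg_right (h : G.IndPath p l) {k j : ℕ} (hj : k + 1 < j) (hk : k < l) :
    G.Touches (p k) (seg p (k + 1) j) :=
  ⟨p (k + 1), mem_seg le_rfl hj, h.adj_succ hk⟩

end IndPath

/-- The hole formed by `x` and the induced path `p`, together with a third arm `Z` from `x` to a
vertex `w` with one neighbor or two consecutive neighbors inside `p`. -/
theorem theta_or_pyramid_of_arm {p : ℕ → V} {l i j : ℕ} {x w : V} {Z : Set V}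
    (hp : G.IndPath p l) (x0 : G.Adj x (p 0)) (xl : G.Adj x (p l))
    (far : ∀ k, 0 < k → k < l → p k ≠ x ∧ ¬ G.Adj x (p k))
    (hZ : G.Conn Z) (wx : w ≠ x) (wZ : w ∈ Z) (xZ : G.Touches x Z)
    (hZp : ∀ z ∈ Z, ∀ k ≤ l, z ≠ p k ∧ (G.Adj z (p k) → z = w ∧ (k = i ∨ k = j)))
    (hi : 0 < i) (hj : j < l) (hij : j = i ∨ j = i + 1)
    (wi : G.Adj w (p i)) (wj : G.Adj w (p j)) : G.HasTheta ∨ G.HasPyramid := by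
  rcases hij with rfl | rfl
  · refine .inl (hasTheta_of_sets (u := x) (v := p j) (far j hi hj).1.symm (far j hi hj).2
      (hp.conn_seg (i := 0) (j := j) (by omega)) (hp.conn_seg (i := j + 1) (j := l + 1) le_rfl) hZ
      ⟨p 0, mem_seg le_rfl hi, x0⟩ ⟨p l, mem_seg (by omega) (by omega), xl⟩ xZ
      (hp.touches_seg_left hi hj.le) (hp.touches_seg_right (by omega) hj) ⟨w, wZ, wj.symm⟩
      (hp.sep_seg (by omega) le_rfl) ?_ ?_)
    · rintro _ ⟨k, hk, hk', rfl⟩ z hz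
      have := hZp z hz k (by omega)
      exact ⟨this.1.symm, fun e => by have := (this.2 e.symm).2; omega⟩
    · rintro _ ⟨k, hk, hk', rfl⟩ z hz
      have := hZp z hz k (by omega)
      exact ⟨this.1.symm, fun e => by have := (this.2 e.symm).2; omega⟩
  · have hi' := far i hi (by omega)
    have hj' := far (i + 1) (by omega) hj
    refine .inr (hasPyramid_of_sets (u := x) (x := p i) (y := p (i + 1)) (z := w)
      (hp.conn_seg (i := 0) (j := i + 1) (by omega))
      (hp.conn_seg (i := i + 1) (j := l + 1) le_rfl) hZ
      (mem_seg (by omega) (by omega)) (mem_seg (by omega) (by omega)) wZ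
      hi'.1.symm hj'.1.symm wx.symm
      ⟨p 0, mem_seg le_rfl (by omega), x0⟩ ⟨p l, mem_seg (by omega) (by omega), xl⟩ xZ
      hi'.2 hj'.2 (hp.adj_succ (by omega)) wi.symm wj.symm (hp.sepExcept_seg le_rfl) ?_ ?_)
    · rintro _ ⟨k, hk, hk', rfl⟩ z hz
      have := hZp z hz k (by omega)
      refine ⟨this.1.symm, fun e => ?_⟩
      obtain ⟨rfl, h⟩ := this.2 e.symm
      exact ⟨congrArg p (by omega), rfl⟩
    · rintro _ ⟨k, hk, hk', rfl⟩ z hz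
      have := hZp z hz k (by omega)
      refine ⟨this.1.symm, fun e => ?_⟩
      obtain ⟨rfl, h⟩ := this.2 e.symm
      exact ⟨congrArg p (by omega), rfl⟩

/-- A third neighbor `e` of `x` that sees the interior of an induced path between two neighbors
of `x`: one neighbor gives a theta, two consecutive ones give a pyramid, and otherwise `e` is the
center of a broken wheel whose rim consists of the path and `x`. -/
theorem broken_of_adj_interior (hθ : ¬ G.HasTheta) (hπ : ¬ G.HasPyramid) {p : ℕ → V} {l : ℕ}
    {x e : V} (hp : G.IndPath p l) (x0 : G.Adj x (p 0)) (xl : G.Adj x (p l)) (xe : G.Adj x e)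
    (far : ∀ k, 0 < k → k < l → p k ≠ x ∧ ¬ G.Adj x (p k))
    (e0 : e ≠ p 0 ∧ ¬ G.Adj e (p 0)) (el : e ≠ p l ∧ ¬ G.Adj e (p l))
    (he : ∃ k, 0 < k ∧ k < l ∧ G.Adj e (p k)) : G.HasBrokenWheel := by
  obtain ⟨k, hk, hkl, hek⟩ := he
  obtain ⟨i, j, hij, hjl, hi, hj, hfl⟩ := exists_first_last ⟨k, hkl.le, hek⟩
  have hi0 : 0 < i := Nat.pos_of_ne_zero fun h => e0.2 (h ▸ hi)
  have hjl' : j < l := lt_of_le_of_ne hjl fun h => el.2 (h ▸ hj)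
  have hne : ∀ k ≤ l, e ≠ p k := by
    intro k hk h
    rcases Nat.eq_zero_or_pos k with rfl | h0
    · exact e0.1 h
    rcases hk.eq_or_lt with rfl | h1
    · exact el.1 h
    · exact (far k h0 h1).2 (h ▸ xe)
  have hxp : ∀ k ≤ l, p k ≠ x := by
    intro k hk h
    rcases Nat.eq_zero_or_pos k with rfl | h0
    · exact G.irrefl (h ▸ x0)
    rcases hk.eq_or_lt with rfl | h1
    · exact G.irrefl (h ▸ xl)
    · exact (far k h0 h1).1 h
  by_cases h2 : j = i ∨ j = i + 1
  · have := theta_or_pyramid_of_arm (Z := {e}) hp x0 xl far (conn_singleton e) xe.ne' rfl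
      ⟨e, rfl, xe⟩ (by
        rintro z rfl k hk
        exact ⟨hne k hk, fun h => ⟨rfl, by have := hfl k hk h; omega⟩⟩) hi0 hjl' h2 hi hj
    tauto
  · refine Frame.hasBrokenWheel (x := e) (a := p i) (b := x) (c := x) (d := p j)
      (S := seg p 0 i) (S' := seg p (j + 1) (l + 1)) (R := {x}) (R' := seg p i (j + 1))
      { xa := hi, xb := xe.symm, xc := xe.symm, xd := hj
        farS := ?_, farS' := ?_, xR := xe.ne', xR' := ?_, bR := rfl, cR := rfl
        aR' := mem_seg le_rfl (by omega), dR' := mem_seg hij (by omega)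
        connS := hp.conn_seg (by omega), connS' := hp.conn_seg le_rfl
        connR := conn_singleton x, connR' := hp.conn_seg (by omega)
        sepS := hp.sep_seg (by omega) le_rfl, sepR := ?_, SR := ?_, SR' := ?_
        S'R := ?_, S'R' := ?_
        aS := hp.touches_seg_left hi0 (by omega)
        bS := ⟨p 0, mem_seg le_rfl hi0, x0⟩
        cS' := ⟨p l, mem_seg (by omega) (by omega), xl⟩
        dS' := hp.touches_seg_right (by omega) hjl'
        nondeg := ?_ }
    · rintro _ ⟨k, hk, hk', rfl⟩
      exact ⟨(hne k (by omega)).symm, fun h => by have := hfl k (by omega) h; omega⟩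
    · rintro _ ⟨k, hk, hk', rfl⟩
      exact ⟨(hne k (by omega)).symm, fun h => by have := hfl k (by omega) h; omega⟩
    · rintro ⟨k, hk, hk', h⟩
      exact hne k (by omega) h
    · rintro _ rfl _ ⟨k, hk, hk', rfl⟩
      have := far k (by omega) (by omega)
      exact ⟨this.1.symm, this.2⟩
    · rintro _ ⟨k, hk, hk', rfl⟩ _ rfl
      exact ⟨hxp k (by omega), fun _ => rfl⟩
    · rintro _ ⟨k, hk, hk', rfl⟩ _ ⟨m, hm, hm', rfl⟩
      have := hp k (by omega) m (by omega)
      exact ⟨fun h => by have := this.1 h; omega,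
        fun h => congrArg p (by have := this.2.1 h; omega)⟩
    · rintro _ ⟨k, hk, hk', rfl⟩ _ rfl
      exact ⟨hxp k (by omega), fun _ => rfl⟩
    · rintro _ ⟨k, hk, hk', rfl⟩ _ ⟨m, hm, hm', rfl⟩
      have := hp k (by omega) m (by omega)
      exact ⟨fun h => by have := this.1 h; omega,
        fun h => congrArg p (by have := this.2.1 h; omega)⟩
    · rintro ⟨h, _⟩
      have := (hp.eq_iff (by omega) (by omega)).1 h
      omega

/-- Here `p` is an induced path between two neighbors `a` and `b` of `x`, and `q` leads from a
vertex attached to the interior of `p` to a third neighbor `e` of `x`. If `a` sees `q` but `b`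
does not, then every path from `b` to `e` inside `p` and `q` contains all of `q`, hence a neighbor
of `a` in its interior. -/
theorem broken_of_attached_end (hθ : ¬ G.HasTheta) (hπ : ¬ G.HasPyramid) {p q : ℕ → V} {l k : ℕ}
    {x a b e : V} (hl : 2 ≤ l) (hp : G.IndPath p l) (hb : p 0 = b ∧ p l = a ∨ p 0 = a ∧ p l = b)
    (hq : G.IndPath q k) (hk : 0 < k) (qe : q k = e)
    (xa : G.Adj x a) (xb : G.Adj x b) (xe : G.Adj x e)
    (be : b ≠ e ∧ ¬ G.Adj b e) (ab : a ≠ b ∧ ¬ G.Adj a b) (ae : a ≠ e ∧ ¬ G.Adj a e)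
    (farp : ∀ i, 0 < i → i < l → p i ≠ x ∧ ¬ G.Adj x (p i))
    (farq : ∀ i < k, q i ≠ x ∧ ¬ G.Adj x (q i))
    (hqt : ∀ i ≤ k, (G.Touches (q i) (seg p 1 l) ↔ i = 0))
    (ha : ∃ i < k, G.Adj a (q i)) (hbq : ¬ ∃ i < k, G.Adj b (q i)) : G.HasBrokenWheel := by
  obtain ⟨i₀, hi₀, hai₀⟩ := ha
  have hE : G.Conn (seg p 1 l ∪ seg q 0 k) := by
    obtain ⟨w, hw, hqw⟩ := (hqt 0 (by omega)).2 rfl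
    exact (hp.conn_seg (by omega)).union (hq.conn_seg (by omega))
      ⟨w, hw, q 0, mem_seg le_rfl hk, .inr hqw.symm⟩
  have htb : G.Touches b (seg p 1 l ∪ seg q 0 k) := by
    rcases hb with ⟨h, _⟩ | ⟨_, h⟩
    · exact ⟨p 1, .inl (mem_seg le_rfl (by omega)), h ▸ hp.adj_succ (by omega)⟩
    · exact ⟨p (l - 1), .inl (mem_seg (by omega) (by omega)),
        h ▸ (hp.adj_iff (by omega) (by omega)).2 (by omega)⟩
  have hte : G.Touches e (seg p 1 l ∪ seg q 0 k) :=
    ⟨q (k - 1), .inr (mem_seg (by omega) (by omega)),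
      qe ▸ (hq.adj_iff (by omega) (by omega)).2 (by omega)⟩
  obtain ⟨m, r, hm, hr, r0, rm, hrE⟩ := hE.exists_indPath_through be.1 be.2 htb hte
  have far : ∀ s, 0 < s → s < m → r s ≠ x ∧ ¬ G.Adj x (r s) := by
    intro s hs hs'
    rcases hrE s hs hs' with ⟨i, h1, h2, h3⟩ | ⟨i, h1, h2, h3⟩
    · rw [h3]
      exact farp i (by omega) h2
    · rw [h3]
      exact farq i h2
  by_cases hqr : ∃ s, 0 < s ∧ s < m ∧ r s = q i₀
  · obtain ⟨s, hs, hs', e1⟩ := hqr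
    exact broken_of_adj_interior (e := a) hθ hπ hr (r0 ▸ xb) (rm ▸ xe) xa far (r0 ▸ ab) (rm ▸ ae)
      ⟨s, hs, hs', e1 ▸ hai₀⟩
  · exfalso
    push Not at hqr
    have stay : ∀ s, 0 < s → s < m → r s ∈ seg p 1 l ∪ seg q 0 i₀ := by
      intro s hs
      induction s, hs using Nat.le_induction with
      | base =>
        intro h1
        rcases hrE 1 (by omega) h1 with h | ⟨i, h2, h3, h4⟩
        · exact .inl h
        · refine absurd ⟨i, h3, ?_⟩ hbq
          rw [← h4, ← r0]
          exact hr.adj_succ (by omega)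
      | succ s hs ih =>
        intro h1
        have hadj := hr.adj_succ (i := s) (by omega)
        rcases hrE (s + 1) (by omega) h1 with h | ⟨i, h2, h3, h4⟩
        · exact .inl h
        · have hi : i ≠ i₀ := by
            rintro rfl
            exact hqr (s + 1) (by omega) h1 h4
          rw [h4] at hadj ⊢
          refine .inr (mem_seg (Nat.zero_le i) ?_)
          rcases ih (by omega) with h | ⟨i', h2', h3', h4'⟩
          · have := (hqt i h3.le).1 ⟨_, h, hadj.symm⟩
            omega
          · rw [h4'] at hadj
            have := (hq.adj_iff (by omega) (by omega)).1 hadj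
            omega
    have hadj := hr.adj_succ (i := m - 1) (by omega)
    rw [show m - 1 + 1 = m by omega, rm, ← qe] at hadj
    rcases stay (m - 1) (by omega) (by omega) with h | ⟨i, h2, h3, h4⟩
    · have := (hqt k le_rfl).1 ⟨_, h, hadj.symm⟩
      omega
    · rw [h4] at hadj
      have := (hq.adj_iff (by omega) (by omega)).1 hadj
      omega

/-- Three pairwise nonadjacent neighbors of `x` that are attached to the same connected set of
non-neighbors of `x` force a broken wheel, in the absence of thetas and pyramids. -/
theorem hasBrokenWheel_of_triple [Finite V] (hθ : ¬ G.HasTheta) (hπ : ¬ G.HasPyramid)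
    {x a b e : V} (xa : G.Adj x a) (xb : G.Adj x b) (xe : G.Adj x e)
    (ab : a ≠ b ∧ ¬ G.Adj a b) (ae : a ≠ e ∧ ¬ G.Adj a e) (be : b ≠ e ∧ ¬ G.Adj b e)
    {D : Set V} (hD : G.Conn D) (farD : ∀ v ∈ D, v ≠ x ∧ ¬ G.Adj x v)
    (aD : G.Touches a D) (bD : G.Touches b D) (eD : G.Touches e D) : G.HasBrokenWheel := by
  induction hn : D.ncard using Nat.strong_induction_on generalizing D with
  | _ n ih =>
  subst hn
  obtain ⟨l, p, hl, hp, p0, pl, pD⟩ := hD.exists_indPath_through ab.1 ab.2 aD bD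
  have farp : ∀ i, 0 < i → i < l → p i ≠ x ∧ ¬ G.Adj x (p i) :=
    fun i hi hi' => farD _ (pD i hi hi')
  have x0 : G.Adj x (p 0) := p0 ▸ xa
  have xl : G.Adj x (p l) := pl ▸ xb
  by_cases he : ∃ k, 0 < k ∧ k < l ∧ G.Adj e (p k)
  · exact broken_of_adj_interior hθ hπ hp x0 xl xe farp
      (p0 ▸ ⟨ae.1.symm, fun h => ae.2 h.symm⟩) (pl ▸ ⟨be.1.symm, fun h => be.2 h.symm⟩) he
  have heW : e ∉ seg p 1 l := by
    rintro ⟨i, hi, hi', h⟩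
    exact (farp i hi hi').2 (h ▸ xe)
  obtain ⟨k, q, hq, qe, hqD, hqt⟩ := (hD.insert_of_touches eD).exists_attaching_path
    (W := seg p 1 l) (Set.mem_insert e D) heW
    ⟨p 1, .inr (pD 1 (by omega) (by omega)), .inl (mem_seg le_rfl (by omega))⟩
  have hk : 0 < k := by
    refine Nat.pos_of_ne_zero fun h => ?_
    obtain ⟨w, ⟨i, hi, hi', rfl⟩, hw⟩ := (hqt k le_rfl).2 h
    exact he ⟨i, hi, hi', qe ▸ hw⟩
  have qD : ∀ i < k, q i ∈ D := by
    intro i hi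
    refine (hqD i hi.le).1.resolve_left fun h => ?_
    rw [← qe] at h
    have := (hq.eq_iff hi.le le_rfl).1 h
    omega
  have farq : ∀ i < k, q i ≠ x ∧ ¬ G.Adj x (q i) := fun i hi => farD _ (qD i hi)
  have hqp : ∀ i ≤ k, q i ∉ seg p 1 l := fun i hi => (hqD i hi).2
  by_cases ta : ∃ i < k, G.Adj a (q i)
  · by_cases tb : ∃ i < k, G.Adj b (q i)
    · -- the path `q` alone is attached to all three vertices
      obtain ⟨i, hi, hai⟩ := ta
      obtain ⟨j, hj, hbj⟩ := tb
      have sub : seg q 0 k ⊆ D := by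
        rintro _ ⟨i, _, hi, rfl⟩
        exact qD i hi
      refine ih (seg q 0 k).ncard ?_ (hq.conn_seg (by omega)) (fun v hv => farD v (sub hv))
        ⟨_, mem_seg (Nat.zero_le i) hi, hai⟩ ⟨_, mem_seg (Nat.zero_le j) hj, hbj⟩
        ⟨q (k - 1), mem_seg (by omega) (by omega),
          qe ▸ (hq.adj_iff (by omega) (by omega)).2 (by omega)⟩ rfl
      refine Set.ncard_lt_ncard ⟨sub, fun h => ?_⟩ (Set.toFinite _)
      obtain ⟨i, _, hi, e1⟩ := h (pD 1 (by omega) (by omega))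
      exact hqp i hi.le (e1 ▸ mem_seg le_rfl (by omega))
    · exact broken_of_attached_end hθ hπ hl hp (.inr ⟨p0, pl⟩) hq hk qe xa xb xe be ab ae
        farp farq hqt ta tb
  by_cases tb : ∃ i < k, G.Adj b (q i)
  · exact broken_of_attached_end hθ hπ hl hp (.inl ⟨p0, pl⟩) hq hk qe xb xa xe ae
      ⟨ab.1.symm, fun h => ab.2 h.symm⟩ be farp farq hqt tb ta
  push Not at ta tb
  -- neither end of `p` sees `q`
  have hqa : ∀ i ≤ k, q i ≠ a ∧ ¬ G.Adj (q i) a := by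
    intro i hi
    rcases hi.eq_or_lt with rfl | h
    · rw [qe]
      exact ⟨ae.1.symm, fun h => ae.2 h.symm⟩
    · exact ⟨fun h' => (farq i h).2 (h' ▸ xa), fun h' => ta i h h'.symm⟩
  have hqb : ∀ i ≤ k, q i ≠ b ∧ ¬ G.Adj (q i) b := by
    intro i hi
    rcases hi.eq_or_lt with rfl | h
    · rw [qe]
      exact ⟨be.1.symm, fun h => be.2 h.symm⟩
    · exact ⟨fun h' => (farq i h).2 (h' ▸ xb), fun h' => tb i h h'.symm⟩
  have hqp' : ∀ u ≤ k, ∀ v ≤ l, q u ≠ p v ∧ (G.Adj (q u) (p v) → u = 0) := by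
    intro u hu v hv
    rcases Nat.eq_zero_or_pos v with rfl | h0
    · rw [p0]
      exact ⟨(hqa u hu).1, fun h => absurd h (hqa u hu).2⟩
    rcases hv.eq_or_lt with rfl | h1
    · rw [pl]
      exact ⟨(hqb u hu).1, fun h => absurd h (hqb u hu).2⟩
    · exact ⟨fun h => hqp u hu (h ▸ mem_seg h0 h1),
        fun h => (hqt u hu).1 ⟨_, mem_seg h0 h1, h⟩⟩
  obtain ⟨w, ⟨v, hv, hv', rfl⟩, hw⟩ := (hqt 0 (by omega)).2 rfl
  obtain ⟨i, j, hij, hjl, hi, hj, hfl⟩ := exists_first_last ⟨v, hv'.le, hw⟩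
  have hi0 : 0 < i := Nat.pos_of_ne_zero fun h => (hqa 0 (by omega)).2 (by rwa [h, p0] at hi)
  have hjl' : j < l :=
    lt_of_le_of_ne hjl fun h => (hqb 0 (by omega)).2 (by rwa [h, pl] at hj)
  by_cases h2 : j = i ∨ j = i + 1
  · have := theta_or_pyramid_of_arm (Z := seg q 0 (k + 1)) (w := q 0) hp x0 xl farp
      (hq.conn_seg le_rfl) (farq 0 hk).1 (mem_seg le_rfl (by omega))
      ⟨q k, mem_seg (by omega) (by omega), qe ▸ xe⟩ (by
        rintro _ ⟨u, _, hu, rfl⟩ v hv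
        have := hqp' u (by omega) v hv
        refine ⟨this.1, fun h => ?_⟩
        obtain rfl := this.2 h
        exact ⟨rfl, by have := hfl v hv h; omega⟩) hi0 hjl' h2 hi hj
    tauto
  · refine absurd (hasTheta_of_sets (u := x) (v := q 0) (farq 0 hk).1.symm (farq 0 hk).2
      (X := seg p 0 (i + 1)) (Y := seg p j (l + 1)) (Z := seg q 1 (k + 1))
      (hp.conn_seg (by omega)) (hp.conn_seg (by omega)) (hq.conn_seg le_rfl)
      ⟨_, mem_seg le_rfl (by omega), x0⟩ ⟨_, mem_seg (by omega) (by omega), xl⟩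
      ⟨_, mem_seg (by omega) (Nat.lt_succ_self k), qe ▸ xe⟩
      ⟨_, mem_seg (by omega) (by omega), hi⟩ ⟨_, mem_seg le_rfl (by omega), hj⟩
      (hq.touches_seg_right (by omega) hk) (hp.sep_seg (by omega) le_rfl) ?_ ?_) hθ
    · rintro _ ⟨v, _, hv, rfl⟩ _ ⟨u, hu, hu', rfl⟩
      have := hqp' u (by omega) v (by omega)
      exact ⟨this.1.symm, fun h => by have := this.2 h.symm; omega⟩
    · rintro _ ⟨v, _, hv, rfl⟩ _ ⟨u, hu, hu', rfl⟩
      have := hqp' u (by omega) v (by omega)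
      exact ⟨this.1.symm, fun h => by have := this.2 h.symm; omega⟩

end SimpleGraph

/-! ### The long sectors of a maximal frame -/

namespace SimpleGraph

variable {V : Type*} {G : SimpleGraph V}

theorem Touches.mono {u : V} {X Y : Set V} (h : G.Touches u X) (hXY : X ⊆ Y) : G.Touches u Y := by
  obtain ⟨w, hw, hu⟩ := h
  exact ⟨w, hXY hw, hu⟩

/-- No vertex `x` has three pairwise nonadjacent neighbors that are attached to the same connected
set of non-neighbors of `x`. -/
def TripleFree (G : SimpleGraph V) : Prop :=
  ∀ x a b e : V, G.Adj x a → G.Adj x b → G.Adj x e → a ≠ b ∧ ¬ G.Adj a b → a ≠ e ∧ ¬ G.Adj a e →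
    b ≠ e ∧ ¬ G.Adj b e → ∀ D : Set V, G.Conn D → (∀ v ∈ D, v ≠ x ∧ ¬ G.Adj x v) →
      G.Touches a D → G.Touches b D → G.Touches e D → False

/-- The triangle of the pyramid or long prism found here consists of `x`, the last vertex of `p`
and `c`; the hole formed by `x` and `p` is joined to `c` by the path `q` and the set `E`. -/
theorem pyramid_or_prism_of_arm {p q : ℕ → V} {l k i j : ℕ} {x c : V} {E : Set V} (hl : 2 ≤ l)
    (hp : G.IndPath p l) (x0 : G.Adj x (p 0)) (xl : G.Adj x (p l))
    (far : ∀ u, 0 < u → u < l → p u ≠ x ∧ ¬ G.Adj x (p u))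
    (hq : G.IndPath q k) (farq : ∀ w ≤ k, q w ≠ x ∧ ¬ G.Adj x (q w))
    (hqp : ∀ w ≤ k, ∀ u ≤ l, q w ≠ p u ∧ (G.Adj (q w) (p u) → w = 0 ∧ i ≤ u ∧ u ≤ j))
    (hE : G.Conn E) (cE : c ∈ E) (qE : G.Touches (q k) E) (qc : q 0 ≠ c ∧ ¬ G.Adj (q 0) c)
    (hpE : ∀ u ≤ l, ∀ e ∈ E, p u ≠ e ∧ (G.Adj (p u) e → u = l ∧ e = c))
    (hxE : ∀ e ∈ E, x ≠ e ∧ (G.Adj x e → e = c)) (xc : G.Adj x c) (lc : G.Adj (p l) c)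
    (hij : i ≤ j) (hjl : j ≤ l) (qi : G.Adj (q 0) (p i)) (qj : G.Adj (q 0) (p j)) (hil : i < l)
    (hj : j = i + 1 → j < l) : G.HasPyramid ∨ G.HasLongPrism := by
  have hpx : ∀ u ≤ l, p u ≠ x ∧ (G.Adj x (p u) → u = 0 ∨ u = l) := by
    intro u hu
    rcases Nat.eq_zero_or_pos u with rfl | h0
    · exact ⟨x0.ne', fun _ => .inl rfl⟩
    rcases hu.eq_or_lt with rfl | h1
    · exact ⟨xl.ne', fun _ => .inr rfl⟩
    · exact ⟨(far u h0 h1).1, fun h => absurd h (far u h0 h1).2⟩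
  have connA : ∀ u ≤ l, G.Conn (insert x (seg p 0 u)) := by
    intro u hu
    rcases Nat.eq_zero_or_pos u with rfl | h0
    · have : seg p 0 0 = ∅ := by
        ext v
        simp [seg]
      rw [this]
      simpa using conn_singleton (G := G) x
    · exact (hp.conn_seg (by omega)).insert_of_touches ⟨p 0, mem_seg le_rfl h0, x0⟩
  have connZ : ∀ w, G.Conn (seg q w (k + 1) ∪ E) := by
    intro w
    rcases le_or_gt w k with h | h
    · obtain ⟨e, he, hqe⟩ := qE
      exact (hq.conn_seg le_rfl).union hE ⟨q k, mem_seg h (Nat.lt_succ_self k), e, he, .inr hqe⟩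
    · have : seg q w (k + 1) = ∅ := by
        ext v
        simp only [seg, Set.mem_ofPred_eq, Set.mem_empty_iff_false, iff_false]
        rintro ⟨m, h1, h2, -⟩
        omega
      rwa [this, Set.empty_union]
  -- the parts of the hole before and after the neighbors of `q 0`
  have AB : ∀ u v, u < v → G.SepExcept (insert x (seg p 0 u)) (seg p v (l + 1)) x (p l) := by
    rintro u v huv _ (rfl | ⟨s, hs, hs', rfl⟩) _ ⟨t, ht, ht', rfl⟩
    · have := hpx t (by omega)
      exact ⟨this.1.symm, fun h => ⟨rfl, congrArg p (by have := this.2 h; omega)⟩⟩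
    · have := hp s (by omega) t (by omega)
      exact ⟨fun h => by have := this.1 h; omega, fun h => by have := this.2.1 h; omega⟩
  rcases (by omega : j = i ∨ j = i + 1 ∨ i + 2 ≤ j) with rfl | rfl | h2
  · have AZ : G.SepExcept (insert x (seg p 0 j)) (seg q 0 (k + 1) ∪ E) x c := by
      rintro _ (rfl | ⟨s, hs, hs', rfl⟩) _ (⟨w, hw, hw', rfl⟩ | he)
      · have := farq w (by omega)
        exact ⟨this.1.symm, fun h => absurd h this.2⟩
      · have := hxE _ he
        exact ⟨this.1, fun h => ⟨rfl, this.2 h⟩⟩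
      · have := hqp w (by omega) s (by omega)
        exact ⟨this.1.symm, fun h => by have := this.2 h.symm; omega⟩
      · have := hpE s (by omega) _ he
        exact ⟨this.1, fun h => by have := this.2 h; omega⟩
    have BZ : G.SepExcept (seg p (j + 1) (l + 1)) (seg q 0 (k + 1) ∪ E) (p l) c := by
      rintro _ ⟨s, hs, hs', rfl⟩ _ (⟨w, hw, hw', rfl⟩ | he)
      · have := hqp w (by omega) s (by omega)
        exact ⟨this.1.symm, fun h => by have := this.2 h.symm; omega⟩
      · have := hpE s (by omega) _ he
        exact ⟨this.1, fun h => ⟨congrArg p (this.2 h).1, (this.2 h).2⟩⟩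
    have yA : G.Touches (p j) (insert x (seg p 0 j)) := by
      rcases Nat.eq_zero_or_pos j with rfl | h0
      · exact ⟨x, .inl rfl, x0.symm⟩
      · exact (hp.touches_seg_left h0 hjl).mono (Set.subset_insert _ _)
    have yB : G.Touches (p j) (seg p (j + 1) (l + 1)) := hp.touches_seg_right (by omega) hil
    have yZ : G.Touches (p j) (seg q 0 (k + 1) ∪ E) :=
      ⟨q 0, .inl (mem_seg le_rfl (by omega)), qj.symm⟩
    have jc := hpE j hjl c cE
    have jx := hpx j hjl
    have jl := hp j hjl l le_rfl
    have jc' : ¬ G.Adj (p j) c := fun h => by have := jc.2 h; omega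
    have njl : p j ≠ p l := fun h => by have := jl.1 h; omega
    have lB : p l ∈ seg p (j + 1) (l + 1) := mem_seg (by omega) (by omega)
    rcases Nat.eq_zero_or_pos j with h0 | h0
    · exact .inl (hasPyramid_of_sets (connZ 0) (hp.conn_seg le_rfl) (connA j hjl)
        (.inr cE) lB (.inl rfl) jc.1 njl jx.1 yZ yB yA jc'
        (fun h => by have := jl.2.1 h; omega) lc.symm xc.symm xl.symm BZ.symm AZ.symm
        (AB j (j + 1) (by omega)).symm)
    · exact .inl (hasPyramid_of_sets (connZ 0) (connA j hjl) (hp.conn_seg le_rfl)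
        (.inr cE) (.inl rfl) lB jc.1 jx.1 njl yZ yA yB jc'
        (fun h => by have := jx.2 h.symm; omega) xc.symm lc.symm xl AZ.symm BZ.symm
        (AB j (j + 1) (by omega)))
  · have hil' := hj rfl
    refine .inr (hasLongPrism_of_sets (a := p i) (b := p (i + 1)) (c := q 0) (x := x) (y := p l)
      (z := c) (connA (i + 1) hjl) (hp.conn_seg (i := i + 1) le_rfl) (connZ 0)
      (.inr (mem_seg (by omega) (by omega))) (mem_seg le_rfl (by omega))
      (.inl (mem_seg le_rfl (by omega))) (.inl rfl) (mem_seg (by omega) (by omega)) (.inr cE)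
      (hpx i (by omega)).1 (fun h => by have := (hp.eq_iff hjl le_rfl).1 h; omega) qc.1 qc.2
      (hp.adj_succ hjl) qi.symm qj.symm xl xc lc ?_ ?_ ?_)
    · rintro _ (rfl | ⟨s, hs, hs', rfl⟩) _ ⟨t, ht, ht', rfl⟩
      · have := hpx t (by omega)
        exact ⟨this.1.symm, fun h => .inr ⟨rfl, congrArg p (by have := this.2 h; omega)⟩⟩
      · have := hp s (by omega) t (by omega)
        exact ⟨fun h => by have := this.1 h; omega, fun h => .inl
          ⟨congrArg p (by have := this.2.1 h; omega), congrArg p (by have := this.2.1 h; omega)⟩⟩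
    · rintro _ (rfl | ⟨s, hs, hs', rfl⟩) _ (⟨w, hw, hw', rfl⟩ | he)
      · have := farq w (by omega)
        exact ⟨this.1.symm, fun h => absurd h this.2⟩
      · have := hxE _ he
        exact ⟨this.1, fun h => .inr ⟨rfl, this.2 h⟩⟩
      · have := hqp w (by omega) s (by omega)
        exact ⟨this.1.symm, fun h => .inl
          ⟨congrArg p (by have := this.2 h.symm; omega), congrArg q (this.2 h.symm).1⟩⟩
      · have := hpE s (by omega) _ he
        exact ⟨this.1, fun h => by have := this.2 h; omega⟩
    · rintro _ ⟨s, hs, hs', rfl⟩ _ (⟨w, hw, hw', rfl⟩ | he)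
      · have := hqp w (by omega) s (by omega)
        exact ⟨this.1.symm, fun h => .inl
          ⟨congrArg p (by have := this.2 h.symm; omega), congrArg q (this.2 h.symm).1⟩⟩
      · have := hpE s (by omega) _ he
        exact ⟨this.1, fun h => .inr ⟨congrArg p (this.2 h).1, (this.2 h).2⟩⟩
  · have q1 : G.Touches (q 0) (seg q 1 (k + 1) ∪ E) := by
      rcases Nat.eq_zero_or_pos k with rfl | h0
      · exact qE.mono Set.subset_union_right
      · exact (hq.touches_seg_right (k := 0) (by omega) h0).mono Set.subset_union_left
    refine .inl (hasPyramid_of_sets (u := q 0) (x := c) (y := x) (z := p l) (connZ 1)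
      (connA (i + 1) (by omega)) (hp.conn_seg (i := j) le_rfl) (.inr cE) (.inl rfl)
      (mem_seg (by omega) (by omega)) qc.1 (farq 0 (by omega)).1 (hqp 0 (by omega) l le_rfl).1
      q1 ⟨p i, .inr (mem_seg (by omega) (by omega)), qi⟩ ⟨p j, mem_seg le_rfl (by omega), qj⟩
      qc.2 (fun h => (farq 0 (by omega)).2 h.symm) xc.symm lc.symm xl ?_ ?_
      (AB (i + 1) j (by omega)))
    · rintro _ (⟨w, hw, hw', rfl⟩ | he) _ (rfl | ⟨s, hs, hs', rfl⟩)
      · have := farq w (by omega)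
        exact ⟨this.1, fun h => absurd h.symm this.2⟩
      · have := hqp w (by omega) s (by omega)
        exact ⟨this.1, fun h => by have := this.2 h; omega⟩
      · have := hxE _ he
        exact ⟨this.1.symm, fun h => ⟨this.2 h.symm, rfl⟩⟩
      · have := hpE s (by omega) _ he
        exact ⟨this.1.symm, fun h => by have := this.2 h.symm; omega⟩
    · rintro _ (⟨w, hw, hw', rfl⟩ | he) _ ⟨s, hs, hs', rfl⟩
      · have := hqp w (by omega) s (by omega)
        exact ⟨this.1, fun h => by have := this.2 h; omega⟩
      · have := hpE s (by omega) _ he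
        exact ⟨this.1.symm, fun h => ⟨(this.2 h.symm).2, congrArg p (this.2 h.symm).1⟩⟩

namespace Frame

variable {x a b c d : V} {S S' R R' : Set V}

/-- If `b = c` and `a` is adjacent to `d`, then `b` is the apex of a pyramid with triangle
`x a d`. -/
theorem hasPyramid_of_eq_of_adj (F : G.Frame x a b c d S S' R R') (hbc : b = c)
    (had : G.Adj a d) : G.HasPyramid := by
  subst hbc
  have h : ∀ v ∈ S, v ≠ d ∧ ¬ G.Adj v d := fun v hv =>
    ⟨(F.SR' v hv d F.dR').1, fun e => had.ne ((F.SR' v hv d F.dR').2 e).symm⟩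
  have h' : ∀ v ∈ S', v ≠ a ∧ ¬ G.Adj v a := fun v hv =>
    ⟨(F.S'R' v hv a F.aR').1, fun e => had.ne ((F.S'R' v hv a F.aR').2 e)⟩
  refine hasPyramid_of_sets (u := b) (x := a) (y := d) (z := x) (X := insert a S)
    (Y := insert d S') (Z := {x}) (F.connS.insert_of_touches F.aS)
    (F.connS'.insert_of_touches F.dS') (conn_singleton x) (.inl rfl) (.inl rfl) rfl
    F.ne_ab.symm F.ne_bd F.xb.ne' (F.bS.mono (Set.subset_insert _ _))
    (F.cS'.mono (Set.subset_insert _ _)) ⟨x, rfl, F.xb.symm⟩ (fun e => F.not_ab e.symm) F.not_bd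
    had F.xa.symm F.xd.symm ?_ ?_ ?_
  · rintro _ (rfl | hu) _ (rfl | hv)
    · exact ⟨had.ne, fun _ => ⟨rfl, rfl⟩⟩
    · exact ⟨(h' _ hv).1.symm, fun e => absurd e.symm (h' _ hv).2⟩
    · exact ⟨(h _ hu).1, fun e => absurd e (h _ hu).2⟩
    · exact ⟨(F.sepS _ hu _ hv).1, fun e => absurd e (F.sepS _ hu _ hv).2⟩
  · rintro _ (rfl | hu) _ rfl
    · exact ⟨F.xa.ne', fun _ => ⟨rfl, rfl⟩⟩
    · exact ⟨(F.farS _ hu).1, fun e => absurd e.symm (F.farS _ hu).2⟩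
  · rintro _ (rfl | hu) _ rfl
    · exact ⟨F.xd.ne', fun _ => ⟨rfl, rfl⟩⟩
    · exact ⟨(F.farS' _ hu).1, fun e => absurd e.symm (F.farS' _ hu).2⟩

/-- If `b c` and `a d` are edges, then the two long sectors cannot be joined by a vertex that sees
neither `c` nor `d`. -/
theorem pyramid_or_prism_of_link (F : G.Frame x a b c d S S' R R') (hbc : G.Adj b c)
    (had : G.Adj a d) {t : V} (ht : t ≠ x ∧ ¬ G.Adj x t) (tc : ¬ G.Adj t c) (td : ¬ G.Adj t d)
    (tS : G.Touches t S) (tS' : G.Touches t S') : G.HasPyramid ∨ G.HasLongPrism := by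
  obtain ⟨l, p, hl, hp, p0, pl, pS⟩ :=
    F.connS.exists_indPath_through F.ne_ab F.not_ab F.aS F.bS
  have far : ∀ u, 0 < u → u < l → p u ≠ x ∧ ¬ G.Adj x (p u) :=
    fun u h h' => F.farS _ (pS u h h')
  have tS_not : t ∉ S := by
    obtain ⟨s, hs, e⟩ := tS'
    exact fun h => (F.sepS t h s hs).2 e
  have tW : t ∉ seg p 0 (l + 1) := by
    rintro ⟨u, hu, hu', rfl⟩
    rcases Nat.eq_zero_or_pos u with rfl | h0
    · exact ht.2 (p0 ▸ F.xa)
    rcases (Nat.lt_succ_iff.1 hu').eq_or_lt with rfl | h1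
    · exact ht.2 (pl ▸ F.xb)
    · exact tS_not (pS u h0 h1)
  obtain ⟨k, q, hq, qk, hqD, hqt⟩ :=
    (F.connS.insert_of_touches tS).exists_attaching_path (Set.mem_insert t S) tW
      ⟨p 1, .inr (pS 1 (by omega) (by omega)), .inl (mem_seg (by omega) (by omega))⟩
  obtain ⟨w, ⟨u, hu, hu', rfl⟩, hw⟩ := (hqt 0 (by omega)).2 rfl
  obtain ⟨i, j, hij, hjl, hi, hj, hfl⟩ :=
    exists_first_last (p := p) (l := l) ⟨u, by omega, hw⟩
  have farq : ∀ w ≤ k, q w ≠ x ∧ ¬ G.Adj x (q w) := by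
    intro w hw
    rcases (hqD w hw).1 with h | h
    · exact h ▸ ht
    · exact F.farS _ h
  have hqp : ∀ w ≤ k, ∀ u ≤ l, q w ≠ p u ∧ (G.Adj (q w) (p u) → w = 0 ∧ i ≤ u ∧ u ≤ j) := by
    intro w hw u hu
    refine ⟨fun h => (hqD w hw).2 (h ▸ mem_seg (by omega) (by omega)), fun h => ?_⟩
    obtain rfl := (hqt w hw).1 ⟨_, mem_seg (Nat.zero_le u) (by omega), h⟩
    exact ⟨rfl, hfl u hu h⟩
  have Sc : ∀ v ∈ S, v ≠ c ∧ ¬ G.Adj v c := fun v hv =>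
    ⟨(F.SR v hv c F.cR).1, fun e => hbc.ne ((F.SR v hv c F.cR).2 e).symm⟩
  have Sd : ∀ v ∈ S, v ≠ d ∧ ¬ G.Adj v d := fun v hv =>
    ⟨(F.SR' v hv d F.dR').1, fun e => had.ne ((F.SR' v hv d F.dR').2 e).symm⟩
  have aS' : ∀ v ∈ S', a ≠ v ∧ ¬ G.Adj a v := fun v hv =>
    ⟨(F.S'R' v hv a F.aR').1.symm, fun e => had.ne ((F.S'R' v hv a F.aR').2 e.symm)⟩
  have bS' : ∀ v ∈ S', b ≠ v ∧ ¬ G.Adj b v := fun v hv =>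
    ⟨(F.S'R v hv b F.bR).1.symm, fun e => hbc.ne ((F.S'R v hv b F.bR).2 e.symm)⟩
  have qc : ∀ w ≤ k, q w ≠ c ∧ ¬ G.Adj (q w) c := by
    intro w hw
    rcases (hqD w hw).1 with h | h
    · rw [h]
      exact ⟨fun e => ht.2 (e ▸ F.xc), tc⟩
    · exact Sc _ h
  have qd : ∀ w ≤ k, q w ≠ d ∧ ¬ G.Adj (q w) d := by
    intro w hw
    rcases (hqD w hw).1 with h | h
    · rw [h]
      exact ⟨fun e => ht.2 (e ▸ F.xd), td⟩
    · exact Sd _ h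
  have hpE : ∀ u ≤ l, ∀ e ∈ insert c S', p u ≠ e ∧ (G.Adj (p u) e → u = l ∧ e = c) := by
    rintro u hu e he
    rcases Nat.eq_zero_or_pos u with rfl | h0
    · rw [p0]
      rcases he with rfl | he
      · exact ⟨F.ne_ac, fun h => absurd h F.not_ac⟩
      · exact ⟨(aS' e he).1, fun h => absurd h (aS' e he).2⟩
    rcases hu.eq_or_lt with rfl | h1
    · rw [pl]
      rcases he with rfl | he
      · exact ⟨hbc.ne, fun _ => ⟨rfl, rfl⟩⟩
      · exact ⟨(bS' e he).1, fun h => absurd h (bS' e he).2⟩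
    · rcases he with rfl | he
      · exact ⟨(Sc _ (pS u h0 h1)).1, fun h => absurd h (Sc _ (pS u h0 h1)).2⟩
      · have := F.sepS _ (pS u h0 h1) e he
        exact ⟨this.1, fun h => absurd h this.2⟩
  have hpE' : ∀ u ≤ l, ∀ e ∈ insert d S', p u ≠ e ∧ (G.Adj (p u) e → u = 0 ∧ e = d) := by
    rintro u hu e he
    rcases Nat.eq_zero_or_pos u with rfl | h0
    · rw [p0]
      rcases he with rfl | he
      · exact ⟨had.ne, fun _ => ⟨rfl, rfl⟩⟩
      · exact ⟨(aS' e he).1, fun h => absurd h (aS' e he).2⟩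
    rcases hu.eq_or_lt with rfl | h1
    · rw [pl]
      rcases he with rfl | he
      · exact ⟨F.ne_bd, fun h => absurd h F.not_bd⟩
      · exact ⟨(bS' e he).1, fun h => absurd h (bS' e he).2⟩
    · rcases he with rfl | he
      · exact ⟨(Sd _ (pS u h0 h1)).1, fun h => absurd h (Sd _ (pS u h0 h1)).2⟩
      · have := F.sepS _ (pS u h0 h1) e he
        exact ⟨this.1, fun h => absurd h this.2⟩
  by_cases hcase : i < l ∧ (j = i + 1 → j < l)
  · refine pyramid_or_prism_of_arm (E := insert c S') hl hp (p0 ▸ F.xa) (pl ▸ F.xb) far hq farq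
      hqp (F.connS'.insert_of_touches F.cS') (.inl rfl)
      (qk ▸ tS'.mono (Set.subset_insert _ _)) (qc 0 (by omega)) hpE ?_ F.xc (pl ▸ hbc) hij hjl
      hi hj hcase.1 hcase.2
    rintro e (rfl | he)
    · exact ⟨F.xc.ne, fun _ => rfl⟩
    · exact ⟨(F.farS' e he).1.symm, fun h => absurd h (F.farS' e he).2⟩
  · -- the neighbors of `q 0` are at the end `b`, so the triangle `x a d` is used instead
    refine pyramid_or_prism_of_arm (p := fun u => p (l - u)) (i := l - j) (j := l - i)
      (E := insert d S') hl hp.reverse (by simpa [pl] using F.xb) (by simpa [p0] using F.xa)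
      (fun u h h' => far _ (by omega) (by omega)) hq farq ?_
      (F.connS'.insert_of_touches F.dS') (.inl rfl)
      (qk ▸ tS'.mono (Set.subset_insert _ _)) (qd 0 (by omega)) ?_ ?_ F.xd
      (by simpa [p0] using had) (by omega) (by omega) ?_ ?_ (by omega) (by omega)
    · intro w hw u hu
      have := hqp w hw (l - u) (by omega)
      exact ⟨this.1, fun h => by have := this.2 h; omega⟩
    · intro u hu e he
      have := hpE' (l - u) (by omega) e he
      exact ⟨this.1, fun h => by have := this.2 h; exact ⟨by omega, this.2⟩⟩
    · rintro e (rfl | he)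
      · exact ⟨F.xd.ne, fun _ => rfl⟩
      · exact ⟨(F.farS' e he).1.symm, fun h => absurd h (F.farS' e he).2⟩
    · rwa [show l - (l - j) = j by omega]
    · rwa [show l - (l - i) = i by omega]

/-- A vertex outside of `S` that is attached to `S` can see at most the first two vertices of the
path between `b` and `c`. -/
theorem adj_path_of_touches {r : ℕ → V} {l : ℕ} (hG : G.TripleFree)
    (F : G.Frame x a b c d S S' (seg r 0 (l + 1)) R') (hr : G.IndPath r l) (r0 : r 0 = b)
    (rl : r l = c) {t : V} (ht : t ≠ x ∧ ¬ G.Adj x t) (tS : G.Touches t S)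
    (tc : b = c ∨ ¬ G.Adj t c) {i : ℕ} (hi0 : 0 < i) (hi : i ≤ l) (hti : G.Adj t (r i)) :
    i = 1 ∧ G.Adj x (r 1) ∧ r 1 ≠ c := by
  classical
  have hD := F.connS.insert_of_touches tS
  have farD : ∀ v ∈ insert t S, v ≠ x ∧ ¬ G.Adj x v := by
    rintro v (rfl | hv)
    exacts [ht, F.farS v hv]
  have hxr : ∀ u ≤ l, r u ≠ x := fun u hu h =>
    F.xR (h ▸ mem_seg (Nat.zero_le u) (by omega))
  have har : ∀ u ≤ l, a ≠ r u ∧ ¬ G.Adj a (r u) := by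
    intro u hu
    have := F.sepR.symm a F.aR' (r u) (mem_seg (Nat.zero_le u) (by omega))
    exact this
  have aD : G.Touches a (insert t S) := F.aS.mono (Set.subset_insert _ _)
  by_cases hxi : G.Adj x (r i)
  · have h1 : i = 1 := by
      by_contra hne
      refine hG x a b (r i) F.xa F.xb hxi ⟨F.ne_ab, F.not_ab⟩ (har i hi) ?_ (insert t S) hD farD aD
        (F.bS.mono (Set.subset_insert _ _)) ⟨t, .inl rfl, hti.symm⟩
      rw [← r0]
      have := hr 0 (by omega) i hi
      exact ⟨fun h => by have := this.1 h; omega, fun h => by have := this.2.1 h; omega⟩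
    subst h1
    refine ⟨rfl, hxi, fun h => ?_⟩
    rcases tc with h' | h'
    · have := (hr.eq_iff (by omega) hi).1 (r0.trans (h'.trans h.symm))
      omega
    · exact h' (h ▸ hti)
  · -- the ends of the sector that contains `r i` are attached to the same set as `a`
    exfalso
    have h0 : G.Adj x (r 0) := r0 ▸ F.xb
    have hl : G.Adj x (r l) := rl ▸ F.xc
    have hil : i < l := lt_of_le_of_ne hi fun h => hxi (h ▸ hl)
    set f := Nat.findGreatest (fun u => G.Adj x (r u)) i
    have hf : G.Adj x (r f) := Nat.findGreatest_spec (P := fun u => G.Adj x (r u)) (Nat.zero_le i) h0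
    have hfi : f ≤ i := Nat.findGreatest_le i
    have hfi' : f ≠ i := fun h => hxi (h ▸ hf)
    have hf' : ∀ u, f < u → u ≤ i → ¬ G.Adj x (r u) := fun u h h' =>
      Nat.findGreatest_is_greatest h h'
    have hex : ∃ u, i < u ∧ G.Adj x (r u) := ⟨l, hil, hl⟩
    obtain ⟨heq, hg⟩ := Nat.find_spec hex
    have hgl : Nat.find hex ≤ l := Nat.find_min' hex ⟨hil, hl⟩
    have hg' := fun u (hu : u < Nat.find hex) => Nat.find_min hex hu
    set g := Nat.find hex
    have hseg : i ∈ Set.Ioo f g := ⟨by omega, heq⟩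
    refine hG x a (r f) (r g) F.xa hf hg (har f (by omega)) (har g hgl) ?_
      (insert t S ∪ seg r (f + 1) g)
      (hD.union (hr.conn_seg (by omega)) ⟨t, .inl rfl, r i, mem_seg (by omega) heq, .inr hti⟩)
      ?_ (aD.mono Set.subset_union_left)
      ((hr.touches_seg_right (by omega) (by omega)).mono Set.subset_union_right)
      ⟨r (g - 1), .inr (mem_seg (by omega) (by omega)),
        (hr.adj_iff hgl (by omega)).2 (by omega)⟩
    · have := hr f (by omega) g hgl
      exact ⟨fun h => by have := this.1 h; omega, fun h => by have := this.2.1 h; omega⟩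
    · rintro v (hv | ⟨u, hu, hu', rfl⟩)
      · exact farD v hv
      · refine ⟨hxr u (by omega), ?_⟩
        rcases le_or_gt u i with h | h
        · exact hf' u (by omega) h
        · exact fun h' => hg' u hu' ⟨h, h'⟩

/-- In a frame that maximizes the total size of `S` and `S'`, the set `S` absorbs every vertex
that is attached to it, is not adjacent to `x`, and sees neither `c` nor `d` (unless `c = b` or
`d = a`, respectively). -/
theorem mem_of_touches [Finite V] (hρ : ¬ G.HasLongPrism) (hπ : ¬ G.HasPyramid)
    (hG : G.TripleFree) {r r' : ℕ → V} {l l' : ℕ}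
    (F : G.Frame x a b c d S S' (seg r 0 (l + 1)) (seg r' 0 (l' + 1)))
    (hr : G.IndPath r l) (r0 : r 0 = b) (rl : r l = c)
    (hr' : G.IndPath r' l') (r'0 : r' 0 = a) (r'l : r' l' = d)
    (hmax : ∀ y e f g h T T' Q Q', G.Frame y e f g h T T' Q Q' →
      T.ncard + T'.ncard ≤ S.ncard + S'.ncard)
    {t : V} (ht : t ≠ x ∧ ¬ G.Adj x t) (tS : G.Touches t S)
    (tc : b = c ∨ ¬ G.Adj t c) (td : a = d ∨ ¬ G.Adj t d) : t ∈ S := by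
  classical
  by_contra htS
  have hD := F.connS.insert_of_touches tS
  have tS'_not : t ∉ S' := by
    obtain ⟨s, hs, e⟩ := tS
    exact fun h => (F.sepS s hs t h).2 e.symm
  by_cases tS' : G.Touches t S'
  · obtain ⟨s, hs, hts⟩ := tS'
    have hD' : G.Conn (insert t S ∪ S') := hD.union F.connS' ⟨t, .inl rfl, s, hs, .inr hts⟩
    have farD' : ∀ v ∈ insert t S ∪ S', v ≠ x ∧ ¬ G.Adj x v := by
      rintro v ((rfl | hv) | hv)
      exacts [ht, F.farS v hv, F.farS' v hv]
    have sub : S ⊆ insert t S ∪ S' := (Set.subset_insert _ _).trans Set.subset_union_left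
    have hbc : b = c ∨ G.Adj b c := by
      by_contra hne
      push Not at hne
      exact hG x a b c F.xa F.xb F.xc ⟨F.ne_ab, F.not_ab⟩ ⟨F.ne_ac, F.not_ac⟩ hne _ hD' farD'
        (F.aS.mono sub) (F.bS.mono sub) (F.cS'.mono Set.subset_union_right)
    have had : a = d ∨ G.Adj a d := by
      by_contra hne
      push Not at hne
      exact hG x b a d F.xb F.xa F.xd ⟨F.ne_ab.symm, fun h => F.not_ab h.symm⟩
        ⟨F.ne_bd, F.not_bd⟩ hne _ hD' farD'
        (F.bS.mono sub) (F.aS.mono sub) (F.dS'.mono Set.subset_union_right)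
    rcases hbc with hbc | hbc
    · rcases had with had | had
      · exact F.nondeg ⟨had, hbc⟩
      · exact hπ (F.hasPyramid_of_eq_of_adj hbc had)
    · rcases had with had | had
      · exact hπ (F.reflect.hasPyramid_of_eq_of_adj had hbc)
      · have := F.pyramid_or_prism_of_link hbc had ht (tc.resolve_left hbc.ne)
          (td.resolve_left had.ne) tS ⟨s, hs, hts⟩
        tauto
  · -- the frame grows by `t`; `b` or `a` moves one step if `t` sees the next vertex
    have key := fun i hi0 hi h => F.adj_path_of_touches hG hr r0 rl ht tS tc (i := i) hi0 hi h
    have key' := fun i hi0 hi h =>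
      F.reflect.adj_path_of_touches hG hr' r'0 r'l ht tS td (i := i) hi0 hi h
    have tR : ∀ u ≤ l, t ≠ r u := by
      rintro u hu rfl
      obtain ⟨s, hs, e⟩ := tS
      have := (F.SR s hs (r u) (mem_seg (Nat.zero_le u) (by omega))).2 e.symm
      exact ht.2 (this ▸ F.xb)
    have tR' : ∀ u ≤ l', t ≠ r' u := by
      rintro u hu rfl
      obtain ⟨s, hs, e⟩ := tS
      have := (F.SR' s hs (r' u) (mem_seg (Nat.zero_le u) (by omega))).2 e.symm
      exact ht.2 (this ▸ F.xa)
    obtain ⟨β, hβl, hβ1, hβ, hxβ, hβS, hβc⟩ : ∃ β ≤ l, β ≤ 1 ∧ (∀ u ≤ l, 0 < u → G.Adj t (r u) →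
        u = β) ∧ G.Adj x (r β) ∧ G.Touches (r β) (insert t S) ∧ (β = 0 ∨ r β ≠ c) := by
      by_cases h : ∃ u, 0 < u ∧ u ≤ l ∧ G.Adj t (r u)
      · obtain ⟨u, hu0, hul, htu⟩ := h
        obtain ⟨rfl, h1, h2⟩ := key u hu0 hul htu
        exact ⟨1, hul, le_rfl, fun v hv hv0 h => (key v hv0 hv h).1, h1, ⟨t, .inl rfl, htu.symm⟩,
          .inr h2⟩
      · exact ⟨0, by omega, by omega, fun u hu hu0 htu => absurd ⟨u, hu0, hu, htu⟩ h, r0 ▸ F.xb,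
          r0 ▸ F.bS.mono (Set.subset_insert _ _), .inl rfl⟩
    obtain ⟨α, hαl, hα1, hα, hxα, hαS, hαd⟩ : ∃ α ≤ l', α ≤ 1 ∧ (∀ u ≤ l', 0 < u →
        G.Adj t (r' u) → u = α) ∧ G.Adj x (r' α) ∧ G.Touches (r' α) (insert t S) ∧
        (α = 0 ∨ r' α ≠ d) := by
      by_cases h : ∃ u, 0 < u ∧ u ≤ l' ∧ G.Adj t (r' u)
      · obtain ⟨u, hu0, hul, htu⟩ := h
        obtain ⟨rfl, h1, h2⟩ := key' u hu0 hul htu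
        exact ⟨1, hul, le_rfl, fun v hv hv0 h => (key' v hv0 hv h).1, h1, ⟨t, .inl rfl, htu.symm⟩,
          .inr h2⟩
      · exact ⟨0, by omega, by omega, fun u hu hu0 htu => absurd ⟨u, hu0, hu, htu⟩ h, r'0 ▸ F.xa,
          r'0 ▸ F.aS.mono (Set.subset_insert _ _), .inl rfl⟩
    have subR : seg r β (l + 1) ⊆ seg r 0 (l + 1) := by
      rintro _ ⟨u, hu, hu', rfl⟩
      exact mem_seg (Nat.zero_le u) hu'
    have subR' : seg r' α (l' + 1) ⊆ seg r' 0 (l' + 1) := by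
      rintro _ ⟨u, hu, hu', rfl⟩
      exact mem_seg (Nat.zero_le u) hu'
    have F' : G.Frame x (r' α) (r β) c d (insert t S) S' (seg r β (l + 1))
        (seg r' α (l' + 1)) :=
      { xa := hxα, xb := hxβ, xc := F.xc, xd := F.xd
        farS := by
          rintro v (rfl | hv)
          exacts [ht, F.farS v hv]
        farS' := F.farS', xR := fun h => F.xR (subR h), xR' := fun h => F.xR' (subR' h)
        bR := mem_seg le_rfl (by omega), cR := rl ▸ mem_seg hβl (by omega)
        aR' := mem_seg le_rfl (by omega), dR' := r'l ▸ mem_seg hαl (by omega)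
        connS := hD, connS' := F.connS', connR := hr.conn_seg le_rfl
        connR' := hr'.conn_seg le_rfl
        sepS := by
          rintro _ (rfl | hu) v hv
          · exact ⟨fun h => tS'_not (h ▸ hv), fun h => tS' ⟨v, hv, h⟩⟩
          · exact F.sepS _ hu v hv
        sepR := fun u hu v hv => F.sepR u (subR hu) v (subR' hv)
        SR := by
          rintro _ (rfl | hs) _ ⟨u, hu, hu', rfl⟩
          · refine ⟨tR u (by omega), fun h => ?_⟩
            rcases Nat.eq_zero_or_pos u with rfl | h0
            · exact congrArg r (by omega)
            · exact congrArg r (hβ u (by omega) h0 h)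
          · have := F.SR _ hs (r u) (subR (mem_seg hu hu'))
            refine ⟨this.1, fun h => ?_⟩
            have := (hr.eq_iff (by omega) (by omega)).1 ((this.2 h).trans r0.symm)
            exact congrArg r (by omega)
        SR' := by
          rintro _ (rfl | hs) _ ⟨u, hu, hu', rfl⟩
          · refine ⟨tR' u (by omega), fun h => ?_⟩
            rcases Nat.eq_zero_or_pos u with rfl | h0
            · exact congrArg r' (by omega)
            · exact congrArg r' (hα u (by omega) h0 h)
          · have := F.SR' _ hs (r' u) (subR' (mem_seg hu hu'))
            refine ⟨this.1, fun h => ?_⟩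
            have := (hr'.eq_iff (by omega) (by omega)).1 ((this.2 h).trans r'0.symm)
            exact congrArg r' (by omega)
        S'R := fun u hu v hv => F.S'R u hu v (subR hv)
        S'R' := fun u hu v hv => F.S'R' u hu v (subR' hv)
        aS := hαS, bS := hβS, cS' := F.cS', dS' := F.dS'
        nondeg := by
          rintro ⟨h1, h2⟩
          obtain rfl := hαd.resolve_right (not_not_intro h1)
          obtain rfl := hβc.resolve_right (not_not_intro h2)
          exact F.nondeg ⟨r'0.symm.trans h1, r0.symm.trans h2⟩ }
    have := hmax _ _ _ _ _ _ _ _ _ F'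
    rw [Set.ncard_insert_of_notMem htS (Set.toFinite _)] at this
    omega

end Frame

end SimpleGraph

/-! ### The two connecting paths of a maximal frame -/

namespace SimpleGraph

variable {V : Type*} {G : SimpleGraph V}

namespace Frame

variable {x a b c d : V} {S S' R R' : Set V}

/-- The set `D` is a connected set from which the part of the rim between `b` and `c` may be
chosen once `S` and `S'` are known. In a frame that maximizes the total size of `S` and `S'` it is
separated from the part between `a` and `d`: a path `q` between the two parts gives a
three-path-configuration or a larger frame. -/
theorem sep_of_maximal [Finite V] (hρ : ¬ G.HasLongPrism) (hπ : ¬ G.HasPyramid)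
    (hθ : ¬ G.HasTheta) {r r' : ℕ → V} {l l' : ℕ}
    (F : G.Frame x a b c d S S' (seg r 0 (l + 1)) (seg r' 0 (l' + 1)))
    (hr : G.IndPath r l) (r0 : r 0 = b) (rl : r l = c)
    (hr' : G.IndPath r' l') (r'0 : r' 0 = a) (r'l : r' l' = d)
    (hmax : ∀ y e f g h T T' Q Q', G.Frame y e f g h T T' Q Q' →
      T.ncard + T'.ncard ≤ S.ncard + S'.ncard)
    {D : Set V} (hD : G.Conn D) (bD : b ∈ D)
    (hDS : ∀ v ∈ D, v ∉ S ∧ v ∉ S' ∧ (v = b ∨ ¬ G.Touches v S) ∧ (v = c ∨ ¬ G.Touches v S') ∧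
      ¬ G.Adj a v ∧ ¬ G.Adj d v) :
    G.Sep D (seg r' 0 (l' + 1)) := by
  classical
  by_contra hnot
  simp only [Sep, not_forall, not_and_or, not_not] at hnot
  obtain ⟨u, hu, v, hv, huv⟩ := hnot
  have bR' : b ∉ seg r' 0 (l' + 1) := fun h => (F.sepR b F.bR b h).1 rfl
  obtain ⟨k, q, hq, qk, hqD, hqt⟩ := hD.exists_attaching_path bD bR'
    ⟨u, hu, huv.imp (fun h : u = v => h ▸ hv) fun h => ⟨v, hv, h⟩⟩
  have hk : 0 < k := by
    refine Nat.pos_of_ne_zero fun h => ?_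
    obtain ⟨w, hw, e⟩ := (hqt k le_rfl).2 h
    exact (F.sepR b F.bR w hw).2 (qk ▸ e)
  have hex : ∃ m, m ≤ k ∧ G.Touches (q m) (seg r 0 (l + 1)) :=
    ⟨k - 1, by omega, b, F.bR, by
      rw [← qk]
      exact (hq.adj_iff (by omega) le_rfl).2 (by omega)⟩
  obtain ⟨hmk, hm⟩ := Nat.find_spec hex
  have hmin := fun i hi => Nat.find_min hex (m := i) hi
  set m := Nat.find hex
  have hmin' : ∀ w < m, ¬ G.Touches (q w) (seg r 0 (l + 1)) := fun w hw h =>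
    hmin w hw ⟨by omega, h⟩
  have hqR : ∀ w ≤ m, q w ∉ seg r 0 (l + 1) := by
    intro w hw h
    rcases Nat.eq_zero_or_pos w with rfl | h0
    · obtain ⟨z, hz, e⟩ := (hqt 0 (by omega)).2 rfl
      exact (F.sepR _ h z hz).2 e
    · exact hmin' (w - 1) (by omega) ⟨q w, h, (hq.adj_iff (by omega) (by omega)).2 (by omega)⟩
  have hqS : ∀ w ≤ m, q w ∉ S ∧ q w ∉ S' ∧ ¬ G.Touches (q w) S ∧ ¬ G.Touches (q w) S' ∧
      ¬ G.Adj a (q w) ∧ ¬ G.Adj d (q w) := by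
    intro w hw
    obtain ⟨h1, h2, h3, h4, h5, h6⟩ := hDS _ (hqD w (by omega)).1
    exact ⟨h1, h2, h3.resolve_left fun h => hqR w hw (h ▸ F.bR),
      h4.resolve_left fun h => hqR w hw (h ▸ F.cR), h5, h6⟩
  -- the neighbors of the ends of the connecting path
  obtain ⟨w, ⟨u', _, hu', rfl⟩, hw⟩ := (hqt 0 (by omega)).2 rfl
  obtain ⟨i', j', hij', hjl', hi', hj', hfl'⟩ :=
    exists_first_last (p := r') (l := l') ⟨u', by omega, hw⟩
  obtain ⟨w, ⟨v', _, hv', rfl⟩, hw'⟩ := hm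
  obtain ⟨i, j, hij, hjl, hi, hj, hfl⟩ :=
    exists_first_last (p := r) (l := l) ⟨v', by omega, hw'⟩
  have hi'0 : 0 < i' := Nat.pos_of_ne_zero fun h =>
    (hqS 0 (by omega)).2.2.2.2.1 (by rw [h, r'0] at hi'; exact hi'.symm)
  have hjl'' : j' < l' := lt_of_le_of_ne hjl' fun h =>
    (hqS 0 (by omega)).2.2.2.2.2 (by rw [← r'l, ← h]; exact hj'.symm)
  have hqr : ∀ w ≤ m, ∀ u ≤ l, q w ≠ r u ∧ (G.Adj (q w) (r u) → w = m ∧ i ≤ u ∧ u ≤ j) := by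
    intro w hw u hu
    have hmem : r u ∈ seg r 0 (l + 1) := mem_seg (Nat.zero_le u) (by omega)
    refine ⟨fun h => hqR w hw (h ▸ hmem), fun h => ?_⟩
    have : w = m := by
      by_contra hne
      exact hmin' w (by omega) ⟨_, hmem, h⟩
    subst this
    exact ⟨rfl, hfl u hu h⟩
  have hqr' : ∀ w ≤ m, ∀ u ≤ l', q w ≠ r' u ∧
      (G.Adj (q w) (r' u) → w = 0 ∧ i' ≤ u ∧ u ≤ j') := by
    intro w hw u hu
    have hmem : r' u ∈ seg r' 0 (l' + 1) := mem_seg (Nat.zero_le u) (by omega)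
    refine ⟨fun h => (hqD w (by omega)).2 (h ▸ hmem), fun h => ?_⟩
    obtain rfl := (hqt w (by omega)).1 ⟨_, hmem, h⟩
    exact ⟨rfl, hfl' u hu h⟩
  have hrr' : ∀ u ≤ l, ∀ v ≤ l', r u ≠ r' v ∧ ¬ G.Adj (r u) (r' v) := fun u hu v hv =>
    F.sepR _ (mem_seg (Nat.zero_le u) (by omega)) _ (mem_seg (Nat.zero_le v) (by omega))
  have hSr : ∀ s ∈ S, ∀ u ≤ l, s ≠ r u ∧ (G.Adj s (r u) → u = 0) := by
    intro s hs u hu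
    have := F.SR s hs (r u) (mem_seg (Nat.zero_le u) (by omega))
    exact ⟨this.1, fun h => (hr.eq_iff hu (by omega)).1 ((this.2 h).trans r0.symm)⟩
  have hSr' : ∀ s ∈ S, ∀ u ≤ l', s ≠ r' u ∧ (G.Adj s (r' u) → u = 0) := by
    intro s hs u hu
    have := F.SR' s hs (r' u) (mem_seg (Nat.zero_le u) (by omega))
    exact ⟨this.1, fun h => (hr'.eq_iff hu (by omega)).1 ((this.2 h).trans r'0.symm)⟩
  have hS'r : ∀ s ∈ S', ∀ u ≤ l, s ≠ r u ∧ (G.Adj s (r u) → u = l) := by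
    intro s hs u hu
    have := F.S'R s hs (r u) (mem_seg (Nat.zero_le u) (by omega))
    exact ⟨this.1, fun h => (hr.eq_iff hu le_rfl).1 ((this.2 h).trans rl.symm)⟩
  have hS'r' : ∀ s ∈ S', ∀ u ≤ l', s ≠ r' u ∧ (G.Adj s (r' u) → u = l') := by
    intro s hs u hu
    have := F.S'R' s hs (r' u) (mem_seg (Nat.zero_le u) (by omega))
    exact ⟨this.1, fun h => (hr'.eq_iff hu le_rfl).1 ((this.2 h).trans r'l.symm)⟩
  -- the two sides of the rim, one through `S` and one through `S'`
  let A : ℕ → ℕ → Set V := fun α α' => seg r 0 α ∪ S ∪ seg r' 0 α'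
  let B : ℕ → ℕ → Set V := fun β β' => seg r β (l + 1) ∪ S' ∪ seg r' β' (l' + 1)
  have memA : ∀ {α α' u}, u < α → r u ∈ A α α' := fun h => .inl (.inl (mem_seg (Nat.zero_le _) h))
  have memA' : ∀ {α α' u}, u < α' → r' u ∈ A α α' := fun h => .inr (mem_seg (Nat.zero_le _) h)
  have memB : ∀ {β β' u}, β ≤ u → u ≤ l → r u ∈ B β β' :=
    fun h h' => .inl (.inl (mem_seg h (by omega)))
  have memB' : ∀ {β β' u}, β' ≤ u → u ≤ l' → r' u ∈ B β β' :=
    fun h h' => .inr (mem_seg h (by omega))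
  have connA : ∀ α ≤ l + 1, ∀ α' ≤ l' + 1, 0 < α' → G.Conn (A α α') := by
    intro α hα α' hα' h0
    have h1 : G.Conn (seg r 0 α ∪ S) := by
      rcases Nat.eq_zero_or_pos α with rfl | h
      · have : seg r 0 0 = ∅ := by
          ext v
          simp [seg]
        rw [this, Set.empty_union]
        exact F.connS
      · obtain ⟨s, hs, e⟩ := F.bS
        exact (hr.conn_seg hα).union F.connS ⟨b, r0 ▸ mem_seg le_rfl h, s, hs, .inr e⟩
    obtain ⟨s, hs, e⟩ := F.aS
    exact h1.union (hr'.conn_seg hα')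
      ⟨s, .inr hs, a, r'0 ▸ mem_seg le_rfl h0, .inr e.symm⟩
  have connB : ∀ β, ∀ β' ≤ l', G.Conn (B β β') := by
    intro β β' hβ'
    have h1 : G.Conn (seg r β (l + 1) ∪ S') := by
      rcases le_or_gt β l with h | h
      · obtain ⟨s, hs, e⟩ := F.cS'
        exact (hr.conn_seg le_rfl).union F.connS'
          ⟨c, rl ▸ mem_seg h (Nat.lt_succ_self l), s, hs, .inr e⟩
      · have : seg r β (l + 1) = ∅ := by
          ext v
          simp only [seg, Set.mem_ofPred_eq, Set.mem_empty_iff_false, iff_false]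
          rintro ⟨n, h1, h2, -⟩
          omega
        rw [this, Set.empty_union]
        exact F.connS'
    obtain ⟨s, hs, e⟩ := F.dS'
    exact h1.union (hr'.conn_seg le_rfl)
      ⟨s, .inr hs, d, r'l ▸ mem_seg hβ' (Nat.lt_succ_self l'), .inr e.symm⟩
  have AB : ∀ α α' β β', α ≤ β → α' ≤ β' → α ≤ l → 0 < β → α' ≤ l' → 0 < β' →
      ∀ u ∈ A α α', ∀ v ∈ B β β', u ≠ v ∧ (G.Adj u v →
        (α = β ∧ u = r (β - 1) ∧ v = r β) ∨ (α' = β' ∧ u = r' (β' - 1) ∧ v = r' β')) := by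
    rintro α α' β β' h1 h2 h3 h4 h5 h6 _ ((⟨u, _, hu, rfl⟩ | hu) | ⟨u, _, hu, rfl⟩) _
      ((⟨v, hv, hv', rfl⟩ | hv) | ⟨v, hv, hv', rfl⟩)
    · have := hr u (by omega) v (by omega)
      refine ⟨fun h => by have := this.1 h; omega, fun h => .inl ⟨?_, congrArg r ?_,
        congrArg r ?_⟩⟩ <;> have := this.2.1 h <;> omega
    · have := hS'r _ hv u (by omega)
      exact ⟨this.1.symm, fun h => by have := this.2 h.symm; omega⟩
    · have := hrr' u (by omega) v (by omega)
      exact ⟨this.1, fun h => absurd h this.2⟩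
    · have := hSr _ hu v (by omega)
      exact ⟨this.1, fun h => by have := this.2 h; omega⟩
    · have := F.sepS _ hu _ hv
      exact ⟨this.1, fun h => absurd h this.2⟩
    · have := hSr' _ hu v (by omega)
      exact ⟨this.1, fun h => by have := this.2 h; omega⟩
    · have := hrr' v (by omega) u (by omega)
      exact ⟨this.1.symm, fun h => absurd h.symm this.2⟩
    · have := hS'r' _ hv u (by omega)
      exact ⟨this.1.symm, fun h => by have := this.2 h.symm; omega⟩
    · have := hr' u (by omega) v (by omega)
      refine ⟨fun h => by have := this.1 h; omega, fun h => .inr ⟨?_, congrArg r' ?_,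
        congrArg r' ?_⟩⟩ <;> have := this.2.1 h <;> omega
  have AT : ∀ α α' s e, α ≤ l + 1 → α' ≤ l' + 1 → e ≤ m + 1 →
      ∀ u ∈ A α α', ∀ v ∈ seg q s e, u ≠ v ∧ (G.Adj u v →
        (v = q m ∧ m < e ∧ ∃ w, i ≤ w ∧ w ≤ j ∧ w < α ∧ u = r w) ∨
        (v = q 0 ∧ s = 0 ∧ ∃ w, i' ≤ w ∧ w ≤ j' ∧ w < α' ∧ u = r' w)) := by
    rintro α α' s e h1 h2 h3 _ ((⟨u, _, hu, rfl⟩ | hu) | ⟨u, _, hu, rfl⟩) _ ⟨v, hv, hv', rfl⟩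
    · have := hqr v (by omega) u (by omega)
      refine ⟨this.1.symm, fun h => .inl ⟨congrArg q ?_, ?_, u, ?_, ?_, hu, rfl⟩⟩ <;>
        have := this.2 h.symm <;> omega
    · have := hqS v (by omega)
      exact ⟨fun h => this.1 (h ▸ hu), fun h => absurd ⟨_, hu, h.symm⟩ this.2.2.1⟩
    · have := hqr' v (by omega) u (by omega)
      refine ⟨this.1.symm, fun h => .inr ⟨congrArg q ?_, ?_, u, ?_, ?_, hu, rfl⟩⟩ <;>
        have := this.2 h.symm <;> omega
  have BT : ∀ β β' s e, e ≤ m + 1 →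
      ∀ u ∈ B β β', ∀ v ∈ seg q s e, u ≠ v ∧ (G.Adj u v →
        (v = q m ∧ m < e ∧ ∃ w, i ≤ w ∧ w ≤ j ∧ β ≤ w ∧ u = r w) ∨
        (v = q 0 ∧ s = 0 ∧ ∃ w, i' ≤ w ∧ w ≤ j' ∧ β' ≤ w ∧ u = r' w)) := by
    rintro β β' s e h3 _ ((⟨u, hu', hu, rfl⟩ | hu) | ⟨u, hu', hu, rfl⟩) _ ⟨v, hv, hv', rfl⟩
    · have := hqr v (by omega) u (by omega)
      refine ⟨this.1.symm, fun h => .inl ⟨congrArg q ?_, ?_, u, ?_, ?_, hu', rfl⟩⟩ <;>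
        have := this.2 h.symm <;> omega
    · have := hqS v (by omega)
      exact ⟨fun h => this.2.1 (h ▸ hu), fun h => absurd ⟨_, hu, h.symm⟩ this.2.2.2.1⟩
    · have := hqr' v (by omega) u (by omega)
      refine ⟨this.1.symm, fun h => .inr ⟨congrArg q ?_, ?_, u, ?_, ?_, hu', rfl⟩⟩ <;>
        have := this.2 h.symm <;> omega
  have riA : ∀ i α', i ≤ l → G.Touches (r i) (A i α') := by
    intro i α' hil
    rcases Nat.eq_zero_or_pos i with rfl | h0
    · rw [r0]
      exact F.bS.mono fun s hs => .inl (.inr hs)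
    · exact ⟨r (i - 1), memA (by omega), (hr.adj_iff hil (by omega)).2 (by omega)⟩
  have riB : ∀ i β', i ≤ l → G.Touches (r i) (B (i + 1) β') := by
    intro i β' hil
    rcases hil.eq_or_lt with rfl | h0
    · rw [rl]
      exact F.cS'.mono fun s hs => .inl (.inr hs)
    · exact ⟨r (i + 1), memB le_rfl h0, hr.adj_succ h0⟩
  have r'iA : ∀ i α, 0 < i → i ≤ l' → G.Touches (r' i) (A α i) := fun i α h h' =>
    ⟨r' (i - 1), memA' (by omega), (hr'.adj_iff h' (by omega)).2 (by omega)⟩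
  have r'iB : ∀ i β, i < l' → G.Touches (r' i) (B β (i + 1)) := fun i β h =>
    ⟨r' (i + 1), memB' le_rfl h, hr'.adj_succ h⟩
  have connT : ∀ s e, e ≤ m + 1 → G.Conn (seg q s e) := fun s e he => hq.conn_seg (by omega)
  -- a frame with larger sides is impossible
  have big : ∀ α α' β β' y e f g h Q Q', 0 < α' → ¬ G.Frame y e f g h (A α α') (B β β') Q Q' := by
    intro α α' β β' y e f g h Q Q' h0 F'
    have h1 := hmax _ _ _ _ _ _ _ _ _ F'
    have h2 : S.ncard < (A α α').ncard := by
      refine Set.ncard_lt_ncard ⟨fun s hs => .inl (.inr hs), fun hsub => F.aS_notMem (hsub ?_)⟩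
        (Set.toFinite _)
      rw [← r'0]
      exact memA' h0
    have h3 : S'.ncard ≤ (B β β').ncard :=
      Set.ncard_le_ncard (fun s hs => .inl (.inr hs)) (Set.toFinite _)
    omega
  rcases Nat.eq_zero_or_pos m with hm0 | hm0
  · rw [hm0] at hi hj hqr hqr'
    by_cases hone : i = j ∧ i' = j'
    · obtain ⟨rfl, rfl⟩ := hone
      refine hθ (hasTheta_of_sets (u := r i) (v := r' i') (X := A i i') (Y := B (i + 1) (i' + 1))
        (Z := seg q 0 1) (hrr' i hjl i' hjl').1 (hrr' i hjl i' hjl').2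
        (connA _ (by omega) _ (by omega) hi'0) (connB _ _ hjl'') (connT _ _ (by omega))
        (riA _ _ hjl) (riB _ _ hjl) ⟨q 0, mem_seg le_rfl (by omega), hi.symm⟩
        (r'iA _ _ hi'0 hjl') (r'iB _ _ hjl'') ⟨q 0, mem_seg le_rfl (by omega), hi'.symm⟩
        ?_ ?_ ?_)
      · intro u hu v hv
        have := AB i i' (i + 1) (i' + 1) (by omega) (by omega) (by omega) (by omega) (by omega)
          (by omega) u hu v hv
        exact ⟨this.1, fun h => by rcases this.2 h with h | h <;> omega⟩
      · intro u hu v hv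
        have := AT i i' 0 1 (by omega) (by omega) (by omega) u hu v hv
        refine ⟨this.1, fun h => ?_⟩
        rcases this.2 h with ⟨_, _, w, _⟩ | ⟨_, _, w, _⟩ <;> omega
      · intro u hu v hv
        have := BT (i + 1) (i' + 1) 0 1 (by omega) u hu v hv
        refine ⟨this.1, fun h => ?_⟩
        rcases this.2 h with ⟨_, _, w, _⟩ | ⟨_, _, w, _⟩ <;> omega
    · -- the single vertex of the path is the center of a larger frame
      refine big i i' (j + 1) (j' + 1) (q 0) (r' i') (r i) (r j) (r' j') (seg r i (j + 1))
        (seg r' i' (j' + 1)) hi'0 ?_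
      constructor
      · exact hi'
      · exact hi
      · exact hj
      · exact hj'
      · intro v hv
        have := AT i i' 0 1 (by omega) (by omega) (by omega) v hv (q 0)
          (mem_seg le_rfl (by omega))
        refine ⟨this.1, fun h => ?_⟩
        rcases this.2 h.symm with ⟨_, _, w, _⟩ | ⟨_, _, w, _⟩ <;> omega
      · intro v hv
        have := BT (j + 1) (j' + 1) 0 1 (by omega) v hv (q 0) (mem_seg le_rfl (by omega))
        refine ⟨this.1, fun h => ?_⟩
        rcases this.2 h.symm with ⟨_, _, w, _⟩ | ⟨_, _, w, _⟩ <;> omega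
      · rintro ⟨u, hu, hu', e⟩
        exact (hqr 0 le_rfl u (by omega)).1 e
      · rintro ⟨u, hu, hu', e⟩
        exact (hqr' 0 le_rfl u (by omega)).1 e
      · exact mem_seg le_rfl (by omega)
      · exact mem_seg hij (by omega)
      · exact mem_seg le_rfl (by omega)
      · exact mem_seg hij' (by omega)
      · exact connA _ (by omega) _ (by omega) hi'0
      · exact connB _ _ hjl''
      · exact hr.conn_seg (by omega)
      · exact hr'.conn_seg (by omega)
      · intro u hu v hv
        have := AB i i' (j + 1) (j' + 1) (by omega) (by omega) (by omega) (by omega) (by omega)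
          (by omega) u hu v hv
        exact ⟨this.1, fun h => by rcases this.2 h with h | h <;> omega⟩
      · rintro _ ⟨u, hu, hu', rfl⟩ _ ⟨v, hv, hv', rfl⟩
        exact hrr' u (by omega) v (by omega)
      · rintro _ ((⟨u, _, hu, rfl⟩ | hu) | ⟨u, _, hu, rfl⟩) _ ⟨v, hv, hv', rfl⟩
        · have := hr u (by omega) v (by omega)
          exact ⟨fun h => by have := this.1 h; omega,
            fun h => congrArg r (by have := this.2.1 h; omega)⟩
        · have := hSr _ hu v (by omega)
          exact ⟨this.1, fun h => congrArg r (by have := this.2 h; omega)⟩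
        · have := hrr' v (by omega) u (by omega)
          exact ⟨this.1.symm, fun h => absurd h.symm this.2⟩
      · rintro _ ((⟨u, _, hu, rfl⟩ | hu) | ⟨u, _, hu, rfl⟩) _ ⟨v, hv, hv', rfl⟩
        · have := hrr' u (by omega) v (by omega)
          exact ⟨this.1, fun h => absurd h this.2⟩
        · have := hSr' _ hu v (by omega)
          exact ⟨this.1, fun h => congrArg r' (by have := this.2 h; omega)⟩
        · have := hr' u (by omega) v (by omega)
          exact ⟨fun h => by have := this.1 h; omega,
            fun h => congrArg r' (by have := this.2.1 h; omega)⟩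
      · rintro _ ((⟨u, hu, hu', rfl⟩ | hu) | ⟨u, hu, hu', rfl⟩) _ ⟨v, hv, hv', rfl⟩
        · have := hr u (by omega) v (by omega)
          exact ⟨fun h => by have := this.1 h; omega,
            fun h => congrArg r (by have := this.2.1 h; omega)⟩
        · have := hS'r _ hu v (by omega)
          exact ⟨this.1, fun h => congrArg r (by have := this.2 h; omega)⟩
        · have := hrr' v (by omega) u (by omega)
          exact ⟨this.1.symm, fun h => absurd h.symm this.2⟩
      · rintro _ ((⟨u, hu, hu', rfl⟩ | hu) | ⟨u, hu, hu', rfl⟩) _ ⟨v, hv, hv', rfl⟩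
        · have := hrr' u (by omega) v (by omega)
          exact ⟨this.1, fun h => absurd h this.2⟩
        · have := hS'r' _ hu v (by omega)
          exact ⟨this.1, fun h => congrArg r' (by have := this.2 h; omega)⟩
        · have := hr' u (by omega) v (by omega)
          exact ⟨fun h => by have := this.1 h; omega,
            fun h => congrArg r' (by have := this.2.1 h; omega)⟩
      · exact r'iA _ _ hi'0 (by omega)
      · exact riA _ _ (by omega)
      · exact riB _ _ hjl
      · exact r'iB _ _ hjl''
      · rintro ⟨h1, h2⟩
        exact hone ⟨(hr.eq_iff (by omega) (by omega)).1 h2,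
          (hr'.eq_iff (by omega) (by omega)).1 h1⟩
  · have q0m : q 0 ≠ q m := fun h => by
      have := (hq.eq_iff (by omega) hmk).1 h
      omega
    have hiq := hqr 0 (by omega) i (by omega)
    have hjq := hqr 0 (by omega) j hjl
    have hiq' := hqr' m le_rfl i' (by omega)
    have hjq' := hqr' m le_rfl j' hjl'
    have hiq0 : ¬ G.Adj (q 0) (r i) := fun h => by have := hiq.2 h; omega
    have hjq0 : ¬ G.Adj (q 0) (r j) := fun h => by have := hjq.2 h; omega
    have hiqm : ¬ G.Adj (q m) (r' i') := fun h => by have := hiq'.2 h; omega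
    have hjqm : ¬ G.Adj (q m) (r' j') := fun h => by have := hjq'.2 h; omega
    have rr := fun u (hu : u ≤ l) v (hv : v ≤ l') => (hrr' u hu v hv).1.symm
    have rr' : ∀ u ≤ l, ∀ v ≤ l', ¬ G.Adj (r' v) (r u) := fun u hu v hv h =>
      (hrr' u hu v hv).2 h.symm
    rcases (by omega : j = i ∨ j = i + 1 ∨ i + 2 ≤ j) with rfl | rfl | h2 <;>
      rcases (by omega : j' = i' ∨ j' = i' + 1 ∨ i' + 2 ≤ j') with rfl | rfl | h2'
    · -- one neighbor and one neighbor
      refine hθ (hasTheta_of_sets (u := r j) (v := r' j') (X := A j j') (Y := B (j + 1) (j' + 1))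
        (Z := seg q 0 (m + 1)) (hrr' j hjl j' hjl').1 (hrr' j hjl j' hjl').2
        (connA _ (by omega) _ (by omega) hi'0) (connB _ _ hjl'') (connT _ _ le_rfl)
        (riA _ _ hjl) (riB _ _ hjl) ⟨q m, mem_seg (by omega) (by omega), hi.symm⟩
        (r'iA _ _ hi'0 hjl') (r'iB _ _ hjl'') ⟨q 0, mem_seg le_rfl (by omega), hi'.symm⟩
        ?_ ?_ ?_)
      · intro u hu v hv
        have := AB j j' (j + 1) (j' + 1) (by omega) (by omega) (by omega) (by omega) (by omega)
          (by omega) u hu v hv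
        exact ⟨this.1, fun h => by rcases this.2 h with h | h <;> omega⟩
      · intro u hu v hv
        have := AT j j' 0 (m + 1) (by omega) (by omega) (by omega) u hu v hv
        refine ⟨this.1, fun h => ?_⟩
        rcases this.2 h with ⟨_, _, w, _⟩ | ⟨_, _, w, _⟩ <;> omega
      · intro u hu v hv
        have := BT (j + 1) (j' + 1) 0 (m + 1) (by omega) u hu v hv
        refine ⟨this.1, fun h => ?_⟩
        rcases this.2 h with ⟨_, _, w, _⟩ | ⟨_, _, w, _⟩ <;> omega
    · -- one neighbor and two consecutive neighbors
      refine hπ (hasPyramid_of_sets (u := r j) (x := r' i') (y := r' (i' + 1)) (z := q 0)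
        (X := A j (i' + 1)) (Y := B (j + 1) (i' + 1)) (Z := seg q 0 (m + 1))
        (connA _ (by omega) _ (by omega) (by omega)) (connB _ _ hjl') (connT _ _ le_rfl)
        (memA' (by omega)) (memB' le_rfl (by omega)) (mem_seg le_rfl (by omega))
        (hrr' j hjl i' (by omega)).1 (hrr' j hjl _ hjl').1 hiq.1.symm
        (riA _ _ hjl) (riB _ _ hjl) ⟨q m, mem_seg (by omega) (by omega), hi.symm⟩
        (hrr' j hjl i' (by omega)).2 (hrr' j hjl _ hjl').2 (hr'.adj_succ hjl') hi'.symm hj'.symm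
        ?_ ?_ ?_)
      · intro u hu v hv
        have := AB j (i' + 1) (j + 1) (i' + 1) (by omega) (by omega) (by omega) (by omega)
          (by omega) (by omega) u hu v hv
        refine ⟨this.1, fun h => ?_⟩
        rcases this.2 h with h | h
        · omega
        · exact h.2
      · intro u hu v hv
        have := AT j (i' + 1) 0 (m + 1) (by omega) (by omega) (by omega) u hu v hv
        refine ⟨this.1, fun h => ?_⟩
        rcases this.2 h with ⟨_, _, w, _⟩ | ⟨e, _, w, h1, h2, h3, rfl⟩
        · omega
        · exact ⟨congrArg r' (by omega), e⟩
      · intro u hu v hv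
        have := BT (j + 1) (i' + 1) 0 (m + 1) (by omega) u hu v hv
        refine ⟨this.1, fun h => ?_⟩
        rcases this.2 h with ⟨_, _, w, _⟩ | ⟨e, _, w, h1, h2, h3, rfl⟩
        · omega
        · exact ⟨congrArg r' (by omega), e⟩
    · -- one neighbor and two far neighbors
      refine hθ (hasTheta_of_sets (u := r j) (v := q 0) (X := A j (i' + 1)) (Y := B (j + 1) j')
        (Z := seg q 1 (m + 1)) hiq.1.symm (fun h => hiq0 h.symm)
        (connA _ (by omega) _ (by omega) (by omega)) (connB _ _ hjl') (connT _ _ le_rfl)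
        (riA _ _ hjl) (riB _ _ hjl) ⟨q m, mem_seg hm0 (by omega), hi.symm⟩
        ⟨r' i', memA' (by omega), hi'⟩ ⟨r' j', memB' le_rfl hjl', hj'⟩
        (hq.touches_seg_right (by omega) (by omega)) ?_ ?_ ?_)
      · intro u hu v hv
        have := AB j (i' + 1) (j + 1) j' (by omega) (by omega) (by omega) (by omega) (by omega)
          (by omega) u hu v hv
        exact ⟨this.1, fun h => by rcases this.2 h with h | h <;> omega⟩
      · intro u hu v hv
        have := AT j (i' + 1) 1 (m + 1) (by omega) (by omega) (by omega) u hu v hv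
        refine ⟨this.1, fun h => ?_⟩
        rcases this.2 h with ⟨_, _, w, _⟩ | ⟨_, _, w, _⟩ <;> omega
      · intro u hu v hv
        have := BT (j + 1) j' 1 (m + 1) (by omega) u hu v hv
        refine ⟨this.1, fun h => ?_⟩
        rcases this.2 h with ⟨_, _, w, _⟩ | ⟨_, _, w, _⟩ <;> omega
    · -- two consecutive neighbors and one neighbor
      refine hπ (hasPyramid_of_sets (u := r' j') (x := r i) (y := r (i + 1)) (z := q m)
        (X := A (i + 1) j') (Y := B (i + 1) (j' + 1)) (Z := seg q 0 (m + 1))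
        (connA _ (by omega) _ (by omega) hi'0) (connB _ _ hjl'') (connT _ _ le_rfl)
        (memA (by omega)) (memB le_rfl hjl) (mem_seg (by omega) (by omega))
        (rr _ (by omega) _ hjl') (rr _ hjl _ hjl') hiq'.1.symm
        (r'iA _ _ hi'0 hjl') (r'iB _ _ hjl'') ⟨q 0, mem_seg le_rfl (by omega), hi'.symm⟩
        (rr' _ (by omega) _ hjl') (rr' _ hjl _ hjl') (hr.adj_succ hjl) hi.symm hj.symm
        ?_ ?_ ?_)
      · intro u hu v hv
        have := AB (i + 1) j' (i + 1) (j' + 1) (by omega) (by omega) (by omega) (by omega)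
          (by omega) (by omega) u hu v hv
        refine ⟨this.1, fun h => ?_⟩
        rcases this.2 h with h | h
        · exact h.2
        · omega
      · intro u hu v hv
        have := AT (i + 1) j' 0 (m + 1) (by omega) (by omega) (by omega) u hu v hv
        refine ⟨this.1, fun h => ?_⟩
        rcases this.2 h with ⟨e, _, w, h1, h2, h3, rfl⟩ | ⟨_, _, w, _⟩
        · exact ⟨congrArg r (by omega), e⟩
        · omega
      · intro u hu v hv
        have := BT (i + 1) (j' + 1) 0 (m + 1) (by omega) u hu v hv
        refine ⟨this.1, fun h => ?_⟩
        rcases this.2 h with ⟨e, _, w, h1, h2, h3, rfl⟩ | ⟨_, _, w, _⟩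
        · exact ⟨congrArg r (by omega), e⟩
        · omega
    · -- two consecutive neighbors on both sides
      refine hρ (hasLongPrism_of_sets (a := q m) (b := r (i + 1)) (c := r i) (x := q 0)
        (y := r' (i' + 1)) (z := r' i') (X := seg q 0 (m + 1)) (Y := B (i + 1) (i' + 1))
        (Z := A (i + 1) (i' + 1)) (connT _ _ le_rfl) (connB _ _ hjl')
        (connA _ (by omega) _ (by omega) (by omega)) (mem_seg (by omega) (by omega))
        (memB le_rfl hjl) (memA (by omega)) (mem_seg le_rfl (by omega)) (memB' le_rfl hjl')
        (memA' (by omega)) q0m.symm (hrr' _ hjl _ hjl').1 (hrr' _ (by omega) _ (by omega)).1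
        (hrr' _ (by omega) _ (by omega)).2 hj hi (hr.adj_succ hjl).symm hj' hi'
        (hr'.adj_succ hjl').symm ?_ ?_ ?_)
      · intro v hv u hu
        have := BT (i + 1) (i' + 1) 0 (m + 1) (by omega) u hu v hv
        refine ⟨this.1.symm, fun h => ?_⟩
        rcases this.2 h.symm with ⟨e, _, w, h1, h2, h3, rfl⟩ | ⟨e, _, w, h1, h2, h3, rfl⟩
        · exact .inl ⟨e, congrArg r (by omega)⟩
        · exact .inr ⟨e, congrArg r' (by omega)⟩
      · intro v hv u hu
        have := AT (i + 1) (i' + 1) 0 (m + 1) (by omega) (by omega) (by omega) u hu v hv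
        refine ⟨this.1.symm, fun h => ?_⟩
        rcases this.2 h.symm with ⟨e, _, w, h1, h2, h3, rfl⟩ | ⟨e, _, w, h1, h2, h3, rfl⟩
        · exact .inl ⟨e, congrArg r (by omega)⟩
        · exact .inr ⟨e, congrArg r' (by omega)⟩
      · intro v hv u hu
        have := AB (i + 1) (i' + 1) (i + 1) (i' + 1) (by omega) (by omega) (by omega) (by omega)
          (by omega) (by omega) u hu v hv
        refine ⟨this.1.symm, fun h => ?_⟩
        rcases this.2 h.symm with h | h
        · exact .inl ⟨h.2.2, h.2.1⟩
        · exact .inr ⟨h.2.2, h.2.1⟩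
    · -- two consecutive neighbors and two far neighbors
      refine hπ (hasPyramid_of_sets (u := q 0) (x := r i) (y := r (i + 1)) (z := q m)
        (X := A (i + 1) (i' + 1)) (Y := B (i + 1) j') (Z := seg q 1 (m + 1))
        (connA _ (by omega) _ (by omega) (by omega)) (connB _ _ hjl') (connT _ _ le_rfl)
        (memA (by omega)) (memB le_rfl hjl) (mem_seg hm0 (by omega))
        hiq.1 hjq.1 q0m ⟨r' i', memA' (by omega), hi'⟩ ⟨r' j', memB' le_rfl hjl', hj'⟩
        (hq.touches_seg_right (by omega) (by omega)) hiq0 hjq0 (hr.adj_succ hjl) hi.symm hj.symm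
        ?_ ?_ ?_)
      · intro u hu v hv
        have := AB (i + 1) (i' + 1) (i + 1) j' (by omega) (by omega) (by omega) (by omega)
          (by omega) (by omega) u hu v hv
        refine ⟨this.1, fun h => ?_⟩
        rcases this.2 h with h | h
        · exact h.2
        · omega
      · intro u hu v hv
        have := AT (i + 1) (i' + 1) 1 (m + 1) (by omega) (by omega) (by omega) u hu v hv
        refine ⟨this.1, fun h => ?_⟩
        rcases this.2 h with ⟨e, _, w, h1, h2, h3, rfl⟩ | ⟨_, _, w, _⟩
        · exact ⟨congrArg r (by omega), e⟩
        · omega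
      · intro u hu v hv
        have := BT (i + 1) j' 1 (m + 1) (by omega) u hu v hv
        refine ⟨this.1, fun h => ?_⟩
        rcases this.2 h with ⟨e, _, w, h1, h2, h3, rfl⟩ | ⟨_, _, w, _⟩
        · exact ⟨congrArg r (by omega), e⟩
        · omega
    · -- two far neighbors and one neighbor
      refine hθ (hasTheta_of_sets (u := q m) (v := r' j') (X := A (i + 1) j')
        (Y := B j (j' + 1)) (Z := seg q 0 m) hiq'.1 hiqm
        (connA _ (by omega) _ (by omega) hi'0) (connB _ _ hjl'') (connT _ _ (by omega))
        ⟨r i, memA (by omega), hi⟩ ⟨r j, memB le_rfl hjl, hj⟩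
        (hq.touches_seg_left hm0 hmk) (r'iA _ _ hi'0 hjl') (r'iB _ _ hjl'')
        ⟨q 0, mem_seg le_rfl hm0, hi'.symm⟩ ?_ ?_ ?_)
      · intro u hu v hv
        have := AB (i + 1) j' j (j' + 1) (by omega) (by omega) (by omega) (by omega) (by omega)
          (by omega) u hu v hv
        exact ⟨this.1, fun h => by rcases this.2 h with h | h <;> omega⟩
      · intro u hu v hv
        have := AT (i + 1) j' 0 m (by omega) (by omega) (by omega) u hu v hv
        refine ⟨this.1, fun h => ?_⟩
        rcases this.2 h with ⟨_, _, w, _⟩ | ⟨_, _, w, _⟩ <;> omega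
      · intro u hu v hv
        have := BT j (j' + 1) 0 m (by omega) u hu v hv
        refine ⟨this.1, fun h => ?_⟩
        rcases this.2 h with ⟨_, _, w, _⟩ | ⟨_, _, w, _⟩ <;> omega
    · -- two far neighbors and two consecutive neighbors
      refine hπ (hasPyramid_of_sets (u := q m) (x := r' i') (y := r' (i' + 1)) (z := q 0)
        (X := A (i + 1) (i' + 1)) (Y := B j (i' + 1)) (Z := seg q 0 m)
        (connA _ (by omega) _ (by omega) (by omega)) (connB _ _ hjl') (connT _ _ (by omega))
        (memA' (by omega)) (memB' le_rfl hjl') (mem_seg le_rfl hm0)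
        hiq'.1 hjq'.1 q0m.symm ⟨r i, memA (by omega), hi⟩ ⟨r j, memB le_rfl hjl, hj⟩
        (hq.touches_seg_left hm0 hmk) hiqm hjqm (hr'.adj_succ hjl') hi'.symm hj'.symm
        ?_ ?_ ?_)
      · intro u hu v hv
        have := AB (i + 1) (i' + 1) j (i' + 1) (by omega) (by omega) (by omega) (by omega)
          (by omega) (by omega) u hu v hv
        refine ⟨this.1, fun h => ?_⟩
        rcases this.2 h with h | h
        · omega
        · exact h.2
      · intro u hu v hv
        have := AT (i + 1) (i' + 1) 0 m (by omega) (by omega) (by omega) u hu v hv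
        refine ⟨this.1, fun h => ?_⟩
        rcases this.2 h with ⟨_, _, w, _⟩ | ⟨e, _, w, h1, h2, h3, rfl⟩
        · omega
        · exact ⟨congrArg r' (by omega), e⟩
      · intro u hu v hv
        have := BT j (i' + 1) 0 m (by omega) u hu v hv
        refine ⟨this.1, fun h => ?_⟩
        rcases this.2 h with ⟨_, _, w, _⟩ | ⟨e, _, w, h1, h2, h3, rfl⟩
        · omega
        · exact ⟨congrArg r' (by omega), e⟩
    · -- two far neighbors on both sides
      rcases Nat.lt_or_ge 1 m with hm1 | hm1
      · have : ¬ G.Adj (q 0) (q m) := fun h => by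
          have := (hq.adj_iff (by omega) hmk).1 h
          omega
        refine hθ (hasTheta_of_sets (u := q 0) (v := q m) (X := A (i + 1) (i' + 1))
          (Y := B j j') (Z := seg q 1 m) q0m this
          (connA _ (by omega) _ (by omega) (by omega)) (connB _ _ hjl') (connT _ _ (by omega))
          ⟨r' i', memA' (by omega), hi'⟩ ⟨r' j', memB' le_rfl hjl', hj'⟩
          (hq.touches_seg_right (by omega) (by omega))
          ⟨r i, memA (by omega), hi⟩ ⟨r j, memB le_rfl hjl, hj⟩
          (hq.touches_seg_left hm1 hmk) ?_ ?_ ?_)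
        · intro u hu v hv
          have := AB (i + 1) (i' + 1) j j' (by omega) (by omega) (by omega) (by omega) (by omega)
            (by omega) u hu v hv
          exact ⟨this.1, fun h => by rcases this.2 h with h | h <;> omega⟩
        · intro u hu v hv
          have := AT (i + 1) (i' + 1) 1 m (by omega) (by omega) (by omega) u hu v hv
          refine ⟨this.1, fun h => ?_⟩
          rcases this.2 h with ⟨_, _, w, _⟩ | ⟨_, _, w, _⟩ <;> omega
        · intro u hu v hv
          have := BT j j' 1 m (by omega) u hu v hv
          refine ⟨this.1, fun h => ?_⟩
          rcases this.2 h with ⟨_, _, w, _⟩ | ⟨_, _, w, _⟩ <;> omega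
      · -- reroute the rim through `q 1` and take `q 0` as the center of a larger frame
        have hm1' : m = 1 := by omega
        rw [hm1'] at hi hj
        have q01 : G.Adj (q 0) (q 1) := hq.adj_succ (by omega)
        have h1R' : ∀ u ≤ l', q 1 ≠ r' u ∧ ¬ G.Adj (q 1) (r' u) := by
          intro u hu
          have := hqr' 1 (by omega) u hu
          exact ⟨this.1, fun h => by have := this.2 h; omega⟩
        have hq1 := hqS 1 (by omega)
        refine big (i + 1) i' j (j' + 1) (q 0) (r' i') (q 1) (q 1) (r' j') {q 1}
          (seg r' i' (j' + 1)) hi'0 ?_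
        constructor
        · exact hi'
        · exact q01
        · exact q01
        · exact hj'
        · intro v hv
          have := AT (i + 1) i' 0 1 (by omega) (by omega) (by omega) v hv (q 0)
            (mem_seg le_rfl (by omega))
          refine ⟨this.1, fun h => ?_⟩
          rcases this.2 h.symm with ⟨_, _, w, _⟩ | ⟨_, _, w, _⟩ <;> omega
        · intro v hv
          have := BT j (j' + 1) 0 1 (by omega) v hv (q 0) (mem_seg le_rfl (by omega))
          refine ⟨this.1, fun h => ?_⟩
          rcases this.2 h.symm with ⟨_, _, w, _⟩ | ⟨_, _, w, _⟩ <;> omega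
        · exact q01.ne
        · rintro ⟨u, hu, hu', e⟩
          exact (hqr' 0 (by omega) u (by omega)).1 e
        · rfl
        · rfl
        · exact mem_seg le_rfl (by omega)
        · exact mem_seg hij' (by omega)
        · exact connA _ (by omega) _ (by omega) hi'0
        · exact connB _ _ hjl''
        · exact conn_singleton _
        · exact hr'.conn_seg (by omega)
        · intro u hu v hv
          have := AB (i + 1) i' j (j' + 1) (by omega) (by omega) (by omega) (by omega) (by omega)
            (by omega) u hu v hv
          exact ⟨this.1, fun h => by rcases this.2 h with h | h <;> omega⟩
        · rintro _ rfl _ ⟨v, hv, hv', rfl⟩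
          exact h1R' v (by omega)
        · rintro u hu _ rfl
          exact ⟨(AT (i + 1) i' 1 2 (by omega) (by omega) (by omega) u hu (q 1)
            (mem_seg le_rfl (by omega))).1, fun _ => rfl⟩
        · rintro _ ((⟨u, _, hu, rfl⟩ | hu) | ⟨u, _, hu, rfl⟩) _ ⟨v, hv, hv', rfl⟩
          · have := hrr' u (by omega) v (by omega)
            exact ⟨this.1, fun h => absurd h this.2⟩
          · have := hSr' _ hu v (by omega)
            exact ⟨this.1, fun h => congrArg r' (by have := this.2 h; omega)⟩
          · have := hr' u (by omega) v (by omega)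
            exact ⟨fun h => by have := this.1 h; omega,
              fun h => congrArg r' (by have := this.2.1 h; omega)⟩
        · rintro u hu _ rfl
          exact ⟨(BT j (j' + 1) 1 2 (by omega) u hu (q 1)
            (mem_seg le_rfl (by omega))).1, fun _ => rfl⟩
        · rintro _ ((⟨u, hu, hu', rfl⟩ | hu) | ⟨u, hu, hu', rfl⟩) _ ⟨v, hv, hv', rfl⟩
          · have := hrr' u (by omega) v (by omega)
            exact ⟨this.1, fun h => absurd h this.2⟩
          · have := hS'r' _ hu v (by omega)
            exact ⟨this.1, fun h => congrArg r' (by have := this.2 h; omega)⟩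
          · have := hr' u (by omega) v (by omega)
            exact ⟨fun h => by have := this.1 h; omega,
              fun h => congrArg r' (by have := this.2.1 h; omega)⟩
        · exact r'iA _ _ hi'0 (by omega)
        · exact ⟨r i, memA (by omega), hi⟩
        · exact ⟨r j, memB le_rfl hjl, hj⟩
        · exact r'iB _ _ hjl''
        · rintro ⟨h1, _⟩
          have := (hr'.eq_iff (by omega) (by omega)).1 h1
          omega

end Frame

end SimpleGraph

/-! ### Certificates for broken wheels -/

namespace SimpleGraph

variable {V : Type*} {G : SimpleGraph V}

/-- The component of `s` in the subgraph induced on `X`; it is empty if `s` is not in `X`. -/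
def compIn (G : SimpleGraph V) (X : Set V) (s : V) : Set V :=
  {v | s ∈ X ∧ Relation.ReflTransGen (fun u w => G.Adj u w ∧ w ∈ X) s v}

theorem compIn_subset {X : Set V} {s : V} : G.compIn X s ⊆ X := by
  rintro v ⟨hs, hv⟩
  induction hv with
  | refl => exact hs
  | tail _ h _ => exact h.2

theorem self_mem_compIn {X : Set V} {s : V} (hs : s ∈ X) : s ∈ G.compIn X s := ⟨hs, .refl⟩

theorem conn_compIn (X : Set V) (s : V) : G.Conn (G.compIn X s) := by
  refine conn_of_center s ?_
  rintro v ⟨hs, hv⟩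
  induction hv with
  | refl => exact .refl
  | tail h1 h2 ih => exact ih.tail ⟨h2.1, ⟨hs, h1⟩, hs, h1.tail h2⟩

theorem Conn.subset_compIn {X Y : Set V} (hY : G.Conn Y) (hYX : Y ⊆ X) {s : V} (hs : s ∈ Y) :
    Y ⊆ G.compIn X s := fun v hv =>
  ⟨hYX hs, Relation.ReflTransGen.mono (fun _ _ h => ⟨h.1, hYX h.2.2⟩) _ _ (hY s hs v hv)⟩

theorem compIn_subset_of_closed {X Y : Set V} {s : V} (hs : s ∈ Y)
    (h : ∀ v ∈ X, G.Touches v Y → v ∈ Y) : G.compIn X s ⊆ Y := by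
  rintro v ⟨_, hv⟩
  induction hv with
  | refl => exact hs
  | tail _ h2 ih => exact h _ h2.2 ⟨_, ih, h2.1.symm⟩

/-- The vertices other than `x` that are not adjacent to `x`. -/
def farFrom (G : SimpleGraph V) (x : V) : Set V := {v | v ≠ x ∧ ¬ G.Adj x v}

/-- Three independent neighbors `a`, `b`, `e` of `x` are attached to the component of `s` among
the non-neighbors of `x`. -/
def TripleCert (G : SimpleGraph V) (x a b e s : V) : Prop :=
  G.Adj x a ∧ G.Adj x b ∧ G.Adj x e ∧ (a ≠ b ∧ ¬ G.Adj a b) ∧ (a ≠ e ∧ ¬ G.Adj a e) ∧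
    (b ≠ e ∧ ¬ G.Adj b e) ∧ G.Touches a (G.compIn (G.farFrom x) s) ∧
    G.Touches b (G.compIn (G.farFrom x) s) ∧ G.Touches e (G.compIn (G.farFrom x) s)

/-- The vertices among which the interior of the sector from `a` to `b` is sought. -/
def sectorDom (G : SimpleGraph V) (x a b c d : V) : Set V :=
  {v | (v ≠ x ∧ ¬ G.Adj x v) ∧ (b = c ∨ ¬ G.Adj c v) ∧ (a = d ∨ ¬ G.Adj d v)}

/-- The vertices among which the interior of the sector from `c` to `d` is sought once the set `S`
for the sector from `a` to `b` is known. -/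
def sectorDom' (G : SimpleGraph V) (x a b c d : V) (S : Set V) : Set V :=
  {v | (v ≠ x ∧ ¬ G.Adj x v) ∧ (b = c ∨ ¬ G.Adj b v) ∧ (a = d ∨ ¬ G.Adj a v) ∧
    v ∉ S ∧ ¬ G.Touches v S}

/-- The vertices among which the part of the rim from `b` to `c` is sought. -/
def linkDom (G : SimpleGraph V) (x a b c d : V) (S S' : Set V) : Set V :=
  {v | v ≠ x ∧ v ∉ S ∧ v ∉ S' ∧ (v = b ∨ ¬ G.Touches v S) ∧ (v = c ∨ ¬ G.Touches v S') ∧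
    (v ≠ a ∧ v ≠ d) ∧ ¬ G.Adj a v ∧ ¬ G.Adj d v}

/-- The vertices among which the part of the rim from `d` to `a` is sought once the set `R` for
the part from `b` to `c` is known. -/
def linkDom' (G : SimpleGraph V) (x a d : V) (S S' R : Set V) : Set V :=
  {v | v ≠ x ∧ v ∉ S ∧ v ∉ S' ∧ (v = a ∨ ¬ G.Touches v S) ∧ (v = d ∨ ¬ G.Touches v S') ∧
    v ∉ R ∧ ¬ G.Touches v R}

/-- The conditions that turn the sets `S`, `S'`, `R`, `R'` into a frame, provided that these are
components in the domains above. -/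
def FrameCert (G : SimpleGraph V) (x a b c d : V) (S S' R R' : Set V) : Prop :=
  G.Adj x a ∧ G.Adj x b ∧ G.Adj x c ∧ G.Adj x d ∧ G.Touches a S ∧ G.Touches b S ∧
    G.Touches c S' ∧ G.Touches d S' ∧ c ∈ R ∧ d ∈ R' ∧ ¬ (a = d ∧ b = c)

/-- The frame computed greedily from its corners `a`, `b`, `c`, `d` and from vertices `s` and `t`
of its two long sectors exists. -/
def GreedyCert (G : SimpleGraph V) (x a b c d s t : V) : Prop :=
  ∃ S S' R R', S = G.compIn (G.sectorDom x a b c d) s ∧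
    S' = G.compIn (G.sectorDom' x a b c d S) t ∧ R = G.compIn (G.linkDom x a b c d S S') b ∧
    R' = G.compIn (G.linkDom' x a d S S' R) a ∧ G.FrameCert x a b c d S S' R R'

theorem GreedyCert.hasBrokenWheel {x a b c d s t : V} (h : G.GreedyCert x a b c d s t) :
    G.HasBrokenWheel := by
  obtain ⟨S, S', R, R', hS, hS', hR, hR', xa, xb, xc, xd, aS, bS, cS', dS', cR, dR', hne⟩ := h
  have subS : S ⊆ G.sectorDom x a b c d := hS ▸ compIn_subset
  have subS' : S' ⊆ G.sectorDom' x a b c d S := hS' ▸ compIn_subset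
  have subR : R ⊆ G.linkDom x a b c d S S' := hR ▸ compIn_subset
  have subR' : R' ⊆ G.linkDom' x a d S S' R := hR' ▸ compIn_subset
  have bR : b ∈ R := by
    rw [hR] at cR ⊢
    exact self_mem_compIn cR.1
  have aR' : a ∈ R' := by
    rw [hR'] at dR' ⊢
    exact self_mem_compIn dR'.1
  refine Frame.hasBrokenWheel (x := x) (a := a) (b := b) (c := c) (d := d) (S := S) (S' := S')
    (R := R) (R' := R')
    { xa := xa, xb := xb, xc := xc, xd := xd
      farS := fun v hv => (subS hv).1, farS' := fun v hv => (subS' hv).1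
      xR := fun h => (subR h).1 rfl, xR' := fun h => (subR' h).1 rfl
      bR := bR, cR := cR, aR' := aR', dR' := dR'
      connS := hS ▸ conn_compIn _ _, connS' := hS' ▸ conn_compIn _ _
      connR := hR ▸ conn_compIn _ _, connR' := hR' ▸ conn_compIn _ _
      sepS := ?_, sepR := ?_, SR := ?_, SR' := ?_, S'R := ?_, S'R' := ?_
      aS := aS, bS := bS, cS' := cS', dS' := dS', nondeg := hne }
  · intro u hu v hv
    obtain ⟨-, -, -, h1, h2⟩ := subS' hv
    exact ⟨fun h => h1 (h ▸ hu), fun h => h2 ⟨u, hu, h.symm⟩⟩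
  · intro u hu v hv
    obtain ⟨-, -, -, -, -, h1, h2⟩ := subR' hv
    exact ⟨fun h => h1 (h ▸ hu), fun h => h2 ⟨u, hu, h.symm⟩⟩
  · intro u hu v hv
    obtain ⟨-, h1, -, h2, -⟩ := subR hv
    exact ⟨fun h => h1 (h ▸ hu), fun h => h2.resolve_right (not_not_intro ⟨u, hu, h.symm⟩)⟩
  · intro u hu v hv
    obtain ⟨-, h1, -, h2, -⟩ := subR' hv
    exact ⟨fun h => h1 (h ▸ hu), fun h => h2.resolve_right (not_not_intro ⟨u, hu, h.symm⟩)⟩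
  · intro u hu v hv
    obtain ⟨-, -, h1, -, h2, -⟩ := subR hv
    exact ⟨fun h => h1 (h ▸ hu), fun h => h2.resolve_right (not_not_intro ⟨u, hu, h.symm⟩)⟩
  · intro u hu v hv
    obtain ⟨-, -, h1, -, h2, -⟩ := subR' hv
    exact ⟨fun h => h1 (h ▸ hu), fun h => h2.resolve_right (not_not_intro ⟨u, hu, h.symm⟩)⟩

theorem TripleCert.hasBrokenWheel [Finite V] (hπ : ¬ G.HasPyramid) (hθ : ¬ G.HasTheta)
    {x a b e s : V} (h : G.TripleCert x a b e s) : G.HasBrokenWheel := by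
  obtain ⟨xa, xb, xe, ab, ae, be, aD, bD, eD⟩ := h
  exact hasBrokenWheel_of_triple hθ hπ xa xb xe ab ae be (conn_compIn _ _)
    (fun v hv => (compIn_subset hv : v ∈ G.farFrom x)) aD bD eD

theorem exists_tripleCert (h : ¬ G.TripleFree) : ∃ x a b e s, G.TripleCert x a b e s := by
  simp only [TripleFree, not_forall, not_false_eq_true] at h
  obtain ⟨x, a, b, e, xa, xb, xe, ab, ae, be, D, hD, far, ⟨s, hs, has⟩, bD, eD, -⟩ := h
  have sub : D ⊆ G.compIn (G.farFrom x) s := hD.subset_compIn far hs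
  exact ⟨x, a, b, e, s, xa, xb, xe, ab, ae, be, ⟨s, sub hs, has⟩, bD.mono sub, eD.mono sub⟩

theorem seg_reverse (r : ℕ → V) (l : ℕ) :
    seg (fun i => r (l - i)) 0 (l + 1) = seg r 0 (l + 1) := by
  ext v
  constructor
  · rintro ⟨k, _, hk, rfl⟩
    exact mem_seg (Nat.zero_le _) (by omega)
  · rintro ⟨k, _, hk, rfl⟩
    exact ⟨l - k, Nat.zero_le _, by omega, congrArg r (by omega)⟩

namespace Frame

variable {x a b c d : V} {S S' R R' : Set V}

theorem restrict (F : G.Frame x a b c d S S' R R') {Q Q' : Set V} (hQ : Q ⊆ R) (hQ' : Q' ⊆ R')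
    (bQ : b ∈ Q) (cQ : c ∈ Q) (aQ' : a ∈ Q') (dQ' : d ∈ Q') (connQ : G.Conn Q)
    (connQ' : G.Conn Q') : G.Frame x a b c d S S' Q Q' where
  xa := F.xa
  xb := F.xb
  xc := F.xc
  xd := F.xd
  farS := F.farS
  farS' := F.farS'
  xR h := F.xR (hQ h)
  xR' h := F.xR' (hQ' h)
  bR := bQ
  cR := cQ
  aR' := aQ'
  dR' := dQ'
  connS := F.connS
  connS' := F.connS'
  connR := connQ
  connR' := connQ'
  sepS := F.sepS
  sepR u hu v hv := F.sepR u (hQ hu) v (hQ' hv)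
  SR u hu v hv := F.SR u hu v (hQ hv)
  SR' u hu v hv := F.SR' u hu v (hQ' hv)
  S'R u hu v hv := F.S'R u hu v (hQ hv)
  S'R' u hu v hv := F.S'R' u hu v (hQ' hv)
  aS := F.aS
  bS := F.bS
  cS' := F.cS'
  dS' := F.dS'
  nondeg := F.nondeg

/-- In a graph without three-path-configurations other than short prisms, in which no triple
certificate exists, a frame that maximizes the total size of its long sectors is found greedily. -/
theorem exists_greedyCert [Finite V] (hρ : ¬ G.HasLongPrism) (hπ : ¬ G.HasPyramid)
    (hθ : ¬ G.HasTheta) (hG : G.TripleFree) (F : G.Frame x a b c d S S' R R')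
    (hmax : ∀ y e f g h T T' Q Q', G.Frame y e f g h T T' Q Q' →
      T.ncard + T'.ncard ≤ S.ncard + S'.ncard) :
    ∃ s t, G.GreedyCert x a b c d s t := by
  obtain ⟨l, r, hr, r0, rl, hrR⟩ := F.connR.exists_indPath F.bR F.cR
  obtain ⟨l', r', hr', r'0, r'l, hr'R⟩ := F.connR'.exists_indPath F.aR' F.dR'
  have F₁ : G.Frame x a b c d S S' (seg r 0 (l + 1)) (seg r' 0 (l' + 1)) := by
    refine F.restrict ?_ ?_ (r0 ▸ mem_seg le_rfl (by omega))
      (rl ▸ mem_seg (by omega) (by omega)) (r'0 ▸ mem_seg le_rfl (by omega))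
      (r'l ▸ mem_seg (by omega) (by omega)) (hr.conn_seg le_rfl) (hr'.conn_seg le_rfl)
    · rintro _ ⟨k, _, hk, rfl⟩
      exact hrR k (by omega)
    · rintro _ ⟨k, _, hk, rfl⟩
      exact hr'R k (by omega)
  clear F
  have F₂ := F₁.swap
  rw [← seg_reverse r, ← seg_reverse r'] at F₂
  have bc : ∀ s ∈ S, b = c ∨ ¬ G.Adj s c := fun s hs =>
    or_iff_not_imp_right.2 fun h => ((F₁.SR s hs c F₁.cR).2 (not_not.1 h)).symm
  have ad : ∀ s ∈ S, a = d ∨ ¬ G.Adj s d := fun s hs =>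
    or_iff_not_imp_right.2 fun h => ((F₁.SR' s hs d F₁.dR').2 (not_not.1 h)).symm
  have bc' : ∀ s ∈ S', b = c ∨ ¬ G.Adj s b := fun s hs =>
    or_iff_not_imp_right.2 fun h => (F₁.S'R s hs b F₁.bR).2 (not_not.1 h)
  have ad' : ∀ s ∈ S', a = d ∨ ¬ G.Adj s a := fun s hs =>
    or_iff_not_imp_right.2 fun h => (F₁.S'R' s hs a F₁.aR').2 (not_not.1 h)
  obtain ⟨s, hs, -⟩ := F₁.aS
  obtain ⟨t, ht, -⟩ := F₁.cS'
  have eS : S = G.compIn (G.sectorDom x a b c d) s := by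
    have sub : S ⊆ G.sectorDom x a b c d := fun v hv => ⟨F₁.farS v hv,
      (bc v hv).imp_right fun h e => h e.symm, (ad v hv).imp_right fun h e => h e.symm⟩
    refine Set.Subset.antisymm (F₁.connS.subset_compIn sub hs)
      (compIn_subset_of_closed hs fun v hv hvS => ?_)
    exact F₁.mem_of_touches hρ hπ hG hr r0 rl hr' r'0 r'l hmax hv.1 hvS
      (hv.2.1.imp_right fun h e => h e.symm) (hv.2.2.imp_right fun h e => h e.symm)
  have eS' : S' = G.compIn (G.sectorDom' x a b c d S) t := by
    have sub : S' ⊆ G.sectorDom' x a b c d S := by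
      refine fun v hv => ⟨F₁.farS' v hv, (bc' v hv).imp_right fun h e => h e.symm,
        (ad' v hv).imp_right fun h e => h e.symm, fun h => (F₁.sepS v h v hv).1 rfl, ?_⟩
      rintro ⟨u, hu, e⟩
      exact (F₁.sepS u hu v hv).2 e.symm
    refine Set.Subset.antisymm (F₁.connS'.subset_compIn sub ht)
      (compIn_subset_of_closed ht fun v hv hvS => ?_)
    · refine F₂.mem_of_touches hρ hπ hG hr.reverse (by simpa using rl) (by simpa using r0)
        hr'.reverse (by simpa using r'l) (by simpa using r'0) (fun y e f g h T T' Q Q' F' => ?_)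
        hv.1 hvS ?_ ?_
      · rw [add_comm S'.ncard]
        exact hmax _ _ _ _ _ _ _ _ _ F'
      · exact hv.2.1.imp Eq.symm fun h e => h e.symm
      · exact hv.2.2.1.imp Eq.symm fun h e => h e.symm
  have subR : seg r 0 (l + 1) ⊆ G.linkDom x a b c d S S' := by
    intro v hv
    refine ⟨fun h => F₁.xR (h ▸ hv), fun h => (F₁.SR v h v hv).1 rfl,
      fun h => (F₁.S'R v h v hv).1 rfl, ?_, ?_,
      ⟨fun h => (F₁.sepR v hv a F₁.aR').1 h, fun h => (F₁.sepR v hv d F₁.dR').1 h⟩,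
      fun h => (F₁.sepR v hv a F₁.aR').2 h.symm, fun h => (F₁.sepR v hv d F₁.dR').2 h.symm⟩
    · refine or_iff_not_imp_right.2 fun h => ?_
      obtain ⟨u, hu, e⟩ := not_not.1 h
      exact (F₁.SR u hu v hv).2 e.symm
    · refine or_iff_not_imp_right.2 fun h => ?_
      obtain ⟨u, hu, e⟩ := not_not.1 h
      exact (F₁.S'R u hu v hv).2 e.symm
  have subC := F₁.connR.subset_compIn subR F₁.bR
  set D := G.compIn (G.linkDom x a b c d S S') b with hDdef
  have sep : G.Sep D (seg r' 0 (l' + 1)) := by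
    refine F₁.sep_of_maximal hρ hπ hθ hr r0 rl hr' r'0 r'l hmax (conn_compIn _ _)
      (subC F₁.bR) fun v hv => ?_
    obtain ⟨-, h1, h2, h3, h4, -, h5, h6⟩ := compIn_subset hv
    exact ⟨h1, h2, h3, h4, h5, h6⟩
  have subR' : seg r' 0 (l' + 1) ⊆ G.linkDom' x a d S S' D := by
    intro v hv
    refine ⟨fun h => F₁.xR' (h ▸ hv), fun h => (F₁.SR' v h v hv).1 rfl,
      fun h => (F₁.S'R' v h v hv).1 rfl, ?_, ?_, fun h => (sep v h v hv).1 rfl, ?_⟩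
    · refine or_iff_not_imp_right.2 fun h => ?_
      obtain ⟨u, hu, e⟩ := not_not.1 h
      exact (F₁.SR' u hu v hv).2 e.symm
    · refine or_iff_not_imp_right.2 fun h => ?_
      obtain ⟨u, hu, e⟩ := not_not.1 h
      exact (F₁.S'R' u hu v hv).2 e.symm
    · rintro ⟨u, hu, e⟩
      exact (sep u hu v hv).2 e.symm
  exact ⟨s, t, S, S', D, _, eS, eS', hDdef, rfl, F₁.xa, F₁.xb, F₁.xc, F₁.xd, F₁.aS, F₁.bS,
    F₁.cS', F₁.dS', subC F₁.cR, F₁.connR'.subset_compIn subR' F₁.aR' F₁.dR', F₁.nondeg⟩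

end Frame

/-- What the algorithm tests: in a graph without long prisms, pyramids and thetas, a broken wheel
exists if and only if there is a certificate of one of the two kinds. -/
theorem hasBrokenWheel_iff_cert [Finite V] (hρ : ¬ G.HasLongPrism) (hπ : ¬ G.HasPyramid)
    (hθ : ¬ G.HasTheta) :
    G.HasBrokenWheel ↔
      ∃ x a b c d s t, G.TripleCert x a b c s ∨ G.GreedyCert x a b c d s t := by
  classical
  constructor
  · intro h
    by_cases hG : G.TripleFree
    · obtain ⟨x, a, b, c, d, S, S', R, R', F⟩ := h.exists_frame
      let P : ℕ → Prop := fun N => ∃ x a b c d S S' R R', G.Frame x a b c d S S' R R' ∧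
        S.ncard + S'.ncard = N
      have bound : ∀ S : Set V, S.ncard ≤ Nat.card V := fun S => by
        rw [← Set.ncard_univ]
        exact Set.ncard_le_ncard (Set.subset_univ S) (Set.toFinite _)
      have hP := Nat.findGreatest_spec (P := P) (n := Nat.card V + Nat.card V)
        (Nat.add_le_add (bound S) (bound S')) ⟨x, a, b, c, d, S, S', R, R', F, rfl⟩
      obtain ⟨x, a, b, c, d, S, S', R, R', F, hF⟩ := hP
      obtain ⟨s, t, hst⟩ := F.exists_greedyCert hρ hπ hθ hG fun y e f g h T T' Q Q' F' => by
        rw [hF]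
        exact Nat.le_findGreatest (Nat.add_le_add (bound T) (bound T'))
          ⟨y, e, f, g, h, T, T', Q, Q', F', rfl⟩
      exact ⟨x, a, b, c, d, s, t, .inr hst⟩
    · obtain ⟨x, a, b, e, s, hc⟩ := exists_tripleCert hG
      exact ⟨x, a, b, e, e, s, s, .inl hc⟩
  · rintro ⟨x, a, b, c, d, s, t, h | h⟩
    · exact h.hasBrokenWheel hπ hθ
    · exact h.hasBrokenWheel

end SimpleGraph

/-! ### Programs with bounded loops -/

namespace WordRAM

/-- The state after setting a register. -/
def State.setVar (s : State) (x v : ℕ) : State := { s with var := Function.update s.var x v }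

/-- The state after setting an array cell. -/
def State.setArr (s : State) (a i v : ℕ) : State :=
  { s with arr := Function.update s.arr a (Function.update (s.arr a) i v) }

@[simp] theorem State.setVar_arr (s : State) (x v : ℕ) : (s.setVar x v).arr = s.arr := rfl

theorem State.setVar_var (s : State) (x v y : ℕ) :
    (s.setVar x v).var y = if y = x then v else s.var y := by
  simp [State.setVar, Function.update_apply]

theorem State.setArr_arr (s : State) (a i v b j : ℕ) :
    (s.setArr a i v).arr b j = if b = a ∧ j = i then v else s.arr b j := by
  by_cases h : b = a
  · subst h
    simp [State.setArr, Function.update_apply]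
  · simp [State.setArr, h]

/-- Programs whose only loops are bounded ones: `forLt r p` runs `p` with register `r` holding
`0, 1, …, n - 1` in turn, where `n` is the content of register `0`. -/
inductive Cmd where
  | write (a : ℕ) (i e : Expr)
  | seq (p q : Cmd)
  | guard (e : Expr) (p : Cmd)
  | forLt (r : ℕ) (p : Cmd)

namespace Cmd

/-- The translation into a program of the machine. -/
def toProgram : Cmd → Program
  | write a i e => .write a i e
  | seq p q => .seq p.toProgram q.toProgram
  | guard e p => .ite e p.toProgram .skip
  | forLt r p => .seq (.assign r (.const 0))
      (.loop (.lt (.var r) (.var 0))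
        (.seq p.toProgram (.assign r (.add (.var r) (.const 1)))))

/-- The final state, as a function of the initial state. -/
def eval (w : ℕ) : Cmd → State → State
  | write a i e, s => s.setArr a (i.eval w s) (e.eval w s)
  | seq p q, s => q.eval w (p.eval w s)
  | guard e p, s => if e.eval w s ≠ 0 then p.eval w s else s
  | forLt r p, s =>
      Nat.rec (s.setVar r 0) (fun i t => (p.eval w t).setVar r (i + 1)) (s.var 0)

/-- The registers that may be changed. -/
def vars : Cmd → Finset ℕ
  | write _ _ _ => ∅
  | seq p q => p.vars ∪ q.vars
  | guard _ p => p.vars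
  | forLt r p => insert r p.vars

/-- The arrays that may be changed. -/
def arrs : Cmd → Finset ℕ
  | write a _ _ => {a}
  | seq p q => p.arrs ∪ q.arrs
  | guard _ p => p.arrs
  | forLt _ p => p.arrs

/-- The loop registers are protected inside the loops, and so is register `0`. -/
def WF : Cmd → Prop
  | write _ _ _ => True
  | seq p q => p.WF ∧ q.WF
  | guard _ p => p.WF
  | forLt r p => r ≠ 0 ∧ r ∉ p.vars ∧ p.WF

/-- The nesting depth of the loops. -/
def depth : Cmd → ℕ
  | write _ _ _ => 0
  | seq p q => max p.depth q.depth
  | guard _ p => p.depth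
  | forLt _ p => p.depth + 1

/-- The constant factor in the bound for the running time. -/
def factor : Cmd → ℕ
  | write _ i e => i.cost + e.cost + 1
  | seq p q => p.factor + q.factor
  | guard e p => e.cost + 2 + p.factor
  | forLt _ p => p.factor + 14

end Cmd

/-- The states `s` and `t` agree outside of the registers in `X` and the arrays in `A`. -/
def Agree (X A : Finset ℕ) (s t : State) : Prop :=
  (∀ x ∉ X, t.var x = s.var x) ∧ ∀ a ∉ A, t.arr a = s.arr a

namespace Agree

variable {X Y A B : Finset ℕ} {s t u : State}

theorem refl (X A : Finset ℕ) (s : State) : Agree X A s s := ⟨fun _ _ => rfl, fun _ _ => rfl⟩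

theorem trans (h : Agree X A s t) (h' : Agree X A t u) : Agree X A s u :=
  ⟨fun x hx => (h'.1 x hx).trans (h.1 x hx), fun a ha => (h'.2 a ha).trans (h.2 a ha)⟩

theorem mono (h : Agree X A s t) (hX : X ⊆ Y) (hA : A ⊆ B) : Agree Y B s t :=
  ⟨fun x hx => h.1 x fun h' => hx (hX h'), fun a ha => h.2 a fun h' => ha (hA h')⟩

theorem setVar (s : State) {x : ℕ} (hx : x ∈ X) (v : ℕ) : Agree X A s (s.setVar x v) := by
  refine ⟨fun y hy => ?_, fun _ _ => rfl⟩
  rw [State.setVar_var, if_neg]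
  rintro rfl
  exact hy hx

end Agree

namespace Cmd

variable {w : ℕ}

theorem eval_forLt_induct {r n : ℕ} {p : Cmd} {s : State} (hn : s.var 0 = n)
    {P : ℕ → State → Prop} (h0 : P 0 (s.setVar r 0))
    (hs : ∀ i < n, ∀ t, P i t → t.var r = i → P (i + 1) ((p.eval w t).setVar r (i + 1))) :
    P n ((forLt r p).eval w s) := by
  have key : ∀ i ≤ n, P i (Nat.rec (motive := fun _ => State) (s.setVar r 0)
        (fun i t => (p.eval w t).setVar r (i + 1)) i) ∧
      (Nat.rec (motive := fun _ => State) (s.setVar r 0)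
        (fun i t => (p.eval w t).setVar r (i + 1)) i : State).var r = i := by
    intro i hi
    induction i with
    | zero => exact ⟨h0, by simp [State.setVar_var]⟩
    | succ i ih =>
      obtain ⟨h1, h2⟩ := ih (by omega)
      exact ⟨hs i hi _ h1 h2, by simp [State.setVar_var]⟩
  simp only [eval, hn]
  exact (key n le_rfl).1

theorem eval_agree (p : Cmd) (s : State) : Agree p.vars p.arrs s (p.eval w s) := by
  induction p generalizing s with
  | write a i e =>
    refine ⟨fun _ _ => rfl, fun b hb => ?_⟩
    have : b ≠ a := by simpa [arrs] using hb
    simp [eval, State.setArr, this]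
  | seq p q ihp ihq =>
    exact ((ihp s).mono Finset.subset_union_left Finset.subset_union_left).trans
      ((ihq _).mono Finset.subset_union_right Finset.subset_union_right)
  | guard e p ih =>
    simp only [eval]
    split_ifs
    · exact ih s
    · exact Agree.refl _ _ s
  | forLt r p ih =>
    refine eval_forLt_induct (P := fun _ t => Agree (insert r p.vars) p.arrs s t) rfl
      (Agree.setVar s (Finset.mem_insert_self _ _) 0) fun i _ t ht _ => ?_
    exact (ht.trans ((ih t).mono (Finset.subset_insert _ _) subset_rfl)).trans
      (Agree.setVar _ (Finset.mem_insert_self _ _) _)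

/-- The running time of a program with bounded loops is polynomial, of degree the nesting depth of
its loops. -/
theorem exec_eval {n : ℕ} (hn : n < 2 ^ w) (p : Cmd) (hp : p.WF) (h0 : 0 ∉ p.vars) (s : State)
    (hs : s.var 0 = n) :
    ∃ t, Exec w p.toProgram s t (p.eval w s) ∧ t ≤ p.factor * (n + 1) ^ p.depth := by
  induction p generalizing s with
  | write a i e =>
    exact ⟨_, Exec.write a i e s, by simp [factor, depth]⟩
  | seq p q ihp ihq =>
    simp only [vars, Finset.mem_union, not_or] at h0
    obtain ⟨t₁, e₁, b₁⟩ := ihp hp.1 h0.1 s hs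
    obtain ⟨t₂, e₂, b₂⟩ := ihq hp.2 h0.2 (p.eval w s) (((p.eval_agree s).1 0 h0.1).trans hs)
    refine ⟨t₁ + t₂, .seq e₁ e₂, ?_⟩
    have h1 : (n + 1) ^ p.depth ≤ (n + 1) ^ (seq p q).depth :=
      Nat.pow_le_pow_right (by omega) (le_max_left _ _)
    have h2 : (n + 1) ^ q.depth ≤ (n + 1) ^ (seq p q).depth :=
      Nat.pow_le_pow_right (by omega) (le_max_right _ _)
    calc t₁ + t₂ ≤ p.factor * (n + 1) ^ p.depth + q.factor * (n + 1) ^ q.depth := by omega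
      _ ≤ p.factor * (n + 1) ^ (seq p q).depth + q.factor * (n + 1) ^ (seq p q).depth := by gcongr
      _ = _ := by simp only [factor]; ring
  | guard e p ih =>
    have hpos : 1 ≤ (n + 1) ^ p.depth := Nat.one_le_pow _ _ (by omega)
    obtain ⟨t, ht, hb⟩ := ih hp h0 s hs
    by_cases he : e.eval w s = 0
    · refine ⟨e.cost + 1 + 1, ?_, ?_⟩
      · simp only [eval, he, ne_eq, not_true_eq_false, if_false]
        exact .ite_false he (.skip s)
      · simp only [factor, depth]
        nlinarith [Nat.zero_le (p.factor * (n + 1) ^ p.depth),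
          Nat.mul_le_mul_left (e.cost + 2) hpos]
    · refine ⟨e.cost + 1 + t, ?_, ?_⟩
      · simp only [eval, ne_eq, he, not_false_eq_true, if_true]
        exact .ite_true he ht
      · simp only [factor, depth]
        nlinarith [Nat.mul_le_mul_left (e.cost + 2) hpos]
  | forLt r p ih =>
    obtain ⟨hr0, hrp, hp'⟩ := hp
    simp only [vars, Finset.mem_insert, not_or] at h0
    have hw1 : 1 ≤ 2 ^ w := Nat.one_le_two_pow
    set T := p.factor * (n + 1) ^ p.depth with hT
    let st : ℕ → State := fun i => Nat.rec (motive := fun _ => State) (s.setVar r 0)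
      (fun i t => (p.eval w t).setVar r (i + 1)) i
    have st_succ : ∀ i, st (i + 1) = (p.eval w (st i)).setVar r (i + 1) := fun i => rfl
    have st_r : ∀ i, (st i).var r = i := by
      intro i
      cases i with
      | zero => simp [st, State.setVar_var]
      | succ i => rw [st_succ]; simp [State.setVar_var]
    have st_0 : ∀ i, (st i).var 0 = n := by
      intro i
      induction i with
      | zero => simp [st, State.setVar_var, hr0.symm, hs]
      | succ i ih =>
        rw [st_succ, State.setVar_var, if_neg hr0.symm, (p.eval_agree (st i)).1 0 h0.2, ih]
    -- the loop is unrolled from its last iteration backwards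
    have loop : ∀ k ≤ n, ∃ t, Exec w (.loop (.lt (.var r) (.var 0))
        (.seq p.toProgram (.assign r (.add (.var r) (.const 1))))) (st (n - k)) t (st n) ∧
        t ≤ k * (T + 8) + 4 := by
      intro k hk
      induction k with
      | zero =>
        refine ⟨_, Exec.loop_false ?_, by simp [Expr.cost]⟩
        simp [Expr.eval, st_r, st_0]
      | succ k ihk =>
        obtain ⟨t₂, e₂, b₂⟩ := ihk (by omega)
        obtain ⟨t₁, e₁, b₁⟩ := ih hp' h0.2 (st (n - (k + 1))) (st_0 _)
        have hstep : Exec w (.assign r (.add (.var r) (.const 1))) (p.eval w (st (n - (k + 1))))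
            4 (st (n - k)) := by
          have h := Exec.assign (w := w) r (.add (.var r) (.const 1))
            (p.eval w (st (n - (k + 1))))
          have hv : (Expr.add (.var r) (.const 1)).eval w (p.eval w (st (n - (k + 1)))) =
              n - k := by
            have h1 : (p.eval w (st (n - (k + 1)))).var r = n - (k + 1) := by
              rw [(p.eval_agree _).1 r hrp, st_r]
            have h2 : 1 % 2 ^ w = 1 := Nat.mod_eq_of_lt (by omega)
            simp only [Expr.eval, h1, h2]
            rw [Nat.mod_eq_of_lt (by omega)]
            omega
          rw [hv] at h
          have : n - k = n - (k + 1) + 1 := by omega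
          rw [this, st_succ, ← this]
          exact h
        refine ⟨_, Exec.loop_true ?_ (.seq e₁ hstep) e₂, ?_⟩
        · simp [Expr.eval, st_r, st_0]
          omega
        · simp only [Expr.cost]
          have : (k + 1) * (T + 8) = k * (T + 8) + (T + 8) := by ring
          omega
    obtain ⟨t, e, b⟩ := loop n le_rfl
    have h00 : (0 : ℕ) % 2 ^ w = 0 := Nat.zero_mod _
    have hinit : Exec w (.assign r (.const 0)) s 2 (st (n - n)) := by
      have h := Exec.assign (w := w) r (.const 0) s
      simp only [Expr.eval, h00, Expr.cost] at h
      rw [Nat.sub_self]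
      exact h
    refine ⟨2 + t, ?_, ?_⟩
    · have : (forLt r p).eval w s = st n := by
        simp only [eval, hs, st]
      rw [this]
      exact .seq hinit e
    · simp only [factor, depth]
      have hpos : 1 ≤ (n + 1) ^ p.depth := Nat.one_le_pow _ _ (by omega)
      have h1 : (p.factor + 14) * (n + 1) ^ (p.depth + 1) =
          n * T + T + 14 * (n + 1) ^ (p.depth + 1) := by
        rw [hT]
        ring
      have h2 : (n + 1) ≤ (n + 1) ^ (p.depth + 1) := Nat.le_self_pow (by omega) _
      have h3 : n * (T + 8) = n * T + 8 * n := by ring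
      omega

end Cmd

/-! ### Boolean expressions -/

namespace Expr

/-- Negation of truth values; every nonzero value counts as true. -/
def neg (e : Expr) : Expr := .eq e (.const 0)

/-- Conjunction of truth values. -/
def conj (e f : Expr) : Expr := .lt (neg e) (.lt (.const 0) f)

/-- Disjunction of truth values. -/
def disj (e f : Expr) : Expr := neg (conj (neg e) (neg f))

/-- The truth value of an expression. -/
def Holds (w : ℕ) (s : State) (e : Expr) : Prop := e.eval w s ≠ 0

variable {w : ℕ} {s : State}

theorem holds_neg (e : Expr) : (neg e).Holds w s ↔ ¬ e.Holds w s := by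
  by_cases h : e.eval w s = 0 <;> simp [Holds, neg, eval, h]

theorem holds_conj (e f : Expr) : (conj e f).Holds w s ↔ e.Holds w s ∧ f.Holds w s := by
  by_cases h : e.eval w s = 0 <;> by_cases h' : f.eval w s = 0 <;>
    simp [Holds, conj, neg, eval, h, h', Nat.pos_iff_ne_zero]

theorem holds_disj (e f : Expr) : (disj e f).Holds w s ↔ e.Holds w s ∨ f.Holds w s := by
  simp only [disj, holds_neg, holds_conj]
  tauto

theorem holds_eq (e f : Expr) : (Expr.eq e f).Holds w s ↔ e.eval w s = f.eval w s := by
  simp [Holds, eval]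

/-- The conjunction of a list of truth values. -/
def all : List Expr → Expr
  | [] => .eq (.const 0) (.const 0)
  | e :: l => conj e (all l)

theorem holds_all_nil : (all []).Holds w s ↔ True := by simp [Holds, all, eval]

theorem holds_all_cons (e : Expr) (l : List Expr) :
    (all (e :: l)).Holds w s ↔ e.Holds w s ∧ (all l).Holds w s := holds_conj _ _

theorem holds_lt (e f : Expr) : (Expr.lt e f).Holds w s ↔ e.eval w s < f.eval w s := by
  simp [Holds, eval]

end Expr

theorem Cmd.eval_guard_pos {w : ℕ} {s : State} {e : Expr} (h : e.Holds w s) (p : Cmd) :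
    (Cmd.guard e p).eval w s = p.eval w s := if_pos h

theorem Cmd.eval_guard_neg {w : ℕ} {s : State} {e : Expr} (h : ¬ e.Holds w s) (p : Cmd) :
    (Cmd.guard e p).eval w s = s := if_neg h

/-! ### Loops that mark array cells -/

/-- Started in a state that satisfies the invariant `I` and in which the registers in `R` are
smaller than `n`, the program `p` preserves `I`, never unmarks a cell of the array `N`, and marks
all cells in `Q`, a set that depends on the initial values of the registers. A cell is marked if
its content is not `0`. -/
def Marks (w n : ℕ) (I : State → Prop) (R : Finset ℕ) (p : Cmd) (N : ℕ)
    (Q : (ℕ → ℕ) → Set ℕ) : Prop :=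
  ∀ s, I s → (∀ r ∈ R, s.var r < n) → I (p.eval w s) ∧
    (∀ j, s.arr N j ≠ 0 → (p.eval w s).arr N j ≠ 0) ∧ ∀ j ∈ Q s.var, (p.eval w s).arr N j ≠ 0

/-- The set `Q` does not depend on the registers in `W`. -/
def IndepOf (W : Finset ℕ) (Q : (ℕ → ℕ) → Set ℕ) : Prop :=
  ∀ ρ ρ' : ℕ → ℕ, (∀ y ∉ W, ρ y = ρ' y) → Q ρ = Q ρ'

/-- The union of the sets `Q` over the values `0, …, n - 1` of register `r`. -/
def unionOver (n r : ℕ) (Q : (ℕ → ℕ) → Set ℕ) : (ℕ → ℕ) → Set ℕ :=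
  fun ρ => {j | ∃ i < n, j ∈ Q (Function.update ρ r i)}

theorem IndepOf.unionOver {W : Finset ℕ} {Q : (ℕ → ℕ) → Set ℕ} (h : IndepOf W Q) (n r : ℕ) :
    IndepOf (insert r W) (unionOver n r Q) := by
  intro ρ ρ' hρ
  have : ∀ i, Q (Function.update ρ r i) = Q (Function.update ρ' r i) := by
    intro i
    refine h _ _ fun y hy => ?_
    by_cases e : y = r
    · simp [e]
    · simpa [e] using hρ y (by simp [e, hy])
  simp only [WordRAM.unionOver, this]

theorem Marks.forLt {w n r N : ℕ} {I : State → Prop} {p : Cmd} {Q : (ℕ → ℕ) → Set ℕ}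
    {R W : Finset ℕ} (h : Marks w n I (insert r R) p N Q) (hW : p.vars ⊆ W) (hQ : IndepOf W Q)
    (hR : Disjoint R (insert r W)) (hI0 : ∀ s, I s → s.var 0 = n)
    (hI : ∀ s i, I s → I (s.setVar r i)) :
    Marks w n I R (.forLt r p) N (unionOver n r Q) := by
  intro s hs hsR
  -- after `i` rounds, the cells of the first `i` sets are marked
  have key := Cmd.eval_forLt_induct (w := w) (r := r) (p := p) (hI0 s hs)
    (P := fun i t => I t ∧ (∀ y ∉ insert r W, t.var y = s.var y) ∧
      (∀ j, s.arr N j ≠ 0 → t.arr N j ≠ 0) ∧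
      ∀ k < i, ∀ j ∈ Q (Function.update s.var r k), t.arr N j ≠ 0)
    ⟨hI s 0 hs, fun y hy => by
        rw [State.setVar_var, if_neg]
        rintro rfl
        exact hy (Finset.mem_insert_self _ _), fun j hj => hj, by omega⟩ ?_
  · obtain ⟨h1, -, h2, h3⟩ := key
    exact ⟨h1, h2, fun j ⟨i, hi, hj⟩ => h3 i hi j hj⟩
  · rintro i hi t ⟨h1, h2, h3, h4⟩ hti
    obtain ⟨g1, g2, g3⟩ := h t h1 fun y hy => by
      rcases Finset.mem_insert.1 hy with rfl | hy
      · omega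
      · rw [h2 y (Finset.disjoint_left.1 hR hy)]
        exact hsR y hy
    refine ⟨hI _ _ g1, fun y hy => ?_, fun j hj => g2 j (h3 j hj), fun k hk j hj => ?_⟩
    · have hy' : y ≠ r ∧ y ∉ W := by simpa using hy
      rw [State.setVar_var, if_neg hy'.1, (p.eval_agree t).1 y fun h' => hy'.2 (hW h'), h2 y hy]
    · rcases Nat.lt_succ_iff_lt_or_eq.1 hk with hk | rfl
      · exact g2 j (h4 k hk j hj)
      · refine g3 j ?_
        rw [hQ t.var (Function.update s.var r k)]
        · exact hj
        · intro y hy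
          by_cases e : y = r
          · rw [e, hti, Function.update_self]
          · rw [Function.update_of_ne e]
            exact h2 y (by simp [e, hy])

end WordRAM

/-! ### Computing components -/

namespace WordRAM

open SimpleGraph

variable {n w : ℕ} {G : SimpleGraph (Fin n)} {s t : State}

theorem one_mod_two_pow (hw : (n + 2) ^ 2 ≤ 2 ^ w) : 1 % 2 ^ w = 1 := by
  have : (n + 2) ^ 2 = n * n + 4 * n + 4 := by ring
  exact Nat.mod_eq_of_lt (by omega)

/-- Register `0` holds the number of vertices, and array `2` holds the adjacency matrix of `G`,
row by row. Every nonzero entry stands for an edge. -/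
structure Env (G : SimpleGraph (Fin n)) (s : State) : Prop where
  var_zero : s.var 0 = n
  matrix : ∀ u v : Fin n, s.arr 2 (u * n + v) ≠ 0 ↔ G.Adj u v

/-- The array `A` holds the set `X`, as the set of the vertices whose cells are not `0`. -/
def IsSet (s : State) (A : ℕ) (X : Set (Fin n)) : Prop := ∀ v : Fin n, s.arr A v ≠ 0 ↔ v ∈ X

theorem Env.of_agree {X A : Finset ℕ} (h : Env G s) (hst : Agree X A s t) (h0 : 0 ∉ X)
    (h2 : 2 ∉ A) : Env G t :=
  ⟨(hst.1 0 h0).trans h.var_zero, fun u v => by rw [hst.2 2 h2]; exact h.matrix u v⟩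

theorem IsSet.of_agree {X A : Finset ℕ} {B : ℕ} {Y : Set (Fin n)} (h : IsSet s B Y)
    (hst : Agree X A s t) (hB : B ∉ A) : IsSet t B Y := fun v => by rw [hst.2 B hB]; exact h v

/-- The test whether the registers `u` and `v` hold the same vertex. -/
def eqE (u v : ℕ) : Expr := .eq (.var u) (.var v)

/-- The test whether the vertices in the registers `u` and `v` are adjacent. -/
def adjE (u v : ℕ) : Expr := .read 2 (.add (.mul (.var u) (.var 0)) (.var v))

/-- The test whether the vertex in register `v` belongs to the set in array `A`. -/
def memE (A v : ℕ) : Expr := .read A (.var v)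

theorem holds_eqE {u v : ℕ} {i j : Fin n} (hu : s.var u = i) (hv : s.var v = j) :
    (eqE u v).Holds w s ↔ i = j := by
  rw [eqE, Expr.holds_eq]
  simp [Expr.eval, hu, hv, Fin.ext_iff]

theorem holds_memE {A v : ℕ} {i : Fin n} {X : Set (Fin n)} (hA : IsSet s A X)
    (hv : s.var v = i) : (memE A v).Holds w s ↔ i ∈ X := by
  rw [← hA i, ← hv]
  rfl

theorem holds_adjE (hw : (n + 2) ^ 2 ≤ 2 ^ w) (h : Env G s) {u v : ℕ} {i j : Fin n}
    (hu : s.var u = i) (hv : s.var v = j) : (adjE u v).Holds w s ↔ G.Adj i j := by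
  have hi := i.2
  have hj := j.2
  have h1 : i.val * n ≤ n * n := Nat.mul_le_mul_right _ hi.le
  have h2 : (n + 2) ^ 2 = n * n + 4 * n + 4 := by ring
  rw [← h.matrix i j, Expr.Holds, adjE]
  simp only [Expr.eval, hu, hv, h.var_zero]
  rw [Nat.mod_eq_of_lt (by omega : i.val * n < 2 ^ w), Nat.mod_eq_of_lt (by omega)]

namespace Cmd

/-- Stores in array `A` the set of the vertices for which `e` holds, where `e` refers to the
vertex in register `9`. -/
def fill (A : ℕ) (e : Expr) : Cmd := forLt 9 (write A (.var 9) e)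

/-- Adds to the set in array `N` every vertex `v` such that `e` holds for some vertex `u`, where
`e` refers to `u` and `v` by the registers `9` and `10`. -/
def mark (N : ℕ) (e : Expr) : Cmd := forLt 9 (forLt 10 (guard e (write N (.var 10) (.const 1))))

theorem fill_agree (A : ℕ) (e : Expr) (s : State) : Agree {9} {A} s ((fill A e).eval w s) :=
  eval_agree (fill A e) s

theorem mark_agree (N : ℕ) (e : Expr) (s : State) :
    Agree {9, 10} {N} s ((mark N e).eval w s) :=
  (eval_agree (mark N e) s).mono (by simp [mark, vars]) (by simp [mark, arrs])

theorem isSet_fill {A : ℕ} {e : Expr} {X : Set (Fin n)} (hs : s.var 0 = n)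
    (he : ∀ t, Agree {9} {A} s t → ∀ v : Fin n, t.var 9 = v → (e.Holds w t ↔ v ∈ X)) :
    IsSet ((fill A e).eval w s) A X := by
  have key := eval_forLt_induct (w := w) (r := 9) (p := write A (.var 9) e) hs
    (P := fun i t => Agree {9} {A} s t ∧
      ∀ v : Fin n, v.val < i → (t.arr A v ≠ 0 ↔ v ∈ X))
    ⟨Agree.setVar s (by simp) 0, by omega⟩ ?_
  · exact fun v => key.2 v v.2
  · rintro i hi t ⟨h1, h2⟩ ht
    have h3 : Agree {9} {A} t ((write A (.var 9) e).eval w t) :=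
      (eval_agree (write A (.var 9) e) t).mono (by simp [vars]) (by simp [arrs])
    refine ⟨(h1.trans h3).trans (Agree.setVar _ (by simp) _), fun v hv => ?_⟩
    simp only [State.setVar_arr, eval, State.setArr_arr, Expr.eval, ht, true_and]
    rcases Nat.lt_succ_iff_lt_or_eq.1 hv with hv | rfl
    · rw [if_neg (by omega)]
      exact h2 v hv
    · rw [if_pos rfl]
      exact he t h1 v ht

theorem mark_spec (hw : (n + 2) ^ 2 ≤ 2 ^ w) {N : ℕ} {e : Expr} {C : Set (Fin n)}
    {E : Fin n → Fin n → Prop} (hs : s.var 0 = n) (hC : ∀ v : Fin n, s.arr N v ≠ 0 → v ∈ C)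
    (sound : ∀ t, Agree {9, 10} {N} s t → (∀ v : Fin n, t.arr N v ≠ 0 → v ∈ C) →
      ∀ u v : Fin n, t.var 9 = u → t.var 10 = v → e.Holds w t → v ∈ C)
    (complete : ∀ t, Agree {9, 10} {N} s t → (∀ j, s.arr N j ≠ 0 → t.arr N j ≠ 0) →
      ∀ u v : Fin n, t.var 9 = u → t.var 10 = v → E u v → e.Holds w t) :
    (∀ v : Fin n, ((mark N e).eval w s).arr N v ≠ 0 → v ∈ C) ∧
      (∀ j, s.arr N j ≠ 0 → ((mark N e).eval w s).arr N j ≠ 0) ∧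
      ∀ u v : Fin n, E u v → ((mark N e).eval w s).arr N v ≠ 0 := by
  have hone : 1 % 2 ^ w = 1 := one_mod_two_pow hw
  let I : State → Prop := fun t => Agree {9, 10} {N} s t ∧
    (∀ v : Fin n, t.arr N v ≠ 0 → v ∈ C) ∧ ∀ j, s.arr N j ≠ 0 → t.arr N j ≠ 0
  let Q : (ℕ → ℕ) → Set ℕ := fun ρ => {j | ∃ u v : Fin n, ρ 9 = u ∧ ρ 10 = v ∧ j = v ∧ E u v}
  have hI0 : ∀ t, I t → t.var 0 = n := fun t ht => (ht.1.1 0 (by simp)).trans hs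
  have hI : ∀ r ∈ ({9, 10} : Finset ℕ), ∀ t i, I t → I (t.setVar r i) := fun r hr t i ht =>
    ⟨ht.1.trans (Agree.setVar t hr i), ht.2⟩
  have base : Marks w n I {10, 9} (guard e (write N (.var 10) (.const 1))) N Q := by
    intro t ht htr
    obtain ⟨h1, h2, h3⟩ := ht
    let u : Fin n := ⟨t.var 9, htr 9 (by simp)⟩
    let v : Fin n := ⟨t.var 10, htr 10 (by simp)⟩
    have hq : ∀ j ∈ Q t.var, j = t.var 10 ∧ E u v := by
      rintro j ⟨u', v', h9, h10, rfl, h⟩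
      obtain rfl : u = u' := Fin.ext h9
      obtain rfl : v = v' := Fin.ext h10
      exact ⟨rfl, h⟩
    by_cases he : e.Holds w t
    · have hv := sound t h1 h2 u v rfl rfl he
      have ev : (guard e (write N (.var 10) (.const 1))).eval w t =
          t.setArr N (t.var 10) 1 := by
        rw [eval_guard_pos he]
        simp only [eval, Expr.eval, hone]
      rw [ev]
      have mono : ∀ j, t.arr N j ≠ 0 → (t.setArr N (t.var 10) 1).arr N j ≠ 0 := by
        intro j hj
        rw [State.setArr_arr]
        split_ifs
        · exact one_ne_zero
        · exact hj
      refine ⟨⟨h1.trans ?_, fun z hz => ?_, fun j hj => mono j (h3 j hj)⟩, mono, ?_⟩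
      · refine ⟨fun _ _ => rfl, fun a ha => ?_⟩
        have : a ≠ N := by simpa using ha
        simp [State.setArr, this]
      · rw [State.setArr_arr] at hz
        split_ifs at hz with h
        · obtain rfl : z = v := Fin.ext h.2
          exact hv
        · exact h2 z hz
      · intro j hj
        rw [State.setArr_arr, if_pos ⟨rfl, (hq j hj).1⟩]
        exact one_ne_zero
    · have ev : (guard e (write N (.var 10) (.const 1))).eval w t = t :=
        eval_guard_neg he _
      rw [ev]
      exact ⟨⟨h1, h2, h3⟩, fun j hj => hj, fun j hj =>
        absurd (complete t h1 h3 u v rfl rfl (hq j hj).2) he⟩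
  have hQ : IndepOf ∅ Q := fun ρ ρ' h => by simp only [Q, h _ (Finset.notMem_empty _)]
  have m1 := base.forLt (W := ∅) (by simp [vars]) hQ (by simp) hI0 (hI 10 (by simp))
  have m2 := Marks.forLt (R := ∅) (W := {10}) m1 (by simp [vars]) (hQ.unionOver _ _) (by simp) hI0
    (hI 9 (by simp))
  obtain ⟨⟨-, h1, -⟩, h2, h3⟩ := m2 s ⟨Agree.refl _ _ _, hC, fun _ h => h⟩ (by simp)
  refine ⟨h1, h2, fun u v h => h3 v ⟨u, u.2, v, v.2, u, v, ?_, ?_, rfl, h⟩⟩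
  · simp
  · simp

/-- Stores in array `A` the component of the vertex in register `r` in the subgraph induced on the
set of the vertices for which `e` holds, and in array `N` the set of the neighbors of this
component. The expression `e` refers to a vertex by register `9`. Array `3` is used for the set of
the vertices for which `e` holds. -/
def comp (e : Expr) (r A N : ℕ) : Cmd :=
  seq (fill 3 e) <| seq (fill A (.all [eqE 9 r, memE 3 9])) <|
    seq (forLt 11 (mark A (.all [memE A 9, adjE 9 10, memE 3 10]))) <|
      seq (fill N (.const 0)) (mark N (.all [memE A 9, adjE 9 10]))

theorem comp_agree (e : Expr) (r A N : ℕ) (s : State) :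
    Agree {9, 10, 11} {3, A, N} s ((comp e r A N).eval w s) :=
  (eval_agree _ s).mono (by simp [comp, fill, mark, vars]; decide)
    (by intro a; simp [comp, fill, mark, arrs]; tauto)

theorem isSet_closure (hw : (n + 2) ^ 2 ≤ 2 ^ w) (hs : Env G s) {A : ℕ} (hA : 3 < A)
    {X : Set (Fin n)} {v₀ : Fin n} (h3 : IsSet s 3 X) (hAs : IsSet s A {v | v = v₀ ∧ v ∈ X}) :
    IsSet ((forLt 11 (mark A (.all [memE A 9, adjE 9 10, memE 3 10]))).eval w s) A
      (G.compIn X v₀) := by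
  set C := G.compIn X v₀ with hC
  -- after `i` rounds, at least `i` vertices of the component have been found, or all of them
  have key := eval_forLt_induct (w := w) (r := 11)
    (p := mark A (.all [memE A 9, adjE 9 10, memE 3 10])) hs.var_zero
    (P := fun i t => Agree {9, 10, 11} {A} s t ∧ (∀ v : Fin n, t.arr A v ≠ 0 → v ∈ C) ∧
      (v₀ ∈ X → t.arr A v₀ ≠ 0) ∧
      ((∀ v ∈ C, t.arr A v ≠ 0) ∨ i ≤ {v : Fin n | t.arr A v ≠ 0}.ncard))
    ⟨Agree.setVar s (by simp) 0, fun v hv => ?_, fun h => (hAs v₀).2 ⟨rfl, h⟩,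
      .inr (Nat.zero_le _)⟩ ?_
  · obtain ⟨-, h1, -, h2⟩ := key
    refine fun v => ⟨h1 v, ?_⟩
    rcases h2 with h2 | h2
    · exact h2 v
    · intro _
      have : {v : Fin n | ((forLt 11 (mark A (.all [memE A 9, adjE 9 10, memE 3 10]))).eval
          w s).arr A v ≠ 0} = Set.univ := by
        by_contra hne
        have := Set.ncard_lt_card hne
        rw [Nat.card_fin] at this
        omega
      exact this.ge (Set.mem_univ v)
  · obtain ⟨rfl, hv⟩ := (hAs v).1 hv
    exact self_mem_compIn hv
  · rintro i hi t ⟨h1, h2, h4, h5⟩ ht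
    have hE : Env G t := hs.of_agree h1 (by decide) (by simp; omega)
    have ht3 : IsSet t 3 X := h3.of_agree h1 (by simp; omega)
    have hol : ∀ u' : State, Agree {9, 10} {A} t u' → ∀ u v : Fin n, u'.var 9 = u →
        u'.var 10 = v → ((Expr.all [memE A 9, adjE 9 10, memE 3 10]).Holds w u' ↔
          u'.arr A u ≠ 0 ∧ G.Adj u v ∧ v ∈ X) := by
      intro u' h u v hu hv
      have hE' : Env G u' := hE.of_agree h (by decide) (by simp; omega)
      have hA' : IsSet u' A {z : Fin n | u'.arr A z ≠ 0} := fun z => Iff.rfl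
      have h3' : IsSet u' 3 X := ht3.of_agree h (by simp; omega)
      simp only [Expr.holds_all_cons, Expr.holds_all_nil, holds_memE hA' hu,
        holds_adjE hw hE' hu hv, holds_memE h3' hv, and_true]
      rfl
    obtain ⟨g1, g2, g3⟩ := mark_spec (s := t) hw (N := A) (C := C)
      (E := fun u v => t.arr A u ≠ 0 ∧ G.Adj u v ∧ v ∈ X)
      (e := .all [memE A 9, adjE 9 10, memE 3 10]) hE.var_zero h2
      (fun u' h h' u v hu hv he => by
        obtain ⟨e1, e2, e3⟩ := (hol u' h u v hu hv).1 he
        obtain ⟨c1, c2⟩ := h' u e1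
        exact ⟨c1, c2.tail ⟨e2, e3⟩⟩)
      (fun u' h h' u v hu hv he => (hol u' h u v hu hv).2 ⟨h' u he.1, he.2⟩)
    refine ⟨(h1.trans ((mark_agree A _ t).mono (by decide) subset_rfl)).trans
      (Agree.setVar _ (by simp) _), g1, fun h => g2 _ (h4 h), ?_⟩
    simp only [State.setVar_arr]
    rcases h5 with h5 | h5
    · exact .inl fun v hv => g2 _ (h5 v hv)
    · by_cases hcl : ∀ v ∈ C, t.arr A v ≠ 0
      · exact .inl fun v hv => g2 _ (hcl v hv)
      · right
        -- the set found so far is not the whole component, so it is not closed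
        have : ∃ v ∈ X, G.Touches v {z : Fin n | t.arr A z ≠ 0} ∧ t.arr A v = 0 := by
          by_contra! hno
          refine hcl fun v hv => ?_
          exact compIn_subset_of_closed (Y := {z : Fin n | t.arr A z ≠ 0}) (h4 hv.1) hno hv
        obtain ⟨v, hvX, ⟨u, hu, huv⟩, hv⟩ := this
        refine Nat.succ_le_of_lt (h5.trans_lt (Set.ncard_lt_ncard ?_ (Set.toFinite _)))
        exact ⟨fun z hz => g2 z hz, fun hsub =>
          hsub (a := v) (g3 u v ⟨hu, huv.symm, hvX⟩) hv⟩

theorem comp_spec (hw : (n + 2) ^ 2 ≤ 2 ^ w) (hs : Env G s) {e : Expr} {r A N : ℕ} (hA : 3 < A)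
    (hN : 3 < N) (hAN : A ≠ N) (hr : r ≠ 9) {X : Set (Fin n)} {v₀ : Fin n} (hv₀ : s.var r = v₀)
    (he : ∀ t, Agree {9, 10, 11} {3} s t → ∀ v : Fin n, t.var 9 = v → (e.Holds w t ↔ v ∈ X)) :
    IsSet ((comp e r A N).eval w s) A (G.compIn X v₀) ∧
      IsSet ((comp e r A N).eval w s) N {v | G.Touches v (G.compIn X v₀)} := by
  simp only [comp, eval]
  set s₁ := (fill 3 e).eval w s with hs₁
  set s₂ := (fill A (.all [eqE 9 r, memE 3 9])).eval w s₁ with hs₂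
  set s₃ := (forLt 11 (mark A (.all [memE A 9, adjE 9 10, memE 3 10]))).eval w s₂ with hs₃
  set s₄ := (fill N (.const 0)).eval w s₃ with hs₄
  have a₁ : Agree {9} {3} s s₁ := fill_agree _ _ _
  have a₂ : Agree {9} {A} s₁ s₂ := fill_agree _ _ _
  have a₃ : Agree {9, 10, 11} {A} s₂ s₃ :=
    (eval_agree _ s₂).mono (by simp [mark, vars]; decide) (by simp [mark, arrs])
  have a₄ : Agree {9} {N} s₃ s₄ := fill_agree _ _ _
  have E₁ : Env G s₁ := hs.of_agree a₁ (by decide) (by decide)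
  have E₂ : Env G s₂ := E₁.of_agree a₂ (by decide) (by simp; omega)
  have E₃ : Env G s₃ := E₂.of_agree a₃ (by decide) (by simp; omega)
  have E₄ : Env G s₄ := E₃.of_agree a₄ (by decide) (by simp; omega)
  have S₁ : IsSet s₁ 3 X := isSet_fill hs.var_zero fun t ht =>
    he t (ht.mono (by decide) subset_rfl)
  have S₂ : IsSet s₂ A {v | v = v₀ ∧ v ∈ X} := isSet_fill E₁.var_zero fun t ht v hv => by
    have hr' : t.var r = v₀ := by
      rw [ht.1 r (by simpa using hr), a₁.1 r (by simpa using hr), hv₀]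
    simp only [Expr.holds_all_cons, Expr.holds_all_nil, holds_eqE hv hr',
      holds_memE (S₁.of_agree ht (by simp; omega)) hv, and_true]
    rfl
  have S₃ : IsSet s₃ A (G.compIn X v₀) :=
    isSet_closure hw E₂ hA (S₁.of_agree a₂ (by simp; omega)) S₂
  have S₄ : IsSet s₄ N (∅ : Set (Fin n)) := isSet_fill E₃.var_zero fun t _ v _ => by
    simp [Expr.Holds, Expr.eval]
  have S₄' : IsSet s₄ A (G.compIn X v₀) := S₃.of_agree a₄ (by simpa using hAN)
  refine ⟨S₄'.of_agree (mark_agree _ _ _) (by simpa using hAN), ?_⟩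
  have hol : ∀ t : State, Agree {9, 10} {N} s₄ t → ∀ u v : Fin n, t.var 9 = u → t.var 10 = v →
      ((Expr.all [memE A 9, adjE 9 10]).Holds w t ↔ u ∈ G.compIn X v₀ ∧ G.Adj u v) := by
    intro t h u v hu hv
    simp only [Expr.holds_all_cons, Expr.holds_all_nil,
      holds_memE (S₄'.of_agree h (by simpa using hAN)) hu,
      holds_adjE hw (E₄.of_agree h (by decide) (by simp; omega)) hu hv, and_true]
  obtain ⟨g1, -, g3⟩ := mark_spec (s := s₄) hw (N := N) (e := .all [memE A 9, adjE 9 10])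
    (C := {v | G.Touches v (G.compIn X v₀)}) (E := fun u v => u ∈ G.compIn X v₀ ∧ G.Adj u v)
    E₄.var_zero (fun v hv => ((S₄ v).1 hv).elim)
    (fun t h _ u v hu hv he => by
      obtain ⟨h1, h2⟩ := (hol t h u v hu hv).1 he
      exact ⟨u, h1, h2.symm⟩)
    (fun t h _ u v hu hv he => (hol t h u v hu hv).2 he)
  refine fun v => ⟨g1 v, ?_⟩
  rintro ⟨u, hu, huv⟩
  exact g3 u v ⟨hu, huv.symm⟩

end Cmd

end WordRAM

/-! ### The adjacency matrix -/

namespace WordRAM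

open SimpleGraph

variable {n w : ℕ} {G : SimpleGraph (Fin n)} {L : Fin n → List (Fin n)}

/-- The position of the first entry of `L i` in the concatenation of the lists `L u`. -/
def offset (L : Fin n → List (Fin n)) (i : ℕ) : ℕ := ∑ u : Fin n with u.val < i, (L u).length

theorem offset_succ (L : Fin n → List (Fin n)) (u : Fin n) :
    offset L (u + 1) = offset L u + (L u).length := by
  have : ({v : Fin n | v.val < u + 1} : Finset (Fin n)) =
      insert u ({v : Fin n | v.val < u} : Finset (Fin n)) := by
    ext v
    simp only [Finset.mem_filter, Finset.mem_univ, true_and, Finset.mem_insert, Fin.ext_iff]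
    omega
  rw [offset, this, Finset.sum_insert (by simp), add_comm, offset]

theorem length_flatten_take (L : Fin n → List (Fin n)) {i : ℕ} (hi : i ≤ n) :
    ((List.ofFn L).take i).flatten.length = offset L i := by
  induction i with
  | zero => simp [offset]
  | succ i ih =>
    rw [List.take_succ_eq_append_getElem (by simpa using hi), List.flatten_append,
      List.length_append, ih (by omega), offset_succ L ⟨i, hi⟩]
    simp

theorem input_arr_one (u : Fin n) {m : ℕ} (hm : m < (L u).length) :
    (input L).arr 1 (offset L u + m) = (L u)[m] := by
  have h1 : (List.ofFn L).flatten =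
      ((List.ofFn L).take u).flatten ++ (L u ++ ((List.ofFn L).drop (u + 1)).flatten) := by
    conv_lhs => rw [← List.take_append_drop u (List.ofFn L)]
    rw [List.flatten_append, List.drop_eq_getElem_cons (by simp)]
    simp
  have h2 : (List.ofFn L).flatten[offset L u + m]? = some (L u)[m] := by
    rw [h1, List.getElem?_append_right (by rw [length_flatten_take L u.2.le]; omega),
      length_flatten_take L u.2.le, Nat.add_sub_cancel_left, List.getElem?_append_left hm,
      List.getElem?_eq_getElem hm]
  simp [input, List.getD_eq_getElem?_getD, h2, -List.map_flatten]

theorem IsAdjLists.offset_le (hL : IsAdjLists G L) (i : ℕ) : offset L i ≤ n * n := by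
  refine (Finset.sum_le_card_nsmul _ _ n fun u _ => ?_).trans ?_
  · simpa using (hL u).1.length_le_card
  · rw [smul_eq_mul]
    exact Nat.mul_le_mul_right n ((Finset.card_le_univ _).trans_eq (Fintype.card_fin n))

namespace Cmd

/-- The number `i * n + j`, where `i` is in register `3` and `j` in register `4`. -/
def position : Expr := .add (.mul (.var 3) (.var 0)) (.var 4)

/-- The test whether the position in array `1` belongs to the list of the vertex in
register `2`. -/
def positionInList : Expr :=
  .all [.neg (.lt position (.read 0 (.var 2))),
    .lt position (.read 0 (.add (.var 2) (.const 1)))]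

/-- Marks the matrix entry of the edge from the vertex in register `2` to the vertex found at the
position in array `1`. -/
def markEdge : Cmd :=
  guard positionInList (write 2 (.add (.mul (.var 2) (.var 0)) (.read 1 position)) (.const 1))

/-- Computes the adjacency matrix from the adjacency lists: for every vertex `u`, all positions
`k` in the concatenation of the lists are tried. They are written as `i * n + j`, as the loops run
up to `n` only. -/
def matrix : Cmd := forLt 2 <| forLt 3 <| forLt 4 markEdge

theorem matrix_agree (s : State) : Agree {2, 3, 4} {2} s (matrix.eval w s) :=
  (eval_agree matrix s).mono (by decide) (by decide)

theorem env_matrix (hw : (n + 2) ^ 2 ≤ 2 ^ w) (hL : IsAdjLists G L) :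
    Env G (matrix.eval w (input L)) := by
  have hw' : (n + 2) ^ 2 = n * n + 4 * n + 4 := by ring
  have hone : 1 % 2 ^ w = 1 := one_mod_two_pow hw
  have hidx : ∀ i < n, ∀ j < n, (i * n % 2 ^ w + j) % 2 ^ w = i * n + j := by
    intro i hi j hj
    have : i * n ≤ n * n := Nat.mul_le_mul_right _ hi.le
    rw [Nat.mod_eq_of_lt (by omega : i * n < 2 ^ w), Nat.mod_eq_of_lt (by omega)]
  let I : State → Prop := fun t => Agree {2, 3, 4} {2} (input L) t ∧
    ∀ u v : Fin n, t.arr 2 (u * n + v) ≠ 0 → G.Adj u v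
  let Q : (ℕ → ℕ) → Set ℕ := fun ρ => {z | ∃ (u : Fin n) (m : ℕ) (hm : m < (L u).length),
    ρ 2 = u ∧ ρ 3 * n + ρ 4 = offset L u + m ∧ z = u * n + (L u)[m]}
  have hI0 : ∀ t, I t → t.var 0 = n := fun t ht => ht.1.1 0 (by simp)
  have hI : ∀ r ∈ ({2, 3, 4} : Finset ℕ), ∀ t i, I t → I (t.setVar r i) := fun r hr t i ht =>
    ⟨ht.1.trans (Agree.setVar t hr i), ht.2⟩
  have base : Marks w n I {4, 3, 2} markEdge 2 Q := by
    intro t ht htr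
    obtain ⟨h1, h2⟩ := ht
    have r2 := htr 2 (by simp)
    have r3 := htr 3 (by simp)
    have r4 := htr 4 (by simp)
    have h0 : t.var 0 = n := hI0 t ⟨h1, h2⟩
    set u : Fin n := ⟨t.var 2, r2⟩ with hu
    have hu' : t.var 2 = u := rfl
    have off1 : t.arr 0 u = offset L u := by
      rw [h1.2 0 (by simp)]
      simp [input, offset, u.2.le]
    have off2 : t.arr 0 (u + 1) = offset L u + (L u).length := by
      rw [h1.2 0 (by simp), ← offset_succ]
      have : u.val + 1 ≤ n := u.2
      simp [input, offset, this]
    have arr1 : ∀ m, (hm : m < (L u).length) → t.arr 1 (offset L u + m) = (L u)[m] := by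
      intro m hm
      rw [h1.2 1 (by simp), input_arr_one u hm]
    have hol : positionInList.Holds w t ↔
        offset L u ≤ t.var 3 * n + t.var 4 ∧
          t.var 3 * n + t.var 4 < offset L u + (L u).length := by
      have : (u.val + 1) % 2 ^ w = u + 1 := Nat.mod_eq_of_lt (by omega)
      simp only [positionInList, position, Expr.holds_all_cons, Expr.holds_all_nil,
        Expr.holds_neg, Expr.holds_lt, Expr.eval, h0, hidx _ r3 _ r4, hone, hu', this, off1, off2, and_true, not_lt]
    by_cases he : offset L u ≤ t.var 3 * n + t.var 4 ∧
        t.var 3 * n + t.var 4 < offset L u + (L u).length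
    · obtain ⟨m, hm⟩ := Nat.exists_eq_add_of_le he.1
      have hml : m < (L u).length := by omega
      have hv := (hL u).2 _ |>.1 (List.getElem_mem hml)
      set v := (L u)[m] with hvdef
      have ev : markEdge.eval w t = t.setArr 2 (u * n + v) 1 := by
        rw [markEdge, eval_guard_pos (hol.2 he)]
        simp only [eval, position, Expr.eval, hone, h0, hidx _ r3 _ r4, hm, arr1 m hml, hu']
        rw [hidx _ u.2 _ v.2]
      rw [ev]
      have mono : ∀ j, t.arr 2 j ≠ 0 → (t.setArr 2 (u * n + v) 1).arr 2 j ≠ 0 := by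
        intro j hj
        rw [State.setArr_arr]
        split_ifs
        · exact one_ne_zero
        · exact hj
      refine ⟨⟨h1.trans ?_, fun u' v' hz => ?_⟩, mono, ?_⟩
      · refine ⟨fun _ _ => rfl, fun a ha => ?_⟩
        have : a ≠ 2 := by simpa using ha
        simp [State.setArr, this]
      · rw [State.setArr_arr] at hz
        split_ifs at hz with h
        · have hn : 0 < n := u.pos
          have e1 := congrArg (· / n) h.2
          have e2 := congrArg (· % n) h.2
          simp only [Nat.mul_comm _ n, Nat.mul_add_div hn, Nat.mul_add_mod,
            Nat.div_eq_of_lt v.2, Nat.div_eq_of_lt v'.2, Nat.mod_eq_of_lt v.2,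
            Nat.mod_eq_of_lt v'.2, add_zero] at e1 e2
          rw [Fin.ext e1, Fin.ext e2]
          exact hv
        · exact h2 u' v' hz
      · rintro j ⟨u', m', hm', e2, e3, rfl⟩
        obtain rfl : u = u' := Fin.ext e2
        obtain rfl : m = m' := by omega
        rw [State.setArr_arr, if_pos ⟨rfl, rfl⟩]
        exact one_ne_zero
    · have ev : markEdge.eval w t = t := eval_guard_neg (fun h => he (hol.1 h)) _
      rw [ev]
      refine ⟨⟨h1, h2⟩, fun j hj => hj, ?_⟩
      rintro j ⟨u', m', hm', e2, e3, rfl⟩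
      obtain rfl : u = u' := Fin.ext e2
      exact absurd ⟨by omega, by omega⟩ he
  have hQ : IndepOf ∅ Q := fun ρ ρ' h => by simp only [Q, h _ (Finset.notMem_empty _)]
  have m1 := base.forLt (W := ∅) (by simp [markEdge, vars]) hQ (by simp) hI0 (hI 4 (by simp))
  have m2 := Marks.forLt (R := {2}) (W := {4}) m1 (by simp [markEdge, vars]) (hQ.unionOver _ _) (by simp)
    hI0 (hI 3 (by simp))
  have m3 := Marks.forLt (R := ∅) (W := {3, 4}) m2 (by simp [markEdge, vars])
    ((hQ.unionOver _ _).unionOver _ _) (by simp) hI0 (hI 2 (by simp))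
  obtain ⟨⟨h1, h2⟩, -, h3⟩ := m3 (input L)
    ⟨Agree.refl _ _ _, fun u v h => absurd (by simp [input]) h⟩ (by simp)
  refine ⟨h1.1 0 (by simp), fun u v => ⟨h2 u v, fun h => ?_⟩⟩
  obtain ⟨m, hm, rfl⟩ := List.mem_iff_getElem.1 ((hL u).2 v |>.2 h)
  have hk : offset L u + m < n * n := by
    have := hL.offset_le (u + 1)
    rw [offset_succ] at this
    omega
  refine h3 _ ⟨u, u.2, (offset L u + m) / n, Nat.div_lt_of_lt_mul hk, (offset L u + m) % n,
    Nat.mod_lt _ u.pos, u, m, hm, ?_, ?_, rfl⟩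
  · simp
  · simpa using Nat.div_add_mod' _ _

end Cmd

end WordRAM

/-! ### The search for certificates -/

namespace WordRAM

open SimpleGraph

variable {n w : ℕ} {G : SimpleGraph (Fin n)} {s : State}

namespace Cmd

/-- Sets the flag, in cell `0` of array `12`, if `e` holds. -/
def flagIf (e : Expr) : Cmd := guard e (write 12 (.const 0) (.const 1))

/-- The tests for the membership of the vertex in register `9` in `farFrom`. -/
def farTests : List Expr := [.neg (eqE 9 2), .neg (adjE 2 9)]

/-- The test for `TripleCert`, with the component in array `4` and its neighbors in
array `5`. -/
def tripleTest : Expr :=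
  .all [adjE 2 3, adjE 2 4, adjE 2 5, .neg (eqE 3 4), .neg (adjE 3 4), .neg (eqE 3 5),
    .neg (adjE 3 5), .neg (eqE 4 5), .neg (adjE 4 5), memE 5 3, memE 5 4, memE 5 5]

/-- Sets the flag if the registers `2, 3, 4, 5, 7` satisfy `TripleCert`. -/
def searchTriple : Cmd := seq (comp (.all farTests) 7 4 5) (flagIf tripleTest)

/-- The test for `sectorDom`. -/
def sectorTest : Expr :=
  .all (farTests ++ [.disj (eqE 4 5) (.neg (adjE 5 9)), .disj (eqE 3 6) (.neg (adjE 6 9))])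

/-- The test for `sectorDom'`. -/
def sectorTest' : Expr :=
  .all (farTests ++ [.disj (eqE 4 5) (.neg (adjE 4 9)), .disj (eqE 3 6) (.neg (adjE 3 9)),
    .neg (memE 4 9), .neg (memE 5 9)])

/-- The test for `linkDom`. -/
def linkTest : Expr :=
  .all [.neg (eqE 9 2), .neg (memE 4 9), .neg (memE 6 9), .disj (eqE 9 4) (.neg (memE 5 9)),
    .disj (eqE 9 5) (.neg (memE 7 9)), .neg (eqE 9 3), .neg (eqE 9 6), .neg (adjE 3 9),
    .neg (adjE 6 9)]

/-- The test for `linkDom'`. -/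
def linkTest' : Expr :=
  .all [.neg (eqE 9 2), .neg (memE 4 9), .neg (memE 6 9), .disj (eqE 9 3) (.neg (memE 5 9)),
    .disj (eqE 9 6) (.neg (memE 7 9)), .neg (memE 8 9), .neg (memE 9 9)]

/-- The test for `FrameCert`. -/
def frameTest : Expr :=
  .all [adjE 2 3, adjE 2 4, adjE 2 5, adjE 2 6, memE 5 3, memE 5 4, memE 7 5, memE 7 6, memE 8 5,
    memE 10 6, .neg (.conj (eqE 3 6) (eqE 4 5))]

/-- Sets the flag if the registers `2, …, 8` satisfy `GreedyCert`. The sets `S`, `S'`, `R`, `R'`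
are stored in the arrays `4`, `6`, `8`, `10`, and the sets of their neighbors in the arrays `5`,
`7`, `9`, `11`. -/
def searchGreedy : Cmd :=
  seq (comp sectorTest 7 4 5) <| seq (comp sectorTest' 8 6 7) <| seq (comp linkTest 4 8 9) <|
    seq (comp linkTest' 3 10 11) (flagIf frameTest)

/-- Sets the flag if there are registers `2, …, 8` that satisfy one of the certificates. -/
def search : Cmd :=
  forLt 2 <| forLt 3 <| forLt 4 <| forLt 5 <| forLt 6 <| forLt 7 <| forLt 8 <|
    seq searchTriple searchGreedy

theorem flagIf_spec (hw : (n + 2) ^ 2 ≤ 2 ^ w) (e : Expr) (s : State) :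
    ((flagIf e).eval w s).arr 12 0 ≠ 0 ↔ s.arr 12 0 ≠ 0 ∨ e.Holds w s := by
  have hone : 1 % 2 ^ w = 1 := one_mod_two_pow hw
  by_cases he : e.Holds w s
  · rw [flagIf, eval_guard_pos he]
    simp [eval, Expr.eval, State.setArr_arr, hone, he]
  · rw [flagIf, eval_guard_neg he]
    simp [he]

theorem flagIf_mono (hw : (n + 2) ^ 2 ≤ 2 ^ w) (e : Expr) (s : State) {j : ℕ}
    (hj : s.arr 12 j ≠ 0) : ((flagIf e).eval w s).arr 12 j ≠ 0 := by
  have hone : 1 % 2 ^ w = 1 := one_mod_two_pow hw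
  by_cases he : e.Holds w s
  · rw [flagIf, eval_guard_pos he]
    simp only [eval, Expr.eval, State.setArr_arr, hone]
    split_ifs
    · exact one_ne_zero
    · exact hj
  · rwa [flagIf, eval_guard_neg he]

/-- The registers `2, …, 8` hold the vertices `f 2, …, f 8`. -/
def Regs (f : ℕ → Fin n) (s : State) : Prop :=
  ∀ r, 2 ≤ r → r ≤ 8 → s.var r = f r

theorem Regs.of_agree {f : ℕ → Fin n} {s t : State} {A : Finset ℕ} (h : Regs f s)
    (hst : Agree {9, 10, 11} A s t) : Regs f t := fun r h2 h8 => by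
  rw [hst.1 r (by simp; omega)]
  exact h r h2 h8

theorem searchTriple_spec (hw : (n + 2) ^ 2 ≤ 2 ^ w) (hs : Env G s) {f : ℕ → Fin n}
    (hf : Regs f s) :
    (searchTriple.eval w s).arr 12 0 ≠ 0 ↔
      s.arr 12 0 ≠ 0 ∨ G.TripleCert (f 2) (f 3) (f 4) (f 5) (f 7) := by
  simp only [searchTriple, eval]
  obtain ⟨-, h2⟩ := comp_spec (e := .all farTests) (A := 4) (N := 5) (X := G.farFrom (f 2)) hw hs
    (by norm_num) (by norm_num) (by norm_num) (by norm_num)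
    (hf 7 (by norm_num) (by norm_num)) fun t ht v hv => by
      have E := hs.of_agree ht (by decide) (by decide)
      have r := hf.of_agree ht
      simp only [farTests, Expr.holds_all_cons, Expr.holds_all_nil, Expr.holds_neg,
        holds_eqE hv (r 2 (by norm_num) (by norm_num)),
        holds_adjE hw E (r 2 (by norm_num) (by norm_num)) hv, and_true]
      rfl
  have a := comp_agree (w := w) (.all farTests) 7 4 5 s
  set t := (comp (.all farTests) 7 4 5).eval w s
  have E : Env G t := hs.of_agree a (by decide) (by decide)
  have r := hf.of_agree a
  have r2 := r 2 (by norm_num) (by norm_num)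
  have r3 := r 3 (by norm_num) (by norm_num)
  have r4 := r 4 (by norm_num) (by norm_num)
  have r5 := r 5 (by norm_num) (by norm_num)
  rw [flagIf_spec hw, a.2 12 (by decide), tripleTest]
  simp only [Expr.holds_all_cons, Expr.holds_all_nil, Expr.holds_neg, holds_adjE hw E r2 r3,
    holds_adjE hw E r2 r4, holds_adjE hw E r2 r5, holds_adjE hw E r3 r4, holds_adjE hw E r3 r5,
    holds_adjE hw E r4 r5, holds_eqE r3 r4, holds_eqE r3 r5, holds_eqE r4 r5, holds_memE h2 r3,
    holds_memE h2 r4, holds_memE h2 r5, TripleCert, Set.mem_ofPred_eq, and_assoc, and_true,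
    ne_eq]

theorem searchGreedy_spec (hw : (n + 2) ^ 2 ≤ 2 ^ w) (hs : Env G s) {f : ℕ → Fin n}
    (hf : Regs f s) :
    (searchGreedy.eval w s).arr 12 0 ≠ 0 ↔
      s.arr 12 0 ≠ 0 ∨ G.GreedyCert (f 2) (f 3) (f 4) (f 5) (f 6) (f 7) (f 8) := by
  simp only [searchGreedy, eval]
  set s₁ := (comp sectorTest 7 4 5).eval w s with hs₁
  set s₂ := (comp sectorTest' 8 6 7).eval w s₁ with hs₂
  set s₃ := (comp linkTest 4 8 9).eval w s₂ with hs₃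
  set s₄ := (comp linkTest' 3 10 11).eval w s₃ with hs₄
  have a₁ : Agree {9, 10, 11} {3, 4, 5} s s₁ := comp_agree _ _ _ _ _
  have a₂ : Agree {9, 10, 11} {3, 6, 7} s₁ s₂ := comp_agree _ _ _ _ _
  have a₃ : Agree {9, 10, 11} {3, 8, 9} s₂ s₃ := comp_agree _ _ _ _ _
  have a₄ : Agree {9, 10, 11} {3, 10, 11} s₃ s₄ := comp_agree _ _ _ _ _
  have E₁ : Env G s₁ := hs.of_agree a₁ (by decide) (by decide)
  have E₂ : Env G s₂ := E₁.of_agree a₂ (by decide) (by decide)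
  have E₃ : Env G s₃ := E₂.of_agree a₃ (by decide) (by decide)
  have E₄ : Env G s₄ := E₃.of_agree a₄ (by decide) (by decide)
  have f₁ := hf.of_agree a₁
  have f₂ := f₁.of_agree a₂
  have f₃ := f₂.of_agree a₃
  have f₄ := f₃.of_agree a₄
  obtain ⟨S₁, N₁⟩ := comp_spec (e := sectorTest) (r := 7) (A := 4) (N := 5)
    (X := G.sectorDom (f 2) (f 3) (f 4) (f 5) (f 6)) hw hs
    (by norm_num) (by norm_num) (by norm_num) (by norm_num)
    (hf 7 (by norm_num) (by norm_num)) fun t ht v hv => by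
      have E := hs.of_agree ht (by decide) (by decide)
      have r := hf.of_agree ht
      have r2 := r 2 (by norm_num) (by norm_num)
      have r3 := r 3 (by norm_num) (by norm_num)
      have r4 := r 4 (by norm_num) (by norm_num)
      have r5 := r 5 (by norm_num) (by norm_num)
      have r6 := r 6 (by norm_num) (by norm_num)
      simp only [sectorTest, farTests, List.cons_append, List.nil_append, Expr.holds_all_cons,
        Expr.holds_all_nil, Expr.holds_neg, Expr.holds_disj, holds_eqE hv r2,
        holds_adjE hw E r2 hv, holds_eqE r4 r5, holds_eqE r3 r6, holds_adjE hw E r5 hv,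
        holds_adjE hw E r6 hv, sectorDom, Set.mem_ofPred_eq, and_assoc, and_true, ne_eq]
  rw [← hs₁] at S₁ N₁
  set S := G.compIn (G.sectorDom (f 2) (f 3) (f 4) (f 5) (f 6)) (f 7) with hS
  obtain ⟨S₂, N₂⟩ := comp_spec (e := sectorTest') (r := 8) (A := 6) (N := 7)
    (X := G.sectorDom' (f 2) (f 3) (f 4) (f 5) (f 6) S) hw E₁
    (by norm_num) (by norm_num) (by norm_num) (by norm_num)
    (f₁ 8 (by norm_num) (by norm_num)) fun t ht v hv => by
      have E := E₁.of_agree ht (by decide) (by decide)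
      have r := f₁.of_agree ht
      have r2 := r 2 (by norm_num) (by norm_num)
      have r3 := r 3 (by norm_num) (by norm_num)
      have r4 := r 4 (by norm_num) (by norm_num)
      have r5 := r 5 (by norm_num) (by norm_num)
      have r6 := r 6 (by norm_num) (by norm_num)
      simp only [sectorTest', farTests, List.cons_append, List.nil_append, Expr.holds_all_cons,
        Expr.holds_all_nil, Expr.holds_neg, Expr.holds_disj, holds_eqE hv r2,
        holds_adjE hw E r2 hv, holds_eqE r4 r5, holds_eqE r3 r6, holds_adjE hw E r4 hv,
        holds_adjE hw E r3 hv, holds_memE (S₁.of_agree ht (by decide)) hv,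
        holds_memE (N₁.of_agree ht (by decide)) hv, sectorDom', Set.mem_ofPred_eq, and_assoc,
        and_true, ne_eq]
  rw [← hs₂] at S₂ N₂
  set S' := G.compIn (G.sectorDom' (f 2) (f 3) (f 4) (f 5) (f 6) S) (f 8) with hS'
  replace S₁ := S₁.of_agree a₂ (by decide)
  replace N₁ := N₁.of_agree a₂ (by decide)
  obtain ⟨S₃, N₃⟩ := comp_spec (e := linkTest) (r := 4) (A := 8) (N := 9)
    (X := G.linkDom (f 2) (f 3) (f 4) (f 5) (f 6) S S') hw E₂
    (by norm_num) (by norm_num) (by norm_num) (by norm_num)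
    (f₂ 4 (by norm_num) (by norm_num)) fun t ht v hv => by
      have E := E₂.of_agree ht (by decide) (by decide)
      have r := f₂.of_agree ht
      have r2 := r 2 (by norm_num) (by norm_num)
      have r3 := r 3 (by norm_num) (by norm_num)
      have r4 := r 4 (by norm_num) (by norm_num)
      have r5 := r 5 (by norm_num) (by norm_num)
      have r6 := r 6 (by norm_num) (by norm_num)
      simp only [linkTest, Expr.holds_all_cons, Expr.holds_all_nil, Expr.holds_neg,
        Expr.holds_disj, holds_eqE hv r2, holds_eqE hv r3, holds_eqE hv r4, holds_eqE hv r5,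
        holds_eqE hv r6, holds_adjE hw E r3 hv, holds_adjE hw E r6 hv,
        holds_memE (S₁.of_agree ht (by decide)) hv, holds_memE (N₁.of_agree ht (by decide)) hv,
        holds_memE (S₂.of_agree ht (by decide)) hv, holds_memE (N₂.of_agree ht (by decide)) hv,
        linkDom, Set.mem_ofPred_eq, and_assoc, and_true, ne_eq]
  rw [← hs₃] at S₃ N₃
  set R := G.compIn (G.linkDom (f 2) (f 3) (f 4) (f 5) (f 6) S S') (f 4) with hR
  replace S₁ := S₁.of_agree a₃ (by decide)
  replace N₁ := N₁.of_agree a₃ (by decide)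
  replace S₂ := S₂.of_agree a₃ (by decide)
  replace N₂ := N₂.of_agree a₃ (by decide)
  obtain ⟨S₄, -⟩ := comp_spec (e := linkTest') (r := 3) (A := 10) (N := 11)
    (X := G.linkDom' (f 2) (f 3) (f 6) S S' R) hw E₃
    (by norm_num) (by norm_num) (by norm_num) (by norm_num)
    (f₃ 3 (by norm_num) (by norm_num)) fun t ht v hv => by
      have r := f₃.of_agree ht
      have r2 := r 2 (by norm_num) (by norm_num)
      have r3 := r 3 (by norm_num) (by norm_num)
      have r6 := r 6 (by norm_num) (by norm_num)
      simp only [linkTest', Expr.holds_all_cons, Expr.holds_all_nil, Expr.holds_neg,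
        Expr.holds_disj, holds_eqE hv r2, holds_eqE hv r3, holds_eqE hv r6,
        holds_memE (S₁.of_agree ht (by decide)) hv, holds_memE (N₁.of_agree ht (by decide)) hv,
        holds_memE (S₂.of_agree ht (by decide)) hv, holds_memE (N₂.of_agree ht (by decide)) hv,
        holds_memE (S₃.of_agree ht (by decide)) hv, holds_memE (N₃.of_agree ht (by decide)) hv,
        linkDom', Set.mem_ofPred_eq, and_true, ne_eq]
  rw [← hs₄] at S₄
  set R' := G.compIn (G.linkDom' (f 2) (f 3) (f 6) S S' R) (f 3) with hR'
  replace N₁ := N₁.of_agree a₄ (by decide)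
  replace N₂ := N₂.of_agree a₄ (by decide)
  replace S₃ := S₃.of_agree a₄ (by decide)
  have r2 := f₄ 2 (by norm_num) (by norm_num)
  have r3 := f₄ 3 (by norm_num) (by norm_num)
  have r4 := f₄ 4 (by norm_num) (by norm_num)
  have r5 := f₄ 5 (by norm_num) (by norm_num)
  have r6 := f₄ 6 (by norm_num) (by norm_num)
  have htest : frameTest.Holds w s₄ ↔
      G.FrameCert (f 2) (f 3) (f 4) (f 5) (f 6) S S' R R' := by
    simp only [frameTest, Expr.holds_all_cons, Expr.holds_all_nil, Expr.holds_neg,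
      Expr.holds_conj, holds_adjE hw E₄ r2 r3, holds_adjE hw E₄ r2 r4, holds_adjE hw E₄ r2 r5,
      holds_adjE hw E₄ r2 r6, holds_memE N₁ r3, holds_memE N₁ r4, holds_memE N₂ r5,
      holds_memE N₂ r6, holds_memE S₃ r5, holds_memE S₄ r6, holds_eqE r3 r6, holds_eqE r4 r5,
      FrameCert, Set.mem_ofPred_eq, and_true]
  rw [flagIf_spec hw, htest, a₄.2 12 (by decide), a₃.2 12 (by decide), a₂.2 12 (by decide),
    a₁.2 12 (by decide)]
  refine or_congr_right ⟨fun h => ⟨S, S', R, R', rfl, rfl, rfl, rfl, h⟩, ?_⟩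
  rintro ⟨_, _, _, _, rfl, rfl, rfl, rfl, h⟩
  exact h

theorem search_spec (hw : (n + 2) ^ 2 ≤ 2 ^ w) (hs : Env G s) (h12 : s.arr 12 0 = 0) :
    (search.eval w s).arr 12 0 ≠ 0 ↔
      ∃ x a b c d y z, G.TripleCert x a b c y ∨ G.GreedyCert x a b c d y z := by
  set P : Fin n → Fin n → Fin n → Fin n → Fin n → Fin n → Fin n → Prop :=
    fun x a b c d y z => G.TripleCert x a b c y ∨ G.GreedyCert x a b c d y z with hP
  let I : State → Prop := fun t => Env G t ∧ (t.arr 12 0 ≠ 0 → ∃ x a b c d y z, P x a b c d y z)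
  let Q : (ℕ → ℕ) → Set ℕ := fun ρ => {j | j = 0 ∧ ∃ x a b c d y z : Fin n, ρ 2 = x ∧ ρ 3 = a ∧
    ρ 4 = b ∧ ρ 5 = c ∧ ρ 6 = d ∧ ρ 7 = y ∧ ρ 8 = z ∧ P x a b c d y z}
  have hI0 : ∀ t, I t → t.var 0 = n := fun t ht => ht.1.var_zero
  have hI : ∀ r, r ≠ 0 → ∀ t i, I t → I (t.setVar r i) := fun r hr t i ht =>
    ⟨ht.1.of_agree (Agree.setVar (X := {r}) (A := ∅) t (by simp) i) (by simpa using hr.symm)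
      (by simp), ht.2⟩
  have vars_body : (seq searchTriple searchGreedy).vars ⊆ {9, 10, 11} := by decide
  have arrs_body : (seq searchTriple searchGreedy).arrs ⊆ {3, 4, 5, 6, 7, 8, 9, 10, 11, 12} := by
    decide
  have base : Marks w n I {8, 7, 6, 5, 4, 3, 2} (seq searchTriple searchGreedy) 12 Q := by
    intro t ht htr
    have hpos : 0 < n := (Nat.zero_le _).trans_lt (htr 2 (by simp))
    let f : ℕ → Fin n := fun r => if h : t.var r < n then ⟨t.var r, h⟩ else ⟨0, hpos⟩
    have hf : Regs f t := by
      intro r h2 h8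
      have : t.var r < n := htr r (by simp; omega)
      simp [f, this]
    have a₁ : Agree {9, 10, 11} {3, 4, 5, 12} t (searchTriple.eval w t) :=
      (eval_agree _ t).mono (by decide) (by decide)
    have E₁ : Env G (searchTriple.eval w t) := ht.1.of_agree a₁ (by decide) (by decide)
    have hflag : ((seq searchTriple searchGreedy).eval w t).arr 12 0 ≠ 0 ↔
        t.arr 12 0 ≠ 0 ∨ P (f 2) (f 3) (f 4) (f 5) (f 6) (f 7) (f 8) := by
      rw [eval, searchGreedy_spec hw E₁ (hf.of_agree a₁), searchTriple_spec hw ht.1 hf, or_assoc]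
    have mono : ∀ j, t.arr 12 j ≠ 0 →
        ((seq searchTriple searchGreedy).eval w t).arr 12 j ≠ 0 := by
      intro j hj
      simp only [searchTriple, searchGreedy, eval]
      refine flagIf_mono hw _ _ ?_
      rw [(comp_agree _ _ _ _ _).2 12 (by decide), (comp_agree _ _ _ _ _).2 12 (by decide),
        (comp_agree _ _ _ _ _).2 12 (by decide), (comp_agree _ _ _ _ _).2 12 (by decide)]
      refine flagIf_mono hw _ _ ?_
      rwa [(comp_agree _ _ _ _ _).2 12 (by decide)]
    refine ⟨⟨ht.1.of_agree ((eval_agree _ t).mono vars_body arrs_body) (by decide) (by decide),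
      fun h => ?_⟩, mono, ?_⟩
    · rcases hflag.1 h with h | h
      · exact ht.2 h
      · exact ⟨_, _, _, _, _, _, _, h⟩
    · rintro j ⟨rfl, x, a, b, c, d, y, z, h2, h3, h4, h5, h6, h7, h8, h⟩
      have hfr : ∀ r, 2 ≤ r → r ≤ 8 → ∀ v : Fin n, t.var r = v → f r = v := fun r h2 h8 v hv =>
        Fin.ext ((hf r h2 h8).symm.trans hv)
      refine hflag.2 (.inr ?_)
      rwa [hfr 2 (by norm_num) (by norm_num) _ h2, hfr 3 (by norm_num) (by norm_num) _ h3,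
        hfr 4 (by norm_num) (by norm_num) _ h4, hfr 5 (by norm_num) (by norm_num) _ h5,
        hfr 6 (by norm_num) (by norm_num) _ h6, hfr 7 (by norm_num) (by norm_num) _ h7,
        hfr 8 (by norm_num) (by norm_num) _ h8]
  have hQ : IndepOf {9, 10, 11} Q := fun ρ ρ' h => by
    simp only [Q, h 2 (by decide), h 3 (by decide), h 4 (by decide), h 5 (by decide),
      h 6 (by decide), h 7 (by decide), h 8 (by decide)]
  have hv := vars_body
  have m8 := base.forLt hv hQ (by decide) hI0 (hI 8 (by decide))
  replace hv := Finset.insert_subset_insert 8 hv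
  replace hQ := hQ.unionOver n 8
  have m7 := Marks.forLt m8 hv hQ (by decide) hI0 (hI 7 (by decide))
  replace hv := Finset.insert_subset_insert 7 hv
  replace hQ := hQ.unionOver n 7
  have m6 := Marks.forLt m7 hv hQ (by decide) hI0 (hI 6 (by decide))
  replace hv := Finset.insert_subset_insert 6 hv
  replace hQ := hQ.unionOver n 6
  have m5 := Marks.forLt m6 hv hQ (by decide) hI0 (hI 5 (by decide))
  replace hv := Finset.insert_subset_insert 5 hv
  replace hQ := hQ.unionOver n 5
  have m4 := Marks.forLt m5 hv hQ (by decide) hI0 (hI 4 (by decide))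
  replace hv := Finset.insert_subset_insert 4 hv
  replace hQ := hQ.unionOver n 4
  have m3 := Marks.forLt (R := {2}) m4 hv hQ (by decide) hI0 (hI 3 (by decide))
  replace hv := Finset.insert_subset_insert 3 hv
  replace hQ := hQ.unionOver n 3
  have m2 := Marks.forLt (R := ∅) m3 hv hQ (by simp) hI0 (hI 2 (by decide))
  obtain ⟨⟨-, h1⟩, -, h2⟩ := m2 s ⟨hs, fun h => absurd h12 h⟩ (by simp)
  refine ⟨h1, ?_⟩
  rintro ⟨x, a, b, c, d, y, z, h⟩
  refine h2 0 ⟨x, x.2, a, a.2, b, b.2, c, c.2, d, d.2, y, y.2, z, z.2, rfl, x, a, b, c, d, y, z,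
    ?_, ?_, ?_, ?_, ?_, ?_, ?_, h⟩ <;> simp

end Cmd

end WordRAM

/-! ### The decision procedure -/

theorem lemmal :
    ∃ (p : WordRAM.Program) (κ C : ℕ),
      ∀ (n : ℕ) (G : SimpleGraph (Fin n)) (L : Fin n → List (Fin n)) (w : ℕ),
        WordRAM.IsAdjLists G L → (n + 2) ^ κ ≤ 2 ^ w →
        ¬ G.HasLongPrism → ¬ G.HasPyramid → ¬ G.HasTheta →
        ∃ (t : ℕ) (s : WordRAM.State),
          WordRAM.Exec w p (WordRAM.input L) t s ∧
          t ≤ C * (n ^ 13 * (n + G.edgeSet.ncard) + 1) ∧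
          (G.HasBrokenWheel → s.var 0 = 1) ∧
          (¬ G.HasBrokenWheel → s.var 0 = 0) := by
  set p := WordRAM.Cmd.seq .matrix .search with hp
  have hdepth : p.depth = 10 := by decide
  refine ⟨.seq p.toProgram (.assign 0 (.lt (.const 0) (.read 12 (.const 0)))), 2,
    1024 * p.factor + 6, fun n G L w hL hw hρ hπ hθ => ?_⟩
  have hn : n < 2 ^ w := by nlinarith
  have hWF : p.WF := by
    simp [hp, WordRAM.Cmd.matrix, WordRAM.Cmd.search, WordRAM.Cmd.WF, WordRAM.Cmd.vars,
      WordRAM.Cmd.markEdge, WordRAM.Cmd.searchTriple, WordRAM.Cmd.searchGreedy,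
      WordRAM.Cmd.comp, WordRAM.Cmd.fill, WordRAM.Cmd.mark, WordRAM.Cmd.flagIf]
  obtain ⟨t, ht, hb⟩ := p.exec_eval hn hWF (by decide) (WordRAM.input L) rfl
  refine ⟨_, _, .seq ht (.assign 0 _ _), ?_, ?_⟩
  · rw [hdepth] at hb
    simp only [WordRAM.Expr.cost]
    have key : (n + 1) ^ 10 ≤ 1024 * (n ^ 13 * (n + G.edgeSet.ncard) + 1) := by
      rcases Nat.eq_zero_or_pos n with rfl | hpos
      · simp
      · calc (n + 1) ^ 10 ≤ (2 * n) ^ 10 := Nat.pow_le_pow_left (by omega) 10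
          _ = 1024 * n ^ 10 := by ring
          _ ≤ 1024 * n ^ 14 := Nat.mul_le_mul_left _ (Nat.pow_le_pow_right hpos (by norm_num))
          _ = 1024 * (n ^ 13 * n) := by ring
          _ ≤ 1024 * (n ^ 13 * (n + G.edgeSet.ncard) + 1) := Nat.mul_le_mul_left _
              ((Nat.mul_le_mul_left _ (Nat.le_add_right _ _)).trans (Nat.le_succ _))
    calc t + 5 ≤ p.factor * (1024 * (n ^ 13 * (n + G.edgeSet.ncard) + 1)) + 6 := by
          have := Nat.mul_le_mul_left p.factor key
          omega
      _ ≤ p.factor * (1024 * (n ^ 13 * (n + G.edgeSet.ncard) + 1)) +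
          6 * (n ^ 13 * (n + G.edgeSet.ncard) + 1) := by omega
      _ = (1024 * p.factor + 6) * (n ^ 13 * (n + G.edgeSet.ncard) + 1) := by ring
  · have hm := WordRAM.Cmd.env_matrix hw hL
    have h12 : (WordRAM.Cmd.matrix.eval w (WordRAM.input L)).arr 12 0 = 0 := by
      rw [(WordRAM.Cmd.matrix_agree _).2 12 (by decide)]
      simp [WordRAM.input]
    have hflag := (WordRAM.Cmd.search_spec hw hm h12).trans
      (SimpleGraph.hasBrokenWheel_iff_cert hρ hπ hθ).symm
    constructor
    · intro h
      have := hflag.2 h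
      simpa [hp, WordRAM.Expr.eval, WordRAM.Cmd.eval] using this
    · intro h
      have := not_not.1 (mt hflag.1 h)
      simp [hp, WordRAM.Expr.eval, WordRAM.Cmd.eval, this]
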